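/- **Setting.** Fix $\alpha\in(0,1]$ and $Y=[0,1]$. Let $\{(c_m,d_m)\}$ be a countable partition mod $0$ of $Y$ into open intervals and let $F:Y\to Y$ be $C^{1+\alpha}$ on each $(c_m,d_m)$, such that $F|_{(c_m,d_m)}$ extends to a homeomorphism from $[c_m,d_m]$ onto $Y$. Let $\mathcal H$ be the family of inverse branches $h:Y\to[c_m,d_m]$ of $F$, and $\mathcal H_n$ the family of inverse branches of $F^n$ (the $n$-fold compositions of elements of $\mathcal H$). Suppose that there are $C_1\ge1$ and $\rho_0\in(0,1)$ such that (i) $|h'|_\infty\le C_1\rho_0^n$ for all $h\in\mathcal H_n$ and all $n$; (ii) $\big|\log|h'|(x)-\log|h'|(y)\big|\le C_1|x-y|^\alpha$ for all $h\in\mathcal H$, $x,y\in Y$. Let $R:Y\to\mathbb R^+$ be $C^1$ on each $(c_m,d_m)$ with $\inf R>0$, such that (iii) $|(R\circ h)'|_\infty\le C_1$ for all $h\in\mathcal H$; (iv) $\sum_{h\in\mathcal H}e^{\epsilon_0|R\circ h|_\infty}|h'|_\infty<\infty$ for some $\epsilon_0>0$. (The functions $R\circ h$, defined on $(0,1)$,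 are extended continuously to $Y$.) Write $R_n=\sum_{j=0}^{n-1}R\circ F^j$. For $v:Y\to\mathbb C$ let $|v|_\alpha=\sup_{x\ne y}|v(x)-v(y)|/|x-y|^\alpha$, let $C^\alpha(Y)$ be the space of $v$ with $|v|_\infty,|v|_\alpha<\infty$, and for $b\in\mathbb R$ let $$\|v\|_b=\max\{|v|_\infty,\ |v|_\alpha/(1+|b|^\alpha)\}.$$ For $s\in\mathbb C$ let $P_s$ be the twisted transfer operator $P_sv=\sum_{h\in\mathcal H}e^{-sR\circ h}\,|h'|\,v\circ h$. For an operator on $C^\alpha(Y)$, $\|\cdot\|_b$ also denotes the operator norm. **Theorem.** Given $\alpha$, $C_1$, $\rho_0$ and $F$ as above, there are constants $C_3>1$ and $C_4\ge 6C_3$ (independent of $R$) with the following property. Let $R$ be as above and suppose that uniform nonintegrability (UNI) holds: there are $D>0$, $n_0\ge1$ and $h_1,h_2\in\mathcal H_{n_0}$ with $$\inf_{(0,1)}\big|(R_{n_0}\circ h_1-R_{n_0}\circ h_2)'\big|\ge D,$$ where $n_0$ is sufficiently large in the sense that, with $\rho=\rho_0^\alpha$, $$C_1^\alpha C_4\rho^{n_0}(4\pi/D)^\alpha\le\tfrac14\big(2-2\cos\tfrac{\pi}{12}\big)^{1/2},\qquad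 2\rho^{n_0}(1+C_1^\alpha C_4)\le1,\qquad C_3\rho^{n_0}\le\tfrac13 .$$ Then there exist $\epsilon\in(0,1)$, $\gamma\in(0,1)$ and $A>0$ such that, for all $s$ with $|\operatorname{Re}s|<\epsilon$, the series defining $P_sv$ converges absolutely at each point for every $v\in C^\alpha(Y)$ and $P_s$ maps $C^\alpha(Y)$ into itself, and $$\|P_s^n\|_b\le\gamma^n$$ for all $s=\sigma+ib$ with $|\sigma|<\epsilon$, $|b|\ge\max\{4\pi/D,2\}$ and all integers $n\ge A\log|b|$. -/

import Mathlib

open Set MeasureTheory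
open scoped ENNReal

namespace ExpandingSemiflow

/-- The base space `Y = [0,1]`, as a subset of the line. -/
abbrev Y : Set ℝ := Icc (0 : ℝ) 1

/-- A countable full-branch piecewise `C^{1+α}` map `F : Y → Y`: the intervals `(c m, d m)` form a
partition of `Y` mod 0, `F` is `C^{1+α}` on each of them, and the restriction of `F` to `(c m, d m)`
extends to a homeomorphism from `[c m, d m]` onto `Y`. The inverse of that homeomorphism is recorded
as `h m`; only the values of `h m` on `Y` matter, and these are determined by `F`, `c` and `d`. -/
structure FullBranchMap (α : ℝ) (ι : Type*) where
  F : ℝ → ℝ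
  c : ι → ℝ
  d : ι → ℝ
  h : ι → ℝ → ℝ
  mapsTo_F : MapsTo F Y Y
  c_lt_d : ∀ m, c m < d m
  Icc_subset : ∀ m, Icc (c m) (d m) ⊆ Y
  disjoint : Pairwise fun m k => Disjoint (Ioo (c m) (d m)) (Ioo (c k) (d k))
  null_compl : volume (Y \ ⋃ m, Ioo (c m) (d m)) = 0
  contDiffOn_F : ∀ m, ContDiffOn ℝ 1 F (Ioo (c m) (d m))
  holder_deriv_F : ∀ m, ∃ K : ℝ, ∀ x ∈ Ioo (c m) (d m), ∀ y ∈ Ioo (c m) (d m),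
    |deriv F x - deriv F y| ≤ K * |x - y| ^ α
  continuousOn_h : ∀ m, ContinuousOn (h m) Y
  bijOn_h : ∀ m, BijOn (h m) Y (Icc (c m) (d m))
  F_h : ∀ m, ∀ y ∈ Ioo (0 : ℝ) 1, F (h m y) = y

namespace FullBranchMap

variable {α : ℝ} {ι : Type*} (T : FullBranchMap α ι)

theorem h_mem (m : ι) {y : ℝ} (hy : y ∈ Y) : T.h m y ∈ Y :=
  T.Icc_subset m ((T.bijOn_h m).mapsTo hy)

/-- The composition `h_{m₁} ∘ ⋯ ∘ h_{mₙ}` along a word `m₁ ⋯ mₙ`. -/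
def branch : List ι → ℝ → ℝ
  | [] => id
  | m :: w => T.h m ∘ branch w

/-- The family `ℋ_n` of inverse branches of `F^n`. -/
def inverseBranches (n : ℕ) : Set (ℝ → ℝ) :=
  {g | ∃ w : List ι, w.length = n ∧ g = T.branch w}

/-- `F` is a `C^{1+α}` uniformly expanding map with constants `C₁`, `ρ₀`. Derivatives of inverse
branches are derivatives on `Y`, that is, one-sided at the end points `0` and `1`. -/
structure IsUniformlyExpanding (C₁ ρ₀ : ℝ) : Prop where
  one_le_C : 1 ≤ C₁
  rho_mem : ρ₀ ∈ Ioo (0 : ℝ) 1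
  differentiableOn_h : ∀ m, DifferentiableOn ℝ (T.h m) Y
  deriv_h_ne_zero : ∀ m, ∀ y ∈ Y, derivWithin (T.h m) Y y ≠ 0
  contracting : ∀ n, ∀ g ∈ T.inverseBranches n, ∀ y ∈ Y, |derivWithin g Y y| ≤ C₁ * ρ₀ ^ n
  distortion : ∀ m, ∀ x ∈ Y, ∀ y ∈ Y,
    |Real.log (|derivWithin (T.h m) Y x|) - Real.log (|derivWithin (T.h m) Y y|)| ≤ C₁ * |x - y| ^ α

/-- The sup norm of a function on a set; it is used for bounded functions only. -/
noncomputable def supNormOn (S : Set ℝ) (f : ℝ → ℝ) : ℝ := ⨆ y : S, |f y|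

/-- The conditions on the roof function `R` that make the suspension over `F` a `C^{1+α}` expanding
semiflow. As `R` is `C¹` on the open partition elements, `R ∘ h m` is considered on `(0,1)`. -/
structure IsExpandingRoof (C₁ : ℝ) (R : ℝ → ℝ) : Prop where
  contDiffOn : ∀ m, ContDiffOn ℝ 1 R (Ioo (T.c m) (T.d m))
  inf_pos : ∃ r : ℝ, 0 < r ∧ ∀ x ∈ Y, r ≤ R x
  deriv_le : ∀ m, ∀ y ∈ Ioo (0 : ℝ) 1, |deriv (R ∘ T.h m) y| ≤ C₁
  exp_tail : ∃ ε : ℝ, 0 < ε ∧ Summable fun m : ι =>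
    Real.exp (ε * supNormOn (Ioo 0 1) (R ∘ T.h m)) * supNormOn Y (derivWithin (T.h m) Y)

/-- Uniform nonintegrability at time `n` with constant `D`: there are two inverse branches `g₁`, `g₂`
of `F^n` such that `ψ = R_n ∘ g₁ - R_n ∘ g₂` satisfies `inf |ψ'| ≥ D`, where `R_n` is the Birkhoff
sum of `R`. -/
def UNI (R : ℝ → ℝ) (D : ℝ) (n : ℕ) : Prop :=
  ∃ g₁ ∈ T.inverseBranches n, ∃ g₂ ∈ T.inverseBranches n, ∀ y ∈ Ioo (0 : ℝ) 1,
    D ≤ |deriv (fun t => birkhoffSum T.F R n (g₁ t) - birkhoffSum T.F R n (g₂ t)) y|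

/-- The function `R ∘ h m` on `Y`: the continuous extension to `[0,1]` of its restriction to
`(0,1)`. -/
noncomputable def roofBranch (R : ℝ → ℝ) (m : ι) : ℝ → ℝ :=
  extendFrom (Ioo (0 : ℝ) 1) (R ∘ T.h m)

/-- The function `A_{s,h} v = e^{-s R ∘ h} |h'| v ∘ h` for the inverse branch `h = h m`. -/
noncomputable def branchOperator (R : ℝ → ℝ) (s : ℂ) (m : ι) (v : Y → ℂ) (y : Y) : ℂ :=
  Complex.exp (-s * (T.roofBranch R m y : ℂ)) * (|derivWithin (T.h m) Y (y : ℝ)| : ℝ) *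
    v ⟨T.h m y, T.h_mem m y.2⟩

/-- The twisted transfer operator `P_s = ∑ A_{s,h}`, the sum being over all inverse branches. -/
noncomputable def transferOperator (R : ℝ → ℝ) (s : ℂ) (v : Y → ℂ) : Y → ℂ :=
  fun y => ∑' m, T.branchOperator R s m v y

end FullBranchMap

/-- The sup norm `|v|_∞`, with value `∞` for unbounded functions. -/
noncomputable def supNorm (v : Y → ℂ) : ℝ≥0∞ := ⨆ x, ‖v x‖ₑ

/-- The Hölder seminorm `|v|_α`, with value `∞` for functions that are not `α`-Hölder. -/
noncomputable def holderSeminorm (α : ℝ) (v : Y → ℂ) : ℝ≥0∞ :=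
  ⨆ (x : Y) (y : Y) (_ : x ≠ y), ‖v x - v y‖ₑ / ENNReal.ofReal (|(x : ℝ) - (y : ℝ)| ^ α)

/-- The space `C^α(Y)`. -/
def holderSpace (α : ℝ) : Set (Y → ℂ) :=
  {v | max (supNorm v) (holderSeminorm α v) < ∞}

/-- The norm `‖v‖_b = max (|v|_∞, |v|_α / (1 + |b|^α))`. -/
noncomputable def normB (α b : ℝ) (v : Y → ℂ) : ℝ≥0∞ :=
  max (supNorm v) (holderSeminorm α v / ENNReal.ofReal (1 + |b| ^ α))

/-- The operator norm on `C^α(Y)` with respect to `‖·‖_b`: the supremum of `‖P v‖_b` over the unit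
ball (whose elements all lie in `C^α(Y)`). -/
noncomputable def opNormB (α b : ℝ) (P : (Y → ℂ) → (Y → ℂ)) : ℝ≥0∞ :=
  ⨆ (v : Y → ℂ) (_ : normB α b v ≤ 1), normB α b (P v)

/-- The explicit form of the requirement that `n₀` be sufficiently large. -/
structure SufficientlyLarge (α C₁ ρ₀ C₃ C₄ D : ℝ) (n₀ : ℕ) : Prop where
  large₁ : C₁ ^ α * C₄ * (ρ₀ ^ α) ^ n₀ * (4 * Real.pi / D) ^ α
    ≤ 1 / 4 * Real.sqrt (2 - 2 * Real.cos (Real.pi / 12))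
  large₂ : 2 * (ρ₀ ^ α) ^ n₀ * (1 + C₁ ^ α * C₄) ≤ 1
  large₃ : C₃ * (ρ₀ ^ α) ^ n₀ ≤ 1 / 3

end ExpandingSemiflow

/-!
The theorem is proved by Dolgopyat's method: nonintegrability makes the terms of `P_s^n v` cancel on
a definite proportion of `Y`, which gives a contraction in mean square, and smoothing by the
transfer operator turns mean square decay into decay in the Hölder norm. Everything happens for a
`WeightedSystem`, which records the inverse branches, the weights `|h'|`, the roof function seen
through the branches, and the invariance of Lebesgue measure under the unperturbed operator, which
is the change of variables formula (`FullBranchMap.integ_transfer`). The operator `P_s^n` is written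
as a single series over words of length `n`; `Q_σ^n` denotes the operator with the real weights
`e^{-σ R_n ∘ h} |h'|`.

*Normalization without eigenfunctions.* Since `Q_0` preserves Lebesgue measure and the weights have
bounded distortion, the densities `Q_0^k 1` are bounded away from `0` and `∞`. A long Cesàro average
`ψ` of them satisfies `Q_{2σ} ψ ≤ (1 + τ) ψ` for small `σ`, with `τ` as small as desired
(`exists_almost_invariant_density`). No spectral theory is needed: `τ` only has to be small in
comparison with the gain in one step.

*The cone.* A pair `(u, v)` belongs to `Cone` if `u` dominates `|v|` and bounds its oscillation, and
`u` satisfies a Harnack inequality, all at scale `1 / |b|`. Because the branches of length `n₀`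
contract, the cone is invariant under `v ↦ P_s^{n₀} v` together with `u ↦ u'`, where `u'` is
`Q_σ^{n₀} u` with slowly varying damping factors in its terms, as long as `u'` dominates
`P_s^{n₀} v` (`cone_step`).

*Cancellation.* By UNI the difference of the phases of the terms of two words `w₁`, `w₂` runs
through a full circle on every interval of length `2π / (D |b|)`. Hence each such interval contains
a point about which, on a ball of radius `δ / |b|`, the two terms are nearly opposite or one of them
is small, and one of them can be damped (`exists_mem_cancelSet`). By the Cauchy–Schwarz inequality
relative to `ψ` (`damped_sq_le`, `tsum_damping_le`) and the Harnack inequality on intervals of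
length comparable to `1 / |b|` (`integ_le_of_tiles`), the integral of `u² / ψ` decreases by a
definite factor (`exists_cone_contraction`).

*From mean square to Hölder norm.* For `k` of order `log |b|` the branches of length `k` contract
more than the scale `1 / |b|`, so bounded distortion makes `Q_0^k (u² / ψ)` comparable to its
integral, and Cauchy–Schwarz bounds `|P_s^k v|` by the mean square (`norm_P_sq_le_integ`). The
Lasota–Yorke inequality (`norm_P_sub_le'`) then controls the Hölder seminorm, and dividing the time
into three parts of equal order gives the exponential rate (`exists_rate`).
-/

namespace ExpandingSemiflow

/-! ### Words, and operators given by sums over words -/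

universe u

/-- Words of length `n` over the alphabet `ι`, as nested pairs; the first letter is the one whose
branch is applied last. -/
def Word (ι : Type u) : ℕ → Type u
  | 0 => PUnit
  | n + 1 => ι × Word ι n

section Words

variable {ι X 𝕜 : Type*}

/-- The composition `H m₁ ∘ ⋯ ∘ H mₙ` along a word. -/
def wordMap (H : ι → X → X) : (n : ℕ) → Word ι n → X → X
  | 0, _ => id
  | n + 1, (m, w) => H m ∘ wordMap H n w

/-- The multiplicative cocycle generated by `a` along a word: the product of the values of the
`a m` at the points met when the branches of the word are applied one after the other. -/
def wordProd [Monoid 𝕜] (H : ι → X → X) (a : ι → X → 𝕜) : (n : ℕ) → Word ι n → X → 𝕜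
  | 0, _ => fun _ => 1
  | n + 1, (m, w) => fun x => a m (wordMap H n w x) * wordProd H a n w x

/-- The additive cocycle generated by `r` along a word, that is, the Birkhoff sum of `r`. -/
def wordSum [AddMonoid 𝕜] (H : ι → X → X) (r : ι → X → 𝕜) : (n : ℕ) → Word ι n → X → 𝕜
  | 0, _ => fun _ => 0
  | n + 1, (m, w) => fun x => r m (wordMap H n w x) + wordSum H r n w x

/-- The product of a sequence of numbers along a word. -/
def wordMajorant (M : ι → ℝ) : (n : ℕ) → Word ι n → ℝ
  | 0, _ => 1
  | n + 1, (m, w) => M m * wordMajorant M n w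

/-- The weighted transfer operator given by a sum over words of length `n`. -/
noncomputable def wordOp [NormedField 𝕜] (H : ι → X → X) (a : ι → X → 𝕜) (n : ℕ) (v : X → 𝕜)
    (x : X) : 𝕜 :=
  ∑' w : Word ι n, wordProd H a n w x * v (wordMap H n w x)

theorem wordProd_pos (H : ι → X → X) {a : ι → X → ℝ} (ha : ∀ m x, 0 < a m x) (n : ℕ)
    (w : Word ι n) (x : X) : 0 < wordProd H a n w x := by
  induction n with
  | zero => exact one_pos
  | succ n ih => exact mul_pos (ha _ _) (ih _)

theorem wordMajorant_nonneg {M : ι → ℝ} (hM : ∀ m, 0 ≤ M m) (n : ℕ) (w : Word ι n) :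
    0 ≤ wordMajorant M n w := by
  induction n with
  | zero => exact zero_le_one
  | succ n ih => exact mul_nonneg (hM _) (ih _)

theorem summable_wordMajorant {M : ι → ℝ} (hM : ∀ m, 0 ≤ M m) (hs : Summable M) (n : ℕ) :
    Summable (wordMajorant M n) := by
  induction n with
  | zero => exact (hasSum_unique (f := fun _ : PUnit => (1 : ℝ))).summable
  | succ n ih => exact hs.mul_of_nonneg ih hM (wordMajorant_nonneg hM n)

variable [NormedField 𝕜]

theorem norm_wordProd_le (H : ι → X → X) {a : ι → X → 𝕜} {M : ι → ℝ}
    (ha : ∀ m x, ‖a m x‖ ≤ M m) (n : ℕ) (w : Word ι n) (x : X) :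
    ‖wordProd H a n w x‖ ≤ wordMajorant M n w := by
  induction n with
  | zero => exact norm_one.le
  | succ n ih =>
    obtain ⟨m, w⟩ := w
    change ‖a m _ * _‖ ≤ M m * wordMajorant M n w
    rw [norm_mul]
    exact mul_le_mul (ha _ _) (ih _) (norm_nonneg _) ((norm_nonneg _).trans (ha m x))

variable {H : ι → X → X} {a : ι → X → 𝕜} {M : ι → ℝ} {v : X → 𝕜} {B : ℝ}

theorem summable_norm_wordOp (ha : ∀ m x, ‖a m x‖ ≤ M m) (hs : Summable M)
    (hv : ∀ x, ‖v x‖ ≤ B) (n : ℕ) (x : X) :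
    Summable fun w : Word ι n => ‖wordProd H a n w x * v (wordMap H n w x)‖ := by
  have hM : ∀ m, 0 ≤ M m := fun m => (norm_nonneg _).trans (ha m x)
  refine Summable.of_nonneg_of_le (fun _ => norm_nonneg _) (fun w => ?_)
    ((summable_wordMajorant hM hs n).mul_right B)
  rw [norm_mul]
  exact mul_le_mul (norm_wordProd_le H ha n w x) (hv _) (norm_nonneg _)
    (wordMajorant_nonneg hM n w)

theorem summable_wordOp [CompleteSpace 𝕜] (ha : ∀ m x, ‖a m x‖ ≤ M m) (hs : Summable M)
    (hv : ∀ x, ‖v x‖ ≤ B) (n : ℕ) (x : X) :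
    Summable fun w : Word ι n => wordProd H a n w x * v (wordMap H n w x) :=
  (summable_norm_wordOp ha hs hv n x).of_norm

theorem wordOp_zero (H : ι → X → X) (a : ι → X → 𝕜) (v : X → 𝕜) : wordOp H a 0 v = v := by
  funext x
  have h : HasSum (fun w : PUnit => (1 : 𝕜) * v x) (1 * v x) := hasSum_unique _
  exact h.tsum_eq.trans (one_mul _)

theorem wordOp_one (H : ι → X → X) (a : ι → X → 𝕜) (v : X → 𝕜) :
    wordOp H a 1 v = fun x => ∑' m, a m x * v (H m x) := by
  funext x
  let e : ι ≃ Word ι 1 := (Equiv.prodPUnit ι).symm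
  refine (e.tsum_eq _).symm.trans (tsum_congr fun m => ?_)
  change a m x * 1 * v (H m x) = _
  rw [mul_one]

theorem norm_wordOp_le (ha : ∀ m x, ‖a m x‖ ≤ M m) (hs : Summable M)
    (hv : ∀ x, ‖v x‖ ≤ B) (n : ℕ) (x : X) :
    ‖wordOp H a n v x‖ ≤ (∑' w, wordMajorant M n w) * B := by
  have hM : ∀ m, 0 ≤ M m := fun m => (norm_nonneg _).trans (ha m x)
  refine tsum_of_norm_bounded ((summable_wordMajorant hM hs n).hasSum.mul_right B) fun w => ?_
  rw [norm_mul]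
  exact mul_le_mul (norm_wordProd_le H ha n w x) (hv _) (norm_nonneg _)
    (wordMajorant_nonneg hM n w)

variable [CompleteSpace 𝕜]

/-- The operators attached to words form a semigroup. -/
theorem wordOp_succ (ha : ∀ m x, ‖a m x‖ ≤ M m) (hs : Summable M)
    (hv : ∀ x, ‖v x‖ ≤ B) (n : ℕ) :
    wordOp H a (n + 1) v = wordOp H a n (wordOp H a 1 v) := by
  funext x
  have h1 := summable_wordOp (H := H) ha hs hv (n + 1) x
  have h2 : Summable fun p : ι × Word ι n =>
    a p.1 (wordMap H n p.2 x) * wordProd H a n p.2 x * v (H p.1 (wordMap H n p.2 x)) := h1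
  change ∑' p : ι × Word ι n,
    a p.1 (wordMap H n p.2 x) * wordProd H a n p.2 x * v (H p.1 (wordMap H n p.2 x)) = _
  rw [← (Equiv.prodComm (Word ι n) ι).tsum_eq]
  have h3 := (Equiv.prodComm (Word ι n) ι).summable_iff.2 h2
  refine h3.tsum_prod.trans ?_
  refine tsum_congr fun w => ?_
  rw [wordOp_one, ← tsum_mul_left]
  refine tsum_congr fun m => ?_
  change a m (wordMap H n w x) * wordProd H a n w x * v (H m (wordMap H n w x)) = _
  ring

theorem iterate_wordOp (ha : ∀ m x, ‖a m x‖ ≤ M m) (hs : Summable M)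
    (hv : ∀ x, ‖v x‖ ≤ B) (n : ℕ) :
    (wordOp H a 1)^[n] v = wordOp H a n v := by
  induction n generalizing v B with
  | zero => rw [wordOp_zero]; rfl
  | succ n ih =>
    rw [Function.iterate_succ_apply, wordOp_succ ha hs hv n, ih (norm_wordOp_le ha hs hv 1)]

theorem wordOp_add (ha : ∀ m x, ‖a m x‖ ≤ M m) (hs : Summable M)
    (hv : ∀ x, ‖v x‖ ≤ B) (n k : ℕ) :
    wordOp H a (n + k) v = wordOp H a n (wordOp H a k v) := by
  rw [← iterate_wordOp ha hs hv, Function.iterate_add_apply, iterate_wordOp ha hs hv,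
    iterate_wordOp ha hs (norm_wordOp_le ha hs hv k)]

end Words

theorem wordOp_mono {ι X : Type*} {H : ι → X → X} {a : ι → X → ℝ} {M : ι → ℝ} {u v : X → ℝ}
    {A B : ℝ} (ha : ∀ m x, ‖a m x‖ ≤ M m) (hs : Summable M) (ha0 : ∀ m x, 0 < a m x)
    (hu : ∀ x, ‖u x‖ ≤ A) (hv : ∀ x, ‖v x‖ ≤ B) (huv : ∀ x, u x ≤ v x) (n : ℕ) (x : X) :
    wordOp H a n u x ≤ wordOp H a n v x :=
  (summable_wordOp ha hs hu n x).tsum_le_tsum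
    (fun w => mul_le_mul_of_nonneg_left (huv _) (wordProd_pos H ha0 n w x).le)
    (summable_wordOp ha hs hv n x)

/-- The Cauchy–Schwarz inequality for series of nonnegative terms. -/
theorem tsum_sq_le_tsum_mul_tsum {J : Type*} {f g k : J → ℝ} (hf0 : ∀ i, 0 ≤ f i)
    (hg0 : ∀ i, 0 ≤ g i) (hf : Summable f) (hg : Summable g) (hk : Summable k)
    (h : ∀ i, k i ^ 2 ≤ f i * g i) : (∑' i, k i) ^ 2 ≤ (∑' i, f i) * ∑' i, g i := by
  refine le_of_tendsto ((hk.hasSum.pow 2)) (Filter.Eventually.of_forall fun s => ?_)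
  refine (Finset.sum_sq_le_sum_mul_sum_of_sq_le_mul s (fun i _ => hf0 i) (fun i _ => hg0 i)
    fun i _ => h i).trans ?_
  exact mul_le_mul (hf.sum_le_tsum _ fun i _ => hf0 i) (hg.sum_le_tsum _ fun i _ => hg0 i)
    (Finset.sum_nonneg fun i _ => hg0 i) (tsum_nonneg hf0)

/-! ### Weighted systems of contractions of the interval -/

/-- The integral over `[0,1]` of a function on the subtype `Y`. -/
noncomputable def integ (f : Y → ℝ) : ℝ :=
  ∫ x in (0 : ℝ)..1, f (projIcc 0 1 zero_le_one x)

/-- A bound for the Lipschitz constants of all Birkhoff sums of the roof along words. -/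
noncomputable def roofConst (C₁ ρ₀ : ℝ) : ℝ := C₁ * C₁ / (1 - ρ₀)

/-- A bound for the Hölder constants of the logarithms of all derivatives along words. -/
noncomputable def distortionConst (α C₁ ρ₀ : ℝ) : ℝ := C₁ * C₁ ^ α / (1 - ρ₀ ^ α)

/-- A bound for the Hölder constants of the logarithms of all real weights along words. -/
noncomputable def weightConst (α C₁ ρ₀ : ℝ) : ℝ := roofConst C₁ ρ₀ + distortionConst α C₁ ρ₀

theorem dist_le_one (x y : Y) : dist x y ≤ 1 := by
  rw [Subtype.dist_eq, Real.dist_eq, abs_le]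
  constructor <;> linarith [x.2.1, x.2.2, y.2.1, y.2.2]

theorem geom_sum_le_inv {q : ℝ} (h0 : 0 ≤ q) (h1 : q < 1) (n : ℕ) :
    ∑ k ∈ Finset.range n, q ^ k ≤ 1 / (1 - q) := by
  rw [one_div, ← tsum_geometric_of_lt_one h0 h1]
  exact (summable_geometric_of_lt_one h0 h1).sum_le_tsum _ fun k _ => pow_nonneg h0 k

/-- The data on `Y` used by the Dolgopyat argument: the inverse branches `H m`, the absolute values
`J m` of their derivatives, and the roof function `r m` seen through the branches, with the bounds
that follow from uniform expansion. The family `M` dominates the weights `exp (-σ r m) * J m` for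
`|σ| ≤ ε₀`, and `integ_transfer` says that the transfer operator preserves Lebesgue measure. -/
structure WeightedSystem (ι : Type*) (α C₁ ρ₀ : ℝ) where
  H : ι → Y → Y
  J : ι → Y → ℝ
  r : ι → Y → ℝ
  M : ι → ℝ
  ε₀ : ℝ
  α_pos : 0 < α
  α_le : α ≤ 1
  one_le_C : 1 ≤ C₁
  rho_pos : 0 < ρ₀
  rho_lt : ρ₀ < 1
  J_pos : ∀ m y, 0 < J m y
  contracting : ∀ n (w : Word ι n) x y,
    dist (wordMap H n w x) (wordMap H n w y) ≤ C₁ * ρ₀ ^ n * dist x y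
  distortion : ∀ m x y, J m x ≤ J m y * Real.exp (C₁ * dist x y ^ α)
  roof_lipschitz : ∀ m x y, |r m x - r m y| ≤ C₁ * dist x y
  ε₀_pos : 0 < ε₀
  summable_M : Summable M
  tail : ∀ m y, Real.exp (ε₀ * |r m y|) * J m y ≤ M m
  integ_transfer : ∀ f : Y → ℝ, Continuous f → (∀ y, 0 ≤ f y) →
    integ (fun y => ∑' m, J m y * f (H m y)) = integ f

namespace WeightedSystem

variable {ι : Type*} {α C₁ ρ₀ : ℝ} (S : WeightedSystem ι α C₁ ρ₀)
include S

theorem dist_rpow_le_one (x y : Y) : dist x y ^ α ≤ 1 :=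
  Real.rpow_le_one dist_nonneg (dist_le_one x y) S.α_pos.le

theorem dist_le_rpow (x y : Y) : dist x y ≤ dist x y ^ α := by
  have h := Real.rpow_le_rpow_of_exponent_ge' dist_nonneg (dist_le_one x y) S.α_pos.le S.α_le
  rwa [Real.rpow_one] at h

theorem C_pos : 0 < C₁ := one_pos.trans_le S.one_le_C

theorem rho_rpow_pos : 0 < ρ₀ ^ α := Real.rpow_pos_of_pos S.rho_pos _

theorem rho_rpow_lt : ρ₀ ^ α < 1 := Real.rpow_lt_one S.rho_pos.le S.rho_lt S.α_pos

theorem C_rpow_pos : 0 < C₁ ^ α := Real.rpow_pos_of_pos S.C_pos _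

theorem one_le_roofConst : 1 ≤ roofConst C₁ ρ₀ := by
  rw [roofConst, le_div_iff₀ (by linarith [S.rho_lt])]
  nlinarith [S.one_le_C, S.rho_pos]

theorem distortionConst_pos : 0 < distortionConst α C₁ ρ₀ :=
  div_pos (mul_pos S.C_pos S.C_rpow_pos) (by linarith [S.rho_rpow_lt])

theorem weightConst_pos : 0 < weightConst α C₁ ρ₀ := by
  have := S.one_le_roofConst
  have := S.distortionConst_pos
  unfold weightConst
  linarith

theorem wordMap_dist_rpow (n : ℕ) (w : Word ι n) (x y : Y) :
    dist (wordMap S.H n w x) (wordMap S.H n w y) ^ α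
      ≤ C₁ ^ α * (ρ₀ ^ α) ^ n * dist x y ^ α := by
  refine (Real.rpow_le_rpow dist_nonneg (S.contracting n w x y) S.α_pos.le).trans_eq ?_
  rw [Real.mul_rpow (by have := S.C_pos; have := S.rho_pos; positivity) dist_nonneg,
    Real.mul_rpow S.C_pos.le (pow_nonneg S.rho_pos.le _), ← Real.rpow_natCast,
    ← Real.rpow_natCast, ← Real.rpow_mul S.rho_pos.le, ← Real.rpow_mul S.rho_pos.le,
    mul_comm α]

theorem continuous_wordMap (n : ℕ) (w : Word ι n) : Continuous (wordMap S.H n w) := by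
  have h : LipschitzWith (C₁ * ρ₀ ^ n).toNNReal (wordMap S.H n w) :=
    LipschitzWith.of_dist_le_mul fun x y => by
      rw [Real.coe_toNNReal _ (by have := S.C_pos; have := S.rho_pos; positivity)]
      exact S.contracting n w x y
  exact h.continuous

/-- The derivative cocycle `|h'|` along a word. -/
noncomputable def jac (n : ℕ) (w : Word ι n) (y : Y) : ℝ := wordProd S.H S.J n w y

/-- The Birkhoff sum of the roof function along a word. -/
noncomputable def birk (n : ℕ) (w : Word ι n) (y : Y) : ℝ := wordSum S.H S.r n w y

theorem jac_pos (n : ℕ) (w : Word ι n) (y : Y) : 0 < S.jac n w y := wordProd_pos _ S.J_pos n w y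

theorem jac_le_aux (n : ℕ) (w : Word ι n) (x y : Y) :
    S.jac n w x ≤ S.jac n w y *
      Real.exp (C₁ * C₁ ^ α * (∑ k ∈ Finset.range n, (ρ₀ ^ α) ^ k) * dist x y ^ α) := by
  induction n with
  | zero => simp [jac, wordProd]
  | succ n ih =>
    obtain ⟨m, w⟩ := w
    change S.J m (wordMap S.H n w x) * S.jac n w x
      ≤ S.J m (wordMap S.H n w y) * S.jac n w y * _
    have h1 := S.distortion m (wordMap S.H n w x) (wordMap S.H n w y)
    have h2 := mul_le_mul_of_nonneg_left (S.wordMap_dist_rpow n w x y) S.C_pos.le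
    have h3 := h1.trans (mul_le_mul_of_nonneg_left (Real.exp_le_exp.2 h2) (S.J_pos _ _).le)
    refine (mul_le_mul h3 (ih w) (S.jac_pos n w x).le
      (mul_nonneg (S.J_pos _ _).le (Real.exp_pos _).le)).trans_eq ?_
    rw [mul_mul_mul_comm, ← Real.exp_add, Finset.sum_range_succ]
    congr 2
    ring

/-- Bounded distortion: the branches contract, so the distortions along a word form a geometric
series. -/
theorem jac_le (n : ℕ) (w : Word ι n) (x y : Y) :
    S.jac n w x ≤ S.jac n w y * Real.exp (distortionConst α C₁ ρ₀ * dist x y ^ α) := by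
  refine (S.jac_le_aux n w x y).trans ?_
  refine mul_le_mul_of_nonneg_left (Real.exp_le_exp.2 ?_) (S.jac_pos n w y).le
  refine mul_le_mul_of_nonneg_right ?_ (Real.rpow_nonneg dist_nonneg _)
  rw [distortionConst, div_eq_mul_one_div]
  exact mul_le_mul_of_nonneg_left (geom_sum_le_inv S.rho_rpow_pos.le S.rho_rpow_lt n)
    (mul_pos S.C_pos S.C_rpow_pos).le

theorem birk_sub_le_aux (n : ℕ) (w : Word ι n) (x y : Y) :
    |S.birk n w x - S.birk n w y| ≤
      C₁ * C₁ * (∑ k ∈ Finset.range n, ρ₀ ^ k) * dist x y := by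
  induction n with
  | zero => simp [birk, wordSum]
  | succ n ih =>
    obtain ⟨m, w⟩ := w
    change |S.r m (wordMap S.H n w x) + S.birk n w x
      - (S.r m (wordMap S.H n w y) + S.birk n w y)| ≤ _
    rw [add_sub_add_comm]
    refine (abs_add_le _ _).trans ?_
    have h1 := (S.roof_lipschitz m (wordMap S.H n w x) (wordMap S.H n w y)).trans
      (mul_le_mul_of_nonneg_left (S.contracting n w x y) S.C_pos.le)
    rw [Finset.sum_range_succ]
    linarith [ih w]

theorem birk_sub_le (n : ℕ) (w : Word ι n) (x y : Y) :
    |S.birk n w x - S.birk n w y| ≤ roofConst C₁ ρ₀ * dist x y := by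
  refine (S.birk_sub_le_aux n w x y).trans ?_
  refine mul_le_mul_of_nonneg_right ?_ dist_nonneg
  rw [roofConst, div_eq_mul_one_div]
  exact mul_le_mul_of_nonneg_left (geom_sum_le_inv S.rho_pos.le S.rho_lt n)
    (mul_pos S.C_pos S.C_pos).le

theorem continuous_birk (n : ℕ) (w : Word ι n) : Continuous (S.birk n w) := by
  have h0 := S.one_le_roofConst
  have h : LipschitzWith (roofConst C₁ ρ₀).toNNReal (S.birk n w) :=
    LipschitzWith.of_dist_le_mul fun x y => by
      rw [Real.coe_toNNReal _ (by linarith)]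
      exact S.birk_sub_le n w x y
  exact h.continuous

/-- The real weights `e^{-σ R ∘ h} |h'|`. -/
noncomputable def weight (σ : ℝ) (m : ι) (y : Y) : ℝ := Real.exp (-σ * S.r m y) * S.J m y

/-- The complex weights `e^{-s R ∘ h} |h'|`. -/
noncomputable def cweight (s : ℂ) (m : ι) (y : Y) : ℂ :=
  Complex.exp (-s * (S.r m y : ℂ)) * (S.J m y : ℂ)

/-- The real weights along words. -/
noncomputable def G (σ : ℝ) (n : ℕ) (w : Word ι n) (y : Y) : ℝ :=
  wordProd S.H (S.weight σ) n w y

/-- The complex weights along words. -/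
noncomputable def E (s : ℂ) (n : ℕ) (w : Word ι n) (y : Y) : ℂ :=
  wordProd S.H (S.cweight s) n w y

theorem weight_pos (σ : ℝ) (m : ι) (y : Y) : 0 < S.weight σ m y :=
  mul_pos (Real.exp_pos _) (S.J_pos _ _)

theorem G_pos (σ : ℝ) (n : ℕ) (w : Word ι n) (y : Y) : 0 < S.G σ n w y :=
  wordProd_pos _ (S.weight_pos σ) n w y

theorem G_eq (σ : ℝ) (n : ℕ) (w : Word ι n) (y : Y) :
    S.G σ n w y = Real.exp (-σ * S.birk n w y) * S.jac n w y := by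
  induction n with
  | zero => exact (by simp : (1 : ℝ) = Real.exp (-σ * 0) * 1)
  | succ n ih =>
    obtain ⟨m, w⟩ := w
    change Real.exp (-σ * S.r m (wordMap S.H n w y)) * S.J m (wordMap S.H n w y) * S.G σ n w y
      = Real.exp (-σ * (S.r m (wordMap S.H n w y) + S.birk n w y))
        * (S.J m (wordMap S.H n w y) * S.jac n w y)
    rw [ih w, mul_add, Real.exp_add]
    ring

theorem E_eq (s : ℂ) (n : ℕ) (w : Word ι n) (y : Y) :
    S.E s n w y = Complex.exp (-s * (S.birk n w y : ℂ)) * (S.jac n w y : ℂ) := by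
  induction n with
  | zero => exact (by simp : (1 : ℂ) = Complex.exp (-s * ((0 : ℝ) : ℂ)) * ((1 : ℝ) : ℂ))
  | succ n ih =>
    obtain ⟨m, w⟩ := w
    change Complex.exp (-s * (S.r m (wordMap S.H n w y) : ℂ)) * (S.J m (wordMap S.H n w y) : ℂ)
        * S.E s n w y
      = Complex.exp (-s * ((S.r m (wordMap S.H n w y) + S.birk n w y : ℝ) : ℂ))
        * ((S.J m (wordMap S.H n w y) * S.jac n w y : ℝ) : ℂ)
    rw [ih w]
    push_cast
    rw [mul_add, Complex.exp_add]
    ring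

/-- The complex weight is the real weight times a unimodular factor. -/
theorem E_eq_G (s : ℂ) (n : ℕ) (w : Word ι n) (y : Y) :
    S.E s n w y = (S.G s.re n w y : ℂ)
      * Complex.exp ((-(s.im * S.birk n w y) : ℝ) * Complex.I) := by
  rw [E_eq, G_eq]
  push_cast
  rw [mul_right_comm, ← Complex.exp_add]
  congr 2
  conv_lhs => rw [← Complex.re_add_im s]
  ring

theorem norm_E (s : ℂ) (n : ℕ) (w : Word ι n) (y : Y) : ‖S.E s n w y‖ = S.G s.re n w y := by
  rw [E_eq_G, norm_mul, Complex.norm_exp_ofReal_mul_I, mul_one, Complex.norm_real,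
    Real.norm_of_nonneg (S.G_pos _ _ _ _).le]

/-- The real weights have distortion bounded uniformly in the length of the word. -/
theorem G_le {σ : ℝ} (hσ : |σ| ≤ 1) (n : ℕ) (w : Word ι n) (x y : Y) :
    S.G σ n w x ≤ S.G σ n w y * Real.exp (weightConst α C₁ ρ₀ * dist x y ^ α) := by
  rw [G_eq, G_eq]
  have h1 : -σ * S.birk n w x ≤ -σ * S.birk n w y + roofConst C₁ ρ₀ * dist x y ^ α := by
    have h2 := S.birk_sub_le n w y x
    have h3 : σ * (S.birk n w y - S.birk n w x) ≤ 1 * (roofConst C₁ ρ₀ * dist y x) := by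
      refine (le_abs_self _).trans ?_
      rw [abs_mul]
      exact mul_le_mul hσ h2 (abs_nonneg _) zero_le_one
    have h4 := mul_le_mul_of_nonneg_left (S.dist_le_rpow x y)
      (zero_le_one.trans S.one_le_roofConst)
    rw [dist_comm y x] at h3
    linarith
  refine (mul_le_mul (Real.exp_le_exp.2 h1) (S.jac_le n w x y) (S.jac_pos n w x).le
    (Real.exp_pos _).le).trans_eq ?_
  rw [Real.exp_add, weightConst, add_mul, Real.exp_add]
  ring

theorem M_nonneg (m : ι) : 0 ≤ S.M m :=
  (mul_nonneg (Real.exp_pos _).le (S.J_pos m ⟨0, by simp⟩).le).trans (S.tail m ⟨0, by simp⟩)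

theorem norm_weight_le {σ : ℝ} (hσ : |σ| ≤ S.ε₀) (m : ι) (y : Y) : ‖S.weight σ m y‖ ≤ S.M m := by
  rw [Real.norm_of_nonneg (S.weight_pos σ m y).le]
  refine le_trans ?_ (S.tail m y)
  refine mul_le_mul_of_nonneg_right (Real.exp_le_exp.2 ?_) (S.J_pos _ _).le
  calc -σ * S.r m y ≤ |-σ * S.r m y| := le_abs_self _
    _ = |σ| * |S.r m y| := by rw [abs_mul, abs_neg]
    _ ≤ _ := mul_le_mul_of_nonneg_right hσ (abs_nonneg _)

theorem norm_cweight (s : ℂ) (m : ι) (y : Y) : ‖S.cweight s m y‖ = S.weight s.re m y := by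
  rw [cweight, weight, norm_mul, Complex.norm_exp, Complex.norm_real,
    Real.norm_of_nonneg (S.J_pos _ _).le]
  simp

theorem norm_cweight_le {s : ℂ} (hs : |s.re| ≤ S.ε₀) (m : ι) (y : Y) :
    ‖S.cweight s m y‖ ≤ S.M m := by
  rw [norm_cweight]
  exact (le_abs_self _).trans (S.norm_weight_le hs m y)

/-- The weights depend on `σ` in a Lipschitz way at `0`, by convexity of the exponential. -/
theorem weight_le_add {σ : ℝ} (hσ : |σ| ≤ S.ε₀) (m : ι) (y : Y) :
    S.weight σ m y ≤ S.J m y + |σ| / S.ε₀ * S.M m := by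
  have ht0 : 0 ≤ |σ| / S.ε₀ := div_nonneg (abs_nonneg _) S.ε₀_pos.le
  have ht1 : |σ| / S.ε₀ ≤ 1 := (div_le_one S.ε₀_pos).2 hσ
  have h1 : Real.exp (-σ * S.r m y) ≤ 1 + |σ| / S.ε₀ * Real.exp (S.ε₀ * |S.r m y|) := by
    have h2 : -σ * S.r m y ≤ |σ| / S.ε₀ * (S.ε₀ * |S.r m y|) := by
      rw [← mul_assoc, div_mul_cancel₀ _ S.ε₀_pos.ne', ← abs_neg σ, ← abs_mul]
      exact le_abs_self _
    refine (Real.exp_le_exp.2 h2).trans ?_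
    have h3 := convexOn_exp.2 (mem_univ (0 : ℝ)) (mem_univ (S.ε₀ * |S.r m y|))
      (sub_nonneg.2 ht1) ht0 (sub_add_cancel 1 _)
    simp only [smul_eq_mul, mul_zero, zero_add, Real.exp_zero, mul_one] at h3
    linarith
  calc S.weight σ m y ≤ (1 + |σ| / S.ε₀ * Real.exp (S.ε₀ * |S.r m y|)) * S.J m y :=
        mul_le_mul_of_nonneg_right h1 (S.J_pos _ _).le
    _ = S.J m y + |σ| / S.ε₀ * (Real.exp (S.ε₀ * |S.r m y|) * S.J m y) := by ring
    _ ≤ _ := by gcongr; exact S.tail m y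

theorem weight_zero : S.weight 0 = S.J := by
  funext m y
  simp [weight]

theorem G_zero (n : ℕ) (w : Word ι n) (y : Y) : S.G 0 n w y = S.jac n w y := by
  rw [G, weight_zero, jac]

/-- The real transfer operator `Q_σ^n`. -/
noncomputable def Q (σ : ℝ) (n : ℕ) (u : Y → ℝ) : Y → ℝ := wordOp S.H (S.weight σ) n u

/-- The complex transfer operator `P_s^n`. -/
noncomputable def P (s : ℂ) (n : ℕ) (v : Y → ℂ) : Y → ℂ := wordOp S.H (S.cweight s) n v

theorem Q_apply (σ : ℝ) (n : ℕ) (u : Y → ℝ) (y : Y) :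
    S.Q σ n u y = ∑' w : Word ι n, S.G σ n w y * u (wordMap S.H n w y) := rfl

theorem P_apply (s : ℂ) (n : ℕ) (v : Y → ℂ) (y : Y) :
    S.P s n v y = ∑' w : Word ι n, S.E s n w y * v (wordMap S.H n w y) := rfl

variable {S}

theorem summable_Q {σ B : ℝ} {u : Y → ℝ} (hσ : |σ| ≤ S.ε₀) (hu : ∀ y, |u y| ≤ B) (n : ℕ) (y : Y) :
    Summable fun w : Word ι n => S.G σ n w y * u (wordMap S.H n w y) :=
  summable_wordOp (S.norm_weight_le hσ) S.summable_M hu n y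

theorem summable_G {σ : ℝ} (hσ : |σ| ≤ S.ε₀) (n : ℕ) (y : Y) :
    Summable fun w : Word ι n => S.G σ n w y := by
  simpa using summable_Q (u := fun _ => 1) (B := 1) hσ (by simp) n y

theorem summable_norm_P {s : ℂ} {B : ℝ} {v : Y → ℂ} (hs : |s.re| ≤ S.ε₀) (hv : ∀ y, ‖v y‖ ≤ B)
    (n : ℕ) (y : Y) :
    Summable fun w : Word ι n => ‖S.E s n w y * v (wordMap S.H n w y)‖ :=
  summable_norm_wordOp (S.norm_cweight_le hs) S.summable_M hv n y

theorem Q_mono {σ A B : ℝ} {u v : Y → ℝ} (hσ : |σ| ≤ S.ε₀) (hu : ∀ y, |u y| ≤ A)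
    (hv : ∀ y, |v y| ≤ B) (huv : ∀ y, u y ≤ v y) (n : ℕ) (y : Y) : S.Q σ n u y ≤ S.Q σ n v y :=
  wordOp_mono (S.norm_weight_le hσ) S.summable_M (S.weight_pos σ) hu hv huv n y

theorem Q_bounded {σ B : ℝ} {u : Y → ℝ} (hσ : |σ| ≤ S.ε₀) (hu : ∀ y, |u y| ≤ B) (n : ℕ) :
    ∃ B', ∀ y, |S.Q σ n u y| ≤ B' :=
  ⟨_, norm_wordOp_le (S.norm_weight_le hσ) S.summable_M hu n⟩

theorem P_bounded {s : ℂ} {B : ℝ} {v : Y → ℂ} (hs : |s.re| ≤ S.ε₀) (hv : ∀ y, ‖v y‖ ≤ B)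
    (n : ℕ) : ∃ B', ∀ y, ‖S.P s n v y‖ ≤ B' :=
  ⟨_, norm_wordOp_le (S.norm_cweight_le hs) S.summable_M hv n⟩

theorem Q_zero (σ : ℝ) (u : Y → ℝ) : S.Q σ 0 u = u := wordOp_zero _ _ _

theorem P_zero (s : ℂ) (v : Y → ℂ) : S.P s 0 v = v := wordOp_zero _ _ _

theorem Q_add {σ B : ℝ} {u : Y → ℝ} (hσ : |σ| ≤ S.ε₀) (hu : ∀ y, |u y| ≤ B) (n k : ℕ) :
    S.Q σ (n + k) u = S.Q σ n (S.Q σ k u) :=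
  wordOp_add (S.norm_weight_le hσ) S.summable_M hu n k

theorem P_add {s : ℂ} {B : ℝ} {v : Y → ℂ} (hs : |s.re| ≤ S.ε₀) (hv : ∀ y, ‖v y‖ ≤ B)
    (n k : ℕ) : S.P s (n + k) v = S.P s n (S.P s k v) :=
  wordOp_add (S.norm_cweight_le hs) S.summable_M hv n k

theorem norm_P_le {s : ℂ} {B : ℝ} {v : Y → ℂ} {u : Y → ℝ} (hs : |s.re| ≤ S.ε₀)
    (hu : ∀ y, |u y| ≤ B) (hvu : ∀ y, ‖v y‖ ≤ u y) (n : ℕ) (y : Y) :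
    ‖S.P s n v y‖ ≤ S.Q s.re n u y := by
  refine tsum_of_norm_bounded (summable_Q hs hu n y).hasSum fun w => ?_
  change ‖S.E s n w y * _‖ ≤ _
  rw [norm_mul, norm_E]
  exact mul_le_mul_of_nonneg_left (hvu _) (S.G_pos _ _ _ _).le

/-- Bounded distortion for the transfer operator. -/
theorem Q_le_Q_mul_exp {σ B c : ℝ} {u : Y → ℝ} (hσ : |σ| ≤ S.ε₀) (hσ1 : |σ| ≤ 1)
    (hu : ∀ y, |u y| ≤ B) (hu0 : ∀ y, 0 ≤ u y) (n : ℕ) (x y : Y)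
    (h : ∀ w : Word ι n, u (wordMap S.H n w x) ≤ u (wordMap S.H n w y) * Real.exp c) :
    S.Q σ n u x ≤ S.Q σ n u y * Real.exp (weightConst α C₁ ρ₀ * dist x y ^ α + c) := by
  rw [Q_apply, Q_apply, ← tsum_mul_right]
  refine (summable_Q hσ hu n x).tsum_le_tsum (fun w => ?_) ((summable_Q hσ hu n y).mul_right _)
  refine (mul_le_mul (S.G_le hσ1 n w x y) (h w) (hu0 _)
    (mul_nonneg (S.G_pos _ _ _ _).le (Real.exp_pos _).le)).trans_eq ?_
  rw [Real.exp_add]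
  ring

end WeightedSystem

/-! ### Integration over the interval -/

theorem integ_mono {f g : Y → ℝ} (hf : Continuous f) (hg : Continuous g) (h : ∀ y, f y ≤ g y) :
    integ f ≤ integ g :=
  intervalIntegral.integral_mono_on zero_le_one
    ((hf.comp continuous_projIcc).intervalIntegrable _ _)
    ((hg.comp continuous_projIcc).intervalIntegrable _ _) fun _ _ => h _

theorem integ_const (c : ℝ) : integ (fun _ => c) = c := by simp [integ]

theorem integ_const_mul (c : ℝ) (f : Y → ℝ) : integ (fun y => c * f y) = c * integ f :=
  intervalIntegral.integral_const_mul _ _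

theorem integ_sub {f g : Y → ℝ} (hf : Continuous f) (hg : Continuous g) :
    integ (fun y => f y - g y) = integ f - integ g :=
  intervalIntegral.integral_sub ((hf.comp continuous_projIcc).intervalIntegrable _ _)
    ((hg.comp continuous_projIcc).intervalIntegrable _ _)

theorem integ_nonneg {f : Y → ℝ} (h : ∀ y, 0 ≤ f y) : 0 ≤ integ f :=
  intervalIntegral.integral_nonneg zero_le_one fun _ _ => h _

theorem exists_bound_of_continuous {f : Y → ℝ} (hf : Continuous f) : ∃ B, ∀ y, |f y| ≤ B := by
  obtain ⟨B, hB⟩ := isCompact_univ.exists_bound_of_continuousOn hf.continuousOn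
  exact ⟨B, fun y => hB y (mem_univ y)⟩

/-- A function with a Harnack inequality at all scales is continuous. -/
theorem continuous_of_le_mul_exp {α c : ℝ} (hα : 0 < α) {f : Y → ℝ}
    (h : ∀ x y, f x ≤ f y * Real.exp (c * dist x y ^ α)) : Continuous f := by
  refine continuous_iff_continuousAt.2 fun y => ?_
  have hd : Filter.Tendsto (fun x : Y => dist x y ^ α) (nhds y) (nhds 0) := by
    have h1 : Continuous fun x : Y => dist x y ^ α :=
      (continuous_id.dist continuous_const).rpow_const fun _ => Or.inr hα.le
    have h2 := h1.tendsto y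
    rwa [dist_self, Real.zero_rpow hα.ne'] at h2
  have h3 : ∀ e : ℝ, Filter.Tendsto (fun x : Y => f y * Real.exp (e * dist x y ^ α)) (nhds y)
      (nhds (f y)) := fun e => by
    have h4 := ((Real.continuous_exp.tendsto _).comp (hd.const_mul e)).const_mul (f y)
    simpa using h4
  refine tendsto_of_tendsto_of_tendsto_of_le_of_le (h3 (-c)) (h3 c) (fun x => ?_) fun x => h x y
  have h5 := mul_le_mul_of_nonneg_right (h y x) (Real.exp_pos (-c * dist x y ^ α)).le
  rw [mul_assoc, ← Real.exp_add, dist_comm y x] at h5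
  simpa using h5

namespace WeightedSystem

/-! ### The unperturbed operator and its almost invariant densities -/

variable {ι : Type*} {α C₁ ρ₀ : ℝ} {S : WeightedSystem ι α C₁ ρ₀}

theorem continuous_G {σ : ℝ} (hσ : |σ| ≤ 1) (n : ℕ) (w : Word ι n) : Continuous (S.G σ n w) :=
  continuous_of_le_mul_exp S.α_pos (S.G_le hσ n w)

theorem continuous_Q {σ : ℝ} {u : Y → ℝ} (hσ : |σ| ≤ S.ε₀) (hσ1 : |σ| ≤ 1) (hu : Continuous u)
    (n : ℕ) : Continuous (S.Q σ n u) := by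
  obtain ⟨B, hB⟩ := exists_bound_of_continuous hu
  refine continuous_tsum (u := fun w : Word ι n => wordMajorant S.M n w * B) (fun w =>
    (continuous_G hσ1 n w).mul (hu.comp (S.continuous_wordMap n w)))
    ((summable_wordMajorant S.M_nonneg S.summable_M n).mul_right B) fun w y => ?_
  rw [norm_mul]
  exact mul_le_mul (norm_wordProd_le S.H (S.norm_weight_le hσ) n w y) (hB _) (norm_nonneg _)
    (wordMajorant_nonneg S.M_nonneg n w)

theorem Q_nonneg {σ : ℝ} {u : Y → ℝ} (hu : ∀ y, 0 ≤ u y) (n : ℕ) (y : Y) : 0 ≤ S.Q σ n u y :=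
  tsum_nonneg fun _ => mul_nonneg (S.G_pos _ _ _ _).le (hu _)

theorem Q_const_mul (σ c : ℝ) (n : ℕ) (u : Y → ℝ) (y : Y) :
    S.Q σ n (fun x => c * u x) y = c * S.Q σ n u y := by
  rw [Q_apply, Q_apply, ← tsum_mul_left]
  exact tsum_congr fun w => by ring

theorem abs_zero_le : |(0 : ℝ)| ≤ S.ε₀ := by rw [abs_zero]; exact S.ε₀_pos.le

theorem integ_Q_zero {u : Y → ℝ} (hu : Continuous u) (hu0 : ∀ y, 0 ≤ u y) (n : ℕ) :
    integ (S.Q 0 n u) = integ u := by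
  obtain ⟨B, hB⟩ := exists_bound_of_continuous hu
  induction n with
  | zero => rw [Q_zero]
  | succ n ih =>
    rw [add_comm, Q_add S.abs_zero_le hB, ← ih,
      ← S.integ_transfer _ (continuous_Q S.abs_zero_le (by simp) hu n) (Q_nonneg hu0 n)]
    rw [Q, wordOp_one, weight_zero]

/-- Distortion bounds make the oscillation of `Q_0^n 1` bounded, and its integral is `1`. -/
theorem Q_zero_one_bounds (n : ℕ) (y : Y) :
    Real.exp (-weightConst α C₁ ρ₀) ≤ S.Q 0 n (fun _ => 1) y ∧
      S.Q 0 n (fun _ => 1) y ≤ Real.exp (weightConst α C₁ ρ₀) := by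
  have hH : ∀ x y, S.Q 0 n (fun _ => 1) x
      ≤ S.Q 0 n (fun _ => 1) y * Real.exp (weightConst α C₁ ρ₀) := fun x y => by
    have h1 := Q_le_Q_mul_exp (B := 1) (c := 0) S.abs_zero_le (by simp) (u := fun _ => 1)
      (by simp) (by simp) n x y (by simp)
    refine h1.trans (mul_le_mul_of_nonneg_left (Real.exp_le_exp.2 ?_)
      (Q_nonneg (fun _ => zero_le_one) n y))
    rw [add_zero]
    exact mul_le_of_le_one_right S.weightConst_pos.le (S.dist_rpow_le_one x y)
  have hI : integ (S.Q 0 n (fun _ => 1)) = 1 := by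
    rw [integ_Q_zero continuous_const (fun _ => zero_le_one), integ_const]
  have hc : Continuous (S.Q 0 n fun _ => 1) :=
    continuous_Q S.abs_zero_le (by simp) continuous_const n
  constructor
  · have h2 := integ_mono hc continuous_const fun x => hH x y
    rw [hI, integ_const] at h2
    rw [Real.exp_neg]
    exact (inv_le_iff_one_le_mul₀ (Real.exp_pos _)).2 h2
  · have h2 := integ_mono continuous_const (hc.const_mul (Real.exp (weightConst α C₁ ρ₀)))
      fun x => (hH y x).trans_eq (mul_comm _ _)
    rwa [integ_const, integ_const_mul, hI, mul_one] at h2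

theorem abs_Q_zero_one_le (k : ℕ) (y : Y) :
    |S.Q 0 k (fun _ => 1) y| ≤ Real.exp (weightConst α C₁ ρ₀) := by
  rw [abs_of_nonneg (Q_nonneg (fun _ => zero_le_one) k y)]
  exact (Q_zero_one_bounds k y).2

/-- Applying `Q_0` to the sum of the densities `Q_0^k 1` over `k < N` shifts the summation index. -/
theorem Q_sum_iterates (N : ℕ) (y : Y) :
    S.Q 0 1 (fun x => ∑ k ∈ Finset.range N, S.Q 0 k (fun _ => 1) x) y
      = ∑ k ∈ Finset.range N, S.Q 0 (k + 1) (fun _ => 1) y := by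
  rw [Q_apply]
  simp_rw [Finset.mul_sum]
  rw [Summable.tsum_finsetSum fun k _ =>
    summable_Q S.abs_zero_le (abs_Q_zero_one_le k) 1 y]
  refine Finset.sum_congr rfl fun k _ => ?_
  rw [add_comm, Q_add S.abs_zero_le (u := fun _ => 1) (B := 1) (by simp)]
  rfl

/-- The operators `Q_σ` are a perturbation of `Q_0`, of size proportional to `σ`. -/
theorem Q_one_le_add {σ B : ℝ} {u : Y → ℝ} (hσ : |σ| ≤ S.ε₀) (hu0 : ∀ y, 0 ≤ u y)
    (hu : ∀ y, u y ≤ B) (y : Y) :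
    S.Q σ 1 u y ≤ S.Q 0 1 u y + |σ| / S.ε₀ * (∑' m, S.M m) * B := by
  have hB : ∀ y, |u y| ≤ B := fun y => by rw [abs_of_nonneg (hu0 y)]; exact hu y
  have hB0 : 0 ≤ B := (hu0 y).trans (hu y)
  have e : ∀ σ, S.Q σ 1 u y = ∑' m, S.weight σ m y * u (S.H m y) := fun σ => by
    rw [Q, wordOp_one]
  have hs : ∀ {σ}, |σ| ≤ S.ε₀ → Summable fun m => S.weight σ m y * u (S.H m y) := fun {σ} hσ => by
    refine Summable.of_norm_bounded (S.summable_M.mul_right B) fun m => ?_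
    rw [norm_mul]
    exact mul_le_mul (S.norm_weight_le hσ m y) (hB _) (norm_nonneg _) (S.M_nonneg m)
  rw [e, e, ← tsum_mul_left, ← tsum_mul_right, weight_zero]
  have hs0 := hs S.abs_zero_le
  rw [weight_zero] at hs0
  have hsM := (S.summable_M.mul_left (|σ| / S.ε₀)).mul_right B
  rw [← hs0.tsum_add hsM]
  refine (hs hσ).tsum_le_tsum (fun m => ?_) (hs0.add hsM)
  refine (mul_le_mul_of_nonneg_right (S.weight_le_add hσ m y) (hu0 _)).trans ?_
  rw [add_mul]
  gcongr
  · exact mul_nonneg (div_nonneg (abs_nonneg _) S.ε₀_pos.le) (S.M_nonneg m)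
  · exact hu _

/-- For every `τ > 0` there is a density with distortion bounds independent of `τ` which is
expanded by a factor of at most `1 + τ` under all operators `Q_{2σ}` with `σ` small. It is a Cesàro
average of the densities `Q_0^k 1`; it replaces the eigenfunctions of the operators. -/
theorem exists_almost_invariant_density (S : WeightedSystem ι α C₁ ρ₀) {τ : ℝ} (hτ : 0 < τ) :
    ∃ ψ : Y → ℝ, ∃ ε : ℝ, 0 < ε ∧ 2 * ε ≤ S.ε₀ ∧
      (∀ y, Real.exp (-weightConst α C₁ ρ₀) ≤ ψ y) ∧
      (∀ y, ψ y ≤ Real.exp (weightConst α C₁ ρ₀)) ∧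
      (∀ x y, ψ x ≤ ψ y * Real.exp (weightConst α C₁ ρ₀ * dist x y ^ α)) ∧
      ∀ σ : ℝ, |σ| ≤ ε → ∀ n y, S.Q (2 * σ) n ψ y ≤ (1 + τ) ^ n * ψ y := by
  set κ := weightConst α C₁ ρ₀ with hκ
  have hM0 : 0 ≤ ∑' m, S.M m := tsum_nonneg S.M_nonneg
  obtain ⟨N, hN⟩ := exists_nat_gt (2 * Real.exp κ * Real.exp κ / τ)
  have hN0 : (0 : ℝ) < N := lt_of_le_of_lt (by positivity) hN
  rw [div_lt_iff₀ hτ] at hN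
  have hε0 := S.ε₀_pos
  set ε := min (S.ε₀ / 2) (τ * S.ε₀ / (4 * ((∑' m, S.M m) + 1) * (Real.exp κ * Real.exp κ)))
    with hε
  have hεpos : 0 < ε := lt_min (by positivity) (by positivity)
  have hε1 : 2 * ε ≤ S.ε₀ := by
    have h1 : ε ≤ S.ε₀ / 2 := min_le_left _ _
    linarith
  have hε2 : 2 * ε / S.ε₀ * (∑' m, S.M m) * (Real.exp κ * Real.exp κ) ≤ τ / 2 := by
    have h1 : ε ≤ τ * S.ε₀ / (4 * ((∑' m, S.M m) + 1) * (Real.exp κ * Real.exp κ)) :=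
      min_le_right _ _
    rw [le_div_iff₀ (by positivity)] at h1
    rw [div_mul_eq_mul_div, div_mul_eq_mul_div, div_le_iff₀ hε0]
    have h2 : 0 ≤ ε * (Real.exp κ * Real.exp κ) := by positivity
    nlinarith
  set q : ℕ → Y → ℝ := fun k => S.Q 0 k (fun _ => 1) with hq
  set φ : Y → ℝ := fun x => ∑ k ∈ Finset.range N, q k x with hφ
  have hexp : Real.exp (-κ) * Real.exp κ = 1 := by rw [← Real.exp_add]; simp
  have hφlow : ∀ y, N * Real.exp (-κ) ≤ φ y := fun y => by
    have := Finset.card_nsmul_le_sum (Finset.range N) (fun k => q k y) (Real.exp (-κ))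
      fun k _ => (Q_zero_one_bounds k y).1
    simpa using this
  have hφup : ∀ y, φ y ≤ N * Real.exp κ := fun y => by
    have := Finset.sum_le_card_nsmul (Finset.range N) (fun k => q k y) (Real.exp κ)
      fun k _ => (Q_zero_one_bounds k y).2
    simpa using this
  have hφ0 : ∀ y, 0 ≤ φ y := fun y => (by positivity : 0 ≤ N * Real.exp (-κ)).trans (hφlow y)
  have hφH : ∀ x y, φ x ≤ φ y * Real.exp (κ * dist x y ^ α) := fun x y => by
    rw [hφ, Finset.sum_mul]
    refine Finset.sum_le_sum fun k _ => ?_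
    have h1 := Q_le_Q_mul_exp (B := 1) (c := 0) S.abs_zero_le (by simp) (u := fun _ => 1)
      (by simp) (by simp) k x y (by simp)
    rwa [add_zero] at h1
  have hstep : ∀ σ : ℝ, |σ| ≤ ε → ∀ y, S.Q (2 * σ) 1 φ y ≤ (1 + τ) * φ y := fun σ hσ y => by
    have h2σ : |2 * σ| ≤ 2 * ε := by rw [abs_mul, abs_two]; linarith
    have h1 := Q_one_le_add (h2σ.trans hε1) hφ0 hφup y
    -- the sums telescope, so `Q_0 φ - φ` is bounded independently of `N`
    have h2 : S.Q 0 1 φ y ≤ φ y + Real.exp κ := by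
      rw [hφ, Q_sum_iterates]
      change ∑ k ∈ Finset.range N, q (k + 1) y ≤ ∑ k ∈ Finset.range N, q k y + _
      have h3 := (Finset.sum_range_succ (fun k => q k y) N).symm.trans
        (Finset.sum_range_succ' (fun k => q k y) N)
      have h4 : q N y ≤ Real.exp κ := (Q_zero_one_bounds N y).2
      have h5 : 0 ≤ q 0 y := Q_nonneg (fun _ => zero_le_one) 0 y
      linarith
    have h3 : |2 * σ| / S.ε₀ * (∑' m, S.M m) * (N * Real.exp κ)
        ≤ τ / 2 * (N * Real.exp (-κ)) := by
      calc |2 * σ| / S.ε₀ * (∑' m, S.M m) * (N * Real.exp κ)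
          ≤ 2 * ε / S.ε₀ * (∑' m, S.M m) * (N * Real.exp κ) := by gcongr
        _ = 2 * ε / S.ε₀ * (∑' m, S.M m) * (Real.exp κ * Real.exp κ) * (N * Real.exp (-κ)) := by
          linear_combination (-(2 * ε / S.ε₀ * (∑' m, S.M m) * (N * Real.exp κ))) * hexp
        _ ≤ _ := by gcongr
    have h4 : Real.exp κ ≤ τ / 2 * (N * Real.exp (-κ)) := by
      have h5 := mul_le_mul_of_nonneg_right hN.le (Real.exp_pos (-κ)).le
      have h6 : 2 * Real.exp κ * Real.exp κ * Real.exp (-κ) = 2 * Real.exp κ := by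
        linear_combination 2 * Real.exp κ * hexp
      linarith
    have h5 := mul_le_mul_of_nonneg_left (hφlow y) (half_pos hτ).le
    linarith
  have hφB : ∀ y, |φ y| ≤ N * Real.exp κ := fun y => by rw [abs_of_nonneg (hφ0 y)]; exact hφup y
  have hiter : ∀ σ : ℝ, |σ| ≤ ε → ∀ n y, S.Q (2 * σ) n φ y ≤ (1 + τ) ^ n * φ y := by
    intro σ hσ n
    have h2σ : |2 * σ| ≤ S.ε₀ := by rw [abs_mul, abs_two]; linarith
    induction n with
    | zero => intro y; rw [Q_zero]; simp
    | succ n ih =>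
      intro y
      rw [Q_add h2σ hφB]
      obtain ⟨B', hB'⟩ := Q_bounded h2σ hφB 1
      have hB'' : ∀ y, |(1 + τ) * φ y| ≤ (1 + τ) * (N * Real.exp κ) := fun y => by
        rw [abs_mul, abs_of_pos (by linarith : 0 < 1 + τ)]
        exact mul_le_mul_of_nonneg_left (hφB y) (by linarith)
      refine (Q_mono h2σ hB' hB'' (hstep σ hσ) n y).trans ?_
      rw [Q_const_mul, pow_succ', mul_assoc]
      exact mul_le_mul_of_nonneg_left (ih y) (by linarith)
  refine ⟨fun y => (N : ℝ)⁻¹ * φ y, ε, hεpos, hε1, fun y => ?_, fun y => ?_, fun x y => ?_,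
    fun σ hσ n y => ?_⟩
  · change _ ≤ (N : ℝ)⁻¹ * φ y
    rw [← div_eq_inv_mul, le_div_iff₀ hN0, mul_comm]
    exact hφlow y
  · change (N : ℝ)⁻¹ * φ y ≤ _
    rw [← div_eq_inv_mul, div_le_iff₀ hN0, mul_comm]
    exact hφup y
  · rw [mul_assoc]
    exact mul_le_mul_of_nonneg_left (hφH x y) (by positivity)
  · rw [Q_const_mul, mul_left_comm]
    exact mul_le_mul_of_nonneg_left (hiter σ hσ n y) (by positivity)

end WeightedSystem

/-! ### Hölder estimates for the terms of the transfer operator -/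

theorem exp_sub_one_le_mul_exp (z : ℝ) : Real.exp z - 1 ≤ z * Real.exp z := by
  have h := mul_le_mul_of_nonneg_right (Real.add_one_le_exp (-z)) (Real.exp_pos z).le
  rw [← Real.exp_add, neg_add_cancel, Real.exp_zero] at h
  linarith

theorem norm_exp_mul_I_sub_le (a b : ℝ) :
    ‖Complex.exp (a * Complex.I) - Complex.exp (b * Complex.I)‖ ≤ |a - b| := by
  have h : Complex.exp (a * Complex.I) - Complex.exp (b * Complex.I)
      = Complex.exp (b * Complex.I) * (Complex.exp (Complex.I * ((a - b : ℝ) : ℂ)) - 1) := by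
    rw [mul_sub, mul_one, ← Complex.exp_add]
    congr 2
    push_cast
    ring
  rw [h, norm_mul, Complex.norm_exp_ofReal_mul_I, one_mul]
  exact Real.norm_exp_I_mul_ofReal_sub_one_le

/-- Interpolation between the trivial and the Lipschitz bound for a difference of phases. -/
theorem norm_exp_mul_I_sub_le_rpow {α : ℝ} (hα0 : 0 < α) (hα1 : α ≤ 1) {a b z : ℝ}
    (h : |a - b| ≤ z) :
    ‖Complex.exp (a * Complex.I) - Complex.exp (b * Complex.I)‖ ≤ 2 * z ^ α := by
  have hz : 0 ≤ z := (abs_nonneg _).trans h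
  rcases le_total z 1 with hz1 | hz1
  · have h1 := Real.rpow_le_rpow_of_exponent_ge' hz hz1 hα0.le hα1
    rw [Real.rpow_one] at h1
    linarith [norm_exp_mul_I_sub_le a b]
  · have h1 := Real.one_le_rpow hz1 hα0.le
    have h2 := norm_sub_le (Complex.exp (a * Complex.I)) (Complex.exp (b * Complex.I))
    rw [Complex.norm_exp_ofReal_mul_I, Complex.norm_exp_ofReal_mul_I] at h2
    linarith

/-- A bound for the Hölder constant, relative to their size, of the complex weights with imaginary
part `b`. -/
noncomputable def phaseConst (α C₁ ρ₀ b : ℝ) : ℝ :=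
  weightConst α C₁ ρ₀ * Real.exp (weightConst α C₁ ρ₀) + 2 * roofConst C₁ ρ₀ * |b| ^ α

namespace WeightedSystem

variable {ι : Type*} {α C₁ ρ₀ : ℝ} {S : WeightedSystem ι α C₁ ρ₀}

theorem abs_G_sub_le {σ : ℝ} (hσ : |σ| ≤ 1) (n : ℕ) (w : Word ι n) (x y : Y) :
    |S.G σ n w x - S.G σ n w y| ≤ S.G σ n w y *
      (weightConst α C₁ ρ₀ * Real.exp (weightConst α C₁ ρ₀) * dist x y ^ α) := by
  set κ := weightConst α C₁ ρ₀
  have hκ : 0 < κ := S.weightConst_pos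
  set t := dist x y ^ α with ht
  have ht0 : 0 ≤ t := Real.rpow_nonneg dist_nonneg _
  have ht1 : t ≤ 1 := S.dist_rpow_le_one x y
  have hG := S.G_pos σ n w y
  have h1 := S.G_le hσ n w x y
  have h2 := S.G_le hσ n w y x
  rw [dist_comm y x] at h2
  have h3 : Real.exp (κ * t) - 1 ≤ κ * Real.exp κ * t := by
    refine (exp_sub_one_le_mul_exp _).trans ?_
    have h4 : Real.exp (κ * t) ≤ Real.exp κ := Real.exp_le_exp.2 (mul_le_of_le_one_right hκ.le ht1)
    calc κ * t * Real.exp (κ * t) ≤ κ * t * Real.exp κ :=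
          mul_le_mul_of_nonneg_left h4 (by positivity)
      _ = _ := by ring
  have h5 : 1 - Real.exp (-(κ * t)) ≤ κ * Real.exp κ * t := by
    have h6 := Real.add_one_le_exp (-(κ * t))
    have h7 : κ * t * 1 ≤ κ * t * Real.exp κ :=
      mul_le_mul_of_nonneg_left (Real.one_le_exp hκ.le) (by positivity)
    linarith
  rw [abs_le]
  constructor
  · have h8 := mul_le_mul_of_nonneg_right h2 (Real.exp_pos (-(κ * t))).le
    rw [mul_assoc, ← Real.exp_add, add_neg_cancel, Real.exp_zero, mul_one] at h8
    have h9 := mul_le_mul_of_nonneg_left h5 hG.le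
    linarith
  · have h9 := mul_le_mul_of_nonneg_left h3 hG.le
    linarith

theorem phase_sub_le (b : ℝ) (n : ℕ) (w : Word ι n) (x y : Y) :
    ‖Complex.exp ((-(b * S.birk n w x) : ℝ) * Complex.I)
      - Complex.exp ((-(b * S.birk n w y) : ℝ) * Complex.I)‖
      ≤ 2 * roofConst C₁ ρ₀ * |b| ^ α * dist x y ^ α := by
  have hK : 1 ≤ roofConst C₁ ρ₀ := S.one_le_roofConst
  have h1 : |-(b * S.birk n w x) - -(b * S.birk n w y)|
      ≤ roofConst C₁ ρ₀ * (|b| * dist x y) := by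
    rw [← neg_sub', abs_neg, ← mul_sub, abs_mul]
    have h2 := mul_le_mul_of_nonneg_left (S.birk_sub_le n w x y) (abs_nonneg b)
    linarith
  refine (norm_exp_mul_I_sub_le_rpow S.α_pos S.α_le h1).trans ?_
  rw [Real.mul_rpow (by linarith) (by positivity), Real.mul_rpow (abs_nonneg _) dist_nonneg]
  have h3 : roofConst C₁ ρ₀ ^ α ≤ roofConst C₁ ρ₀ := by
    have h4 := Real.rpow_le_rpow_of_exponent_le hK S.α_le
    rwa [Real.rpow_one] at h4
  have h5 : 0 ≤ |b| ^ α * dist x y ^ α := by positivity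
  have h6 := mul_le_mul_of_nonneg_right h3 h5
  linarith

theorem norm_E_sub_le {s : ℂ} (hs : |s.re| ≤ 1) (n : ℕ) (w : Word ι n) (x y : Y) :
    ‖S.E s n w x - S.E s n w y‖ ≤
      S.G s.re n w y * (phaseConst α C₁ ρ₀ s.im * dist x y ^ α) := by
  rw [E_eq_G, E_eq_G]
  set e : Y → ℂ := fun z => Complex.exp ((-(s.im * S.birk n w z) : ℝ) * Complex.I) with he
  have h1 : (S.G s.re n w x : ℂ) * e x - (S.G s.re n w y : ℂ) * e y
      = ((S.G s.re n w x - S.G s.re n w y : ℝ) : ℂ) * e x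
        + (S.G s.re n w y : ℂ) * (e x - e y) := by push_cast; ring
  change ‖(S.G s.re n w x : ℂ) * e x - (S.G s.re n w y : ℂ) * e y‖ ≤ _
  rw [h1]
  refine (norm_add_le _ _).trans ?_
  rw [norm_mul, norm_mul, Complex.norm_exp_ofReal_mul_I, mul_one, Complex.norm_real,
    Complex.norm_real, Real.norm_eq_abs, Real.norm_of_nonneg (S.G_pos _ _ _ _).le]
  have h2 := S.abs_G_sub_le hs n w x y
  have h3 := mul_le_mul_of_nonneg_left (S.phase_sub_le s.im n w x y) (S.G_pos s.re n w y).le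
  rw [phaseConst, add_mul, mul_add]
  exact add_le_add h2 h3

theorem phaseConst_nonneg (S : WeightedSystem ι α C₁ ρ₀) (b : ℝ) : 0 ≤ phaseConst α C₁ ρ₀ b := by
  have := S.weightConst_pos
  have := S.one_le_roofConst
  unfold phaseConst
  positivity

theorem norm_term_sub_le {s : ℂ} (hs : |s.re| ≤ 1) {v : Y → ℂ} {L : ℝ} (n : ℕ) (w : Word ι n)
    (x y : Y)
    (hL : ‖v (wordMap S.H n w x) - v (wordMap S.H n w y)‖ ≤ L * dist x y ^ α) :
    ‖S.E s n w x * v (wordMap S.H n w x) - S.E s n w y * v (wordMap S.H n w y)‖ ≤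
      S.G s.re n w y * ((phaseConst α C₁ ρ₀ s.im * ‖v (wordMap S.H n w y)‖
        + Real.exp (weightConst α C₁ ρ₀) * L) * dist x y ^ α) := by
  set κ := weightConst α C₁ ρ₀
  have h1 : S.E s n w x * v (wordMap S.H n w x) - S.E s n w y * v (wordMap S.H n w y)
      = (S.E s n w x - S.E s n w y) * v (wordMap S.H n w y)
        + S.E s n w x * (v (wordMap S.H n w x) - v (wordMap S.H n w y)) := by ring
  rw [h1]
  refine (norm_add_le _ _).trans ?_
  rw [norm_mul, norm_mul, norm_E]
  have h2 := mul_le_mul_of_nonneg_right (S.norm_E_sub_le hs n w x y)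
    (norm_nonneg (v (wordMap S.H n w y)))
  have h3 : S.G s.re n w x ≤ S.G s.re n w y * Real.exp κ := by
    refine (S.G_le hs n w x y).trans (mul_le_mul_of_nonneg_left (Real.exp_le_exp.2 ?_)
      (S.G_pos _ _ _ _).le)
    exact mul_le_of_le_one_right S.weightConst_pos.le (S.dist_rpow_le_one x y)
  have h4 := mul_le_mul h3 hL (norm_nonneg _)
    (mul_nonneg (S.G_pos s.re n w y).le (Real.exp_pos κ).le)
  linarith

/-- The Lasota–Yorke inequality. -/
theorem norm_P_sub_le {s : ℂ} (hs : |s.re| ≤ S.ε₀) (hs1 : |s.re| ≤ 1) {v : Y → ℂ} {B L : ℝ}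
    (hB : ∀ y, ‖v y‖ ≤ B) (hL0 : 0 ≤ L) (hL : ∀ x y, ‖v x - v y‖ ≤ L * dist x y ^ α) (n : ℕ)
    (x y : Y) :
    ‖S.P s n v x - S.P s n v y‖ ≤ S.Q s.re n (fun _ => 1) y *
      ((phaseConst α C₁ ρ₀ s.im * B
        + Real.exp (weightConst α C₁ ρ₀) * (L * (C₁ ^ α * (ρ₀ ^ α) ^ n))) * dist x y ^ α) := by
  rw [P_apply, P_apply, Q_apply,
    ← (summable_norm_P hs hB n x).of_norm.tsum_sub (summable_norm_P hs hB n y).of_norm]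
  simp only [mul_one]
  refine tsum_of_norm_bounded ((summable_G hs n y).hasSum.mul_right _) fun w => ?_
  have h1 : ‖v (wordMap S.H n w x) - v (wordMap S.H n w y)‖
      ≤ L * (C₁ ^ α * (ρ₀ ^ α) ^ n) * dist x y ^ α := by
    refine (hL _ _).trans ?_
    rw [mul_assoc]
    exact mul_le_mul_of_nonneg_left (S.wordMap_dist_rpow n w x y) hL0
  refine (norm_term_sub_le hs1 n w x y h1).trans ?_
  refine mul_le_mul_of_nonneg_left ?_ (S.G_pos _ _ _ _).le
  refine mul_le_mul_of_nonneg_right ?_ (Real.rpow_nonneg dist_nonneg _)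
  exact add_le_add (mul_le_mul_of_nonneg_left (hB _) (S.phaseConst_nonneg _)) le_rfl

end WeightedSystem

/-! ### The invariant cone -/

/-- The aperture of the cone. Contracting branches reduce the oscillation of a pair in the cone to a
bounded multiple of `|b| ^ α`; the aperture exceeds that multiple together with what the
distortion, the phases of the weights and the damping factors contribute. -/
noncomputable def coneConst (α C₁ ρ₀ : ℝ) : ℝ :=
  12 + 2 * (weightConst α C₁ ρ₀ * Real.exp (weightConst α C₁ ρ₀))
    + 4 * roofConst C₁ ρ₀ + 2 * Real.exp (weightConst α C₁ ρ₀)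

/-- The cone of pairs `(u, v)` such that `u` dominates `v`, and controls its oscillation at scales
comparable to `1 / |b|`. -/
structure Cone (α C b : ℝ) (u : Y → ℝ) (v : Y → ℂ) : Prop where
  norm_le : ∀ y, ‖v y‖ ≤ u y
  harnack : ∀ x y, u x ≤ u y * Real.exp (C * |b| ^ α * dist x y ^ α)
  holder : ∀ x y, ‖v x - v y‖ ≤ C * |b| ^ α * u y * dist x y ^ α

namespace Cone

variable {α C b : ℝ} {u : Y → ℝ} {v : Y → ℂ}

theorem nonneg (h : Cone α C b u v) (y : Y) : 0 ≤ u y := (norm_nonneg _).trans (h.norm_le y)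

theorem continuous (h : Cone α C b u v) (hα : 0 < α) : Continuous u :=
  continuous_of_le_mul_exp hα h.harnack

end Cone

namespace WeightedSystem

variable {ι : Type*} {α C₁ ρ₀ : ℝ} {S : WeightedSystem ι α C₁ ρ₀}

/-- The operator `Q_σ^n` with its terms damped by the factors `χ w`. -/
noncomputable def damped (S : WeightedSystem ι α C₁ ρ₀) (σ : ℝ) (n : ℕ) (χ : Word ι n → Y → ℝ)
    (u : Y → ℝ) (y : Y) : ℝ :=
  ∑' w : Word ι n, S.G σ n w y * (χ w y * u (wordMap S.H n w y))

theorem summable_damped {σ B : ℝ} {u : Y → ℝ} (hσ : |σ| ≤ S.ε₀) (hu : ∀ y, |u y| ≤ B) {n : ℕ}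
    {χ : Word ι n → Y → ℝ} (hχ0 : ∀ w y, 0 ≤ χ w y) (hχ1 : ∀ w y, χ w y ≤ 1) (y : Y) :
    Summable fun w : Word ι n => S.G σ n w y * (χ w y * u (wordMap S.H n w y)) := by
  refine Summable.of_norm_bounded ((summable_G hσ n y).mul_right B) fun w => ?_
  rw [norm_mul, Real.norm_of_nonneg (S.G_pos _ _ _ _).le, norm_mul,
    Real.norm_of_nonneg (hχ0 w y)]
  refine mul_le_mul_of_nonneg_left ?_ (S.G_pos _ _ _ _).le
  exact (mul_le_of_le_one_left (norm_nonneg _) (hχ1 w y)).trans (hu _)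

/-- The cone is invariant, provided that the damped operator still dominates. -/
theorem cone_step {s : ℂ} (hs : |s.re| ≤ S.ε₀) (hs1 : |s.re| ≤ 1) (hb : 1 ≤ |s.im|) {n : ℕ}
    (hn : C₁ ^ α * coneConst α C₁ ρ₀ * (ρ₀ ^ α) ^ n ≤ 1 / 2) {u : Y → ℝ} {v : Y → ℂ}
    (h : Cone α (coneConst α C₁ ρ₀) s.im u v) {χ : Word ι n → Y → ℝ}
    (hχ0 : ∀ w y, 7 / 8 ≤ χ w y) (hχ1 : ∀ w y, χ w y ≤ 1)
    (hχ : ∀ w x y, χ w x ≤ χ w y * Real.exp (|s.im| ^ α * dist x y ^ α))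
    (hdom : ∀ y, ‖S.P s n v y‖ ≤ S.damped s.re n χ u y) :
    Cone α (coneConst α C₁ ρ₀) s.im (S.damped s.re n χ u) (S.P s n v) := by
  set C := coneConst α C₁ ρ₀ with hC
  set κ := weightConst α C₁ ρ₀ with hκ
  have hκ0 : 0 < κ := S.weightConst_pos
  have hK : 1 ≤ roofConst C₁ ρ₀ := S.one_le_roofConst
  have hκe : κ ≤ κ * Real.exp κ := le_mul_of_one_le_right hκ0.le (Real.one_le_exp hκ0.le)
  have hCeq : C = 12 + 2 * (κ * Real.exp κ) + 4 * roofConst C₁ ρ₀ + 2 * Real.exp κ := rfl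
  have hC0 : 0 < C := by rw [hCeq]; positivity
  have hbα : 1 ≤ |s.im| ^ α := Real.one_le_rpow hb S.α_pos.le
  obtain ⟨B, hB⟩ := exists_bound_of_continuous (h.continuous S.α_pos)
  have hvB : ∀ y, ‖v y‖ ≤ B := fun y => (h.norm_le y).trans ((le_abs_self _).trans (hB y))
  have hχ00 : ∀ w y, 0 ≤ χ w y := fun w y => by linarith [hχ0 w y]
  have hsum := fun y => summable_damped (u := u) hs hB hχ00 hχ1 y
  -- the contraction of the branches gains a factor two
  have hcontr : ∀ (w : Word ι n) x y,
      C * |s.im| ^ α * dist (wordMap S.H n w x) (wordMap S.H n w y) ^ α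
        ≤ 1 / 2 * |s.im| ^ α * dist x y ^ α := fun w x y => by
    have h1 := mul_le_mul_of_nonneg_left (S.wordMap_dist_rpow n w x y)
      (by positivity : 0 ≤ C * |s.im| ^ α)
    have h2 := mul_le_mul_of_nonneg_right hn
      (by positivity : 0 ≤ |s.im| ^ α * dist x y ^ α)
    linarith
  refine ⟨hdom, fun x y => ?_, fun x y => ?_⟩
  · rw [damped, damped, ← tsum_mul_right]
    refine (hsum x).tsum_le_tsum (fun w => ?_) ((hsum y).mul_right _)
    have h1 := S.G_le hs1 n w x y
    have h2 := hχ w x y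
    have h3 := (h.harnack (wordMap S.H n w x) (wordMap S.H n w y)).trans
      (mul_le_mul_of_nonneg_left (Real.exp_le_exp.2 (hcontr w x y)) (h.nonneg _))
    have hG := S.G_pos s.re n w y
    refine (mul_le_mul h1 (mul_le_mul h2 h3 (h.nonneg _)
      (mul_nonneg (hχ00 w y) (Real.exp_pos _).le)) (mul_nonneg (hχ00 w x) (h.nonneg _))
      (mul_nonneg hG.le (Real.exp_pos _).le)).trans ?_
    have h4 : Real.exp (κ * dist x y ^ α) * (Real.exp (|s.im| ^ α * dist x y ^ α)
        * Real.exp (1 / 2 * |s.im| ^ α * dist x y ^ α))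
        ≤ Real.exp (C * |s.im| ^ α * dist x y ^ α) := by
      rw [← Real.exp_add, ← Real.exp_add]
      refine Real.exp_le_exp.2 ?_
      rw [← add_mul, ← add_mul]
      refine mul_le_mul_of_nonneg_right ?_ (Real.rpow_nonneg dist_nonneg _)
      have h5 : κ * 1 ≤ κ * |s.im| ^ α := mul_le_mul_of_nonneg_left hbα hκ0.le
      have h6 : (κ + 3 / 2) * |s.im| ^ α ≤ C * |s.im| ^ α := by
        refine mul_le_mul_of_nonneg_right ?_ (by positivity)
        rw [hCeq]
        linarith [Real.exp_pos κ]
      linarith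
    have h7 := mul_le_mul_of_nonneg_left h4
      (mul_nonneg hG.le (mul_nonneg (hχ00 w y) (h.nonneg (wordMap S.H n w y))))
    refine le_trans (le_of_eq ?_) (h7.trans (le_of_eq ?_)) <;> ring
  · rw [P_apply, P_apply, damped,
      ← (summable_norm_P hs hvB n x).of_norm.tsum_sub (summable_norm_P hs hvB n y).of_norm]
    have e1 : C * |s.im| ^ α * (∑' w : Word ι n,
        S.G s.re n w y * (χ w y * u (wordMap S.H n w y))) * dist x y ^ α
        = (∑' w : Word ι n, S.G s.re n w y * (χ w y * u (wordMap S.H n w y)))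
          * (C * |s.im| ^ α * dist x y ^ α) := by ring
    rw [e1]
    refine tsum_of_norm_bounded ((hsum y).hasSum.mul_right _) fun w => ?_
    set U := u (wordMap S.H n w y) with hU
    have hU0 : 0 ≤ U := h.nonneg _
    have h1 : ‖v (wordMap S.H n w x) - v (wordMap S.H n w y)‖
        ≤ 1 / 2 * |s.im| ^ α * U * dist x y ^ α := by
      refine (h.holder _ _).trans ?_
      have h2 := mul_le_mul_of_nonneg_left (hcontr w x y) hU0
      linarith
    refine (norm_term_sub_le hs1 n w x y h1).trans ?_
    rw [mul_assoc (S.G s.re n w y), ← mul_assoc (χ w y * U)]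
    refine mul_le_mul_of_nonneg_left ?_ (S.G_pos _ _ _ _).le
    refine mul_le_mul_of_nonneg_right ?_ (Real.rpow_nonneg dist_nonneg _)
    have h3 : phaseConst α C₁ ρ₀ s.im
        ≤ (κ * Real.exp κ + 2 * roofConst C₁ ρ₀) * |s.im| ^ α := by
      rw [phaseConst, add_mul]
      have h4 : 0 ≤ κ * Real.exp κ := by positivity
      have h5 := mul_le_mul_of_nonneg_left hbα h4
      linarith
    have h4 := mul_le_mul h3 (h.norm_le (wordMap S.H n w y)) (norm_nonneg _) (by positivity)
    have h5 : 7 / 8 * U * (C * |s.im| ^ α) ≤ χ w y * U * (C * |s.im| ^ α) :=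
      mul_le_mul_of_nonneg_right (mul_le_mul_of_nonneg_right (hχ0 w y) hU0) (by positivity)
    have h6 : (κ * Real.exp κ + 2 * roofConst C₁ ρ₀ + 1 / 2 * Real.exp κ) * (|s.im| ^ α * U)
        ≤ 7 / 8 * C * (|s.im| ^ α * U) := by
      refine mul_le_mul_of_nonneg_right ?_ (by positivity)
      rw [hCeq]
      have : 0 ≤ κ * Real.exp κ := by positivity
      linarith [Real.exp_pos κ]
    linarith

end WeightedSystem

/-! ### Cancellation -/

/-- Complex numbers at an angle of at least `2π/3` add up to something no larger than either. -/
theorem norm_add_le_max {z₁ z₂ : ℂ}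
    (h : (z₁ * (starRingEnd ℂ) z₂).re ≤ -(1 / 2) * (‖z₁‖ * ‖z₂‖)) :
    ‖z₁ + z₂‖ ≤ max ‖z₁‖ ‖z₂‖ := by
  have h1 : ‖z₁ + z₂‖ ^ 2 = ‖z₁‖ ^ 2 + ‖z₂‖ ^ 2 + 2 * (z₁ * (starRingEnd ℂ) z₂).re := by
    rw [Complex.sq_norm, Complex.sq_norm, Complex.sq_norm, Complex.normSq_add]
  refine le_of_sq_le_sq ?_ (le_max_of_le_left (norm_nonneg _))
  rcases le_total ‖z₁‖ ‖z₂‖ with h2 | h2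
  · rw [max_eq_right h2]
    nlinarith [norm_nonneg z₁]
  · rw [max_eq_left h2]
    nlinarith [norm_nonneg z₂]

/-- Numbers `v₁`, `v₂` close to `c₁`, `c₂` stay nearly opposite under a rotation `e` close to the
rotation `e₀` that makes `c₁` and `c₂` opposite. -/
theorem re_rotate_mul_conj_le {e e₀ c₁ c₂ v₁ v₂ : ℂ} (he : ‖e‖ = 1)
    (h₀ : e₀ * (c₁ * (starRingEnd ℂ) c₂) = -((‖c₁‖ * ‖c₂‖ : ℝ) : ℂ)) (hee : ‖e - e₀‖ ≤ 1 / 20)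
    (h₁ : ‖v₁ - c₁‖ ≤ 0.132 * ‖c₁‖) (h₂ : ‖v₂ - c₂‖ ≤ 0.132 * ‖c₂‖) :
    (e * (v₁ * (starRingEnd ℂ) v₂)).re ≤ -(1 / 2) * (‖v₁‖ * ‖v₂‖) := by
  have n1 := norm_nonneg c₁
  have n2 := norm_nonneg c₂
  have hv1 : ‖v₁‖ ≤ 1.132 * ‖c₁‖ := by
    have := norm_le_norm_add_norm_sub' v₁ c₁
    linarith
  have hv2 : ‖v₂‖ ≤ 1.132 * ‖c₂‖ := by
    have := norm_le_norm_add_norm_sub' v₂ c₂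
    linarith
  set c := c₁ * (starRingEnd ℂ) c₂ with hc
  have hcn : ‖c‖ = ‖c₁‖ * ‖c₂‖ := by rw [hc, norm_mul, RCLike.norm_conj]
  have hd : e * (v₁ * (starRingEnd ℂ) v₂) = e₀ * c + ((e - e₀) * c
      + e * ((v₁ - c₁) * (starRingEnd ℂ) v₂ + c₁ * (starRingEnd ℂ) (v₂ - c₂))) := by
    rw [hc, map_sub]
    ring
  have h3 : ‖(e - e₀) * c + e * ((v₁ - c₁) * (starRingEnd ℂ) v₂ + c₁ * (starRingEnd ℂ) (v₂ - c₂))‖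
      ≤ 0.34 * (‖c₁‖ * ‖c₂‖) := by
    refine (norm_add_le _ _).trans ?_
    rw [norm_mul (e - e₀), norm_mul e, he, one_mul, hcn]
    have h4 := norm_add_le ((v₁ - c₁) * (starRingEnd ℂ) v₂) (c₁ * (starRingEnd ℂ) (v₂ - c₂))
    rw [norm_mul, norm_mul, RCLike.norm_conj, RCLike.norm_conj] at h4
    have h5 := mul_le_mul h₁ hv2 (norm_nonneg _) (by positivity)
    have h6 := mul_le_mul_of_nonneg_left h₂ n1
    have h7 := mul_le_mul_of_nonneg_right hee (mul_nonneg n1 n2)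
    nlinarith [mul_nonneg n1 n2]
  rw [hd, Complex.add_re, h₀, Complex.neg_re, Complex.ofReal_re]
  have h8 := (Complex.re_le_norm _).trans h3
  have h9 := mul_le_mul hv1 hv2 (norm_nonneg _) (by positivity)
  nlinarith [mul_nonneg n1 n2]

/-- A continuous real function whose values at the ends of an interval differ by at least `2π` takes
every value modulo `2π`. -/
theorem exists_eq_add_two_pi_mul {f : ℝ → ℝ} {p q : ℝ} (hpq : p ≤ q) (hf : ContinuousOn f (Icc p q))
    (h : 2 * Real.pi ≤ |f q - f p|) (θ : ℝ) :
    ∃ y ∈ Icc p q, ∃ k : ℤ, f y = θ + k * (2 * Real.pi) := by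
  obtain ⟨k, ⟨hk1, hk2⟩, -⟩ :=
    existsUnique_add_zsmul_mem_Ico Real.two_pi_pos θ (min (f p) (f q))
  have h1 : θ + k • (2 * Real.pi) ∈ uIcc (f p) (f q) := by
    refine ⟨hk1, hk2.le.trans ?_⟩
    have h2 := max_sub_min_eq_abs (f p) (f q)
    linarith
  rw [← uIcc_of_le hpq] at hf
  obtain ⟨y, hy, hy2⟩ := intermediate_value_uIcc hf h1
  rw [uIcc_of_le hpq] at hy
  exact ⟨y, hy, k, by rw [hy2, zsmul_eq_mul]⟩

/-- The smallness conditions on the radius `δ / |b|` of the balls on which cancellation takes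
place. -/
structure IsRadius (α C₁ ρ₀ D δ : ℝ) : Prop where
  pos : 0 < δ
  le_one : δ ≤ 1
  le_div : δ ≤ 2 * Real.pi / D
  roof : 2 * roofConst C₁ ρ₀ * δ ≤ 1 / 20
  weight : (4 * weightConst α C₁ ρ₀ + 5) * δ ^ α ≤ 1

namespace WeightedSystem

variable {ι : Type*} {α C₁ ρ₀ : ℝ} {S : WeightedSystem ι α C₁ ρ₀}

theorem exists_isRadius (S : WeightedSystem ι α C₁ ρ₀) {D : ℝ} (hD : 0 < D) :
    ∃ δ, IsRadius α C₁ ρ₀ D δ := by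
  have hα := S.α_pos
  have hκ := S.weightConst_pos
  have hK := S.one_le_roofConst
  have hpi := Real.pi_pos
  set κ := weightConst α C₁ ρ₀
  set K := roofConst C₁ ρ₀
  have hz : 0 < (1 / (4 * κ + 5)) ^ α⁻¹ := by positivity
  refine ⟨min (min 1 (2 * Real.pi / D)) (min (1 / (40 * K)) ((1 / (4 * κ + 5)) ^ α⁻¹)),
    ?_, ?_, ?_, ?_, ?_⟩
  · exact lt_min (lt_min one_pos (by positivity)) (lt_min (by positivity) hz)
  · exact (min_le_left _ _).trans (min_le_left _ _)
  · exact (min_le_left _ _).trans (min_le_right _ _)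
  · have h1 : min (min 1 (2 * Real.pi / D)) (min (1 / (40 * K)) ((1 / (4 * κ + 5)) ^ α⁻¹))
        ≤ 1 / (40 * K) := (min_le_right _ _).trans (min_le_left _ _)
    refine (mul_le_mul_of_nonneg_left h1 (by linarith)).trans_eq ?_
    change 2 * K * (1 / (40 * K)) = 1 / 20
    field_simp
    norm_num
  · set δ := min (min 1 (2 * Real.pi / D)) (min (1 / (40 * K)) ((1 / (4 * κ + 5)) ^ α⁻¹))
      with hδ
    have h1 : δ ≤ (1 / (4 * κ + 5)) ^ α⁻¹ := (min_le_right _ _).trans (min_le_right _ _)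
    have h0 : 0 ≤ δ := (lt_min (lt_min one_pos (by positivity)) (lt_min (by positivity) hz)).le
    have h2 := Real.rpow_le_rpow h0 h1 hα.le
    rw [← Real.rpow_mul (by positivity), inv_mul_cancel₀ hα.ne', Real.rpow_one] at h2
    refine (mul_le_mul_of_nonneg_left h2 (by linarith)).trans_eq ?_
    change (4 * κ + 5) * (1 / (4 * κ + 5)) = 1
    field_simp

theorem rpow_mul_dist_le (S : WeightedSystem ι α C₁ ρ₀) {b δ : ℝ} (hb : 1 ≤ |b|) {x y : Y}
    (h : dist x y ≤ δ / |b|) : |b| ^ α * dist x y ^ α ≤ δ ^ α := by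
  rw [← Real.mul_rpow (abs_nonneg _) dist_nonneg]
  refine Real.rpow_le_rpow (by positivity) ?_ S.α_pos.le
  rwa [le_div_iff₀ (by linarith), mul_comm] at h

theorem exp_tenth_le : Real.exp (1 / 10) ≤ 5 / 4 := by
  have h := exp_sub_one_le_mul_exp (1 / 10)
  linarith

/-- Near a point where `|v ∘ h| ≤ u ∘ h / 2` the domination is strict. -/
theorem norm_term_le_of_small {D δ : ℝ} (hδ : IsRadius α C₁ ρ₀ D δ) {s : ℂ} (hb : 1 ≤ |s.im|)
    {n : ℕ} (hn : C₁ ^ α * coneConst α C₁ ρ₀ * (ρ₀ ^ α) ^ n ≤ 1 / 2) {u : Y → ℝ} {v : Y → ℂ}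
    (h : Cone α (coneConst α C₁ ρ₀) s.im u v) (w : Word ι n) {p y : Y}
    (hp : ‖v (wordMap S.H n w p)‖ ≤ 1 / 2 * u (wordMap S.H n w p))
    (hy : dist y p ≤ δ / |s.im|) :
    ‖S.E s n w y * v (wordMap S.H n w y)‖
      ≤ 3 / 4 * (S.G s.re n w y * u (wordMap S.H n w y)) := by
  set C := coneConst α C₁ ρ₀ with hC
  have hκ := S.weightConst_pos
  have hK := S.one_le_roofConst
  have hC0 : 0 < C := by rw [hC, coneConst]; positivity
  have hδα : 0 < δ ^ α := Real.rpow_pos_of_pos hδ.pos _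
  have hw := hδ.weight
  have hq := S.rpow_mul_dist_le hb hy
  have hq5 : δ ^ α ≤ 1 / 5 := by
    have : 0 ≤ weightConst α C₁ ρ₀ * δ ^ α := by positivity
    linarith
  have hcontr : ∀ x z : Y, |s.im| ^ α * dist x z ^ α ≤ 1 / 5 →
      C * |s.im| ^ α * dist (wordMap S.H n w x) (wordMap S.H n w z) ^ α ≤ 1 / 10 :=
    fun x z hxz => by
    have h1 := mul_le_mul_of_nonneg_left (S.wordMap_dist_rpow n w x z)
      (by positivity : 0 ≤ C * |s.im| ^ α)
    have h2 := mul_le_mul_of_nonneg_right hn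
      (by positivity : 0 ≤ |s.im| ^ α * dist x z ^ α)
    linarith
  have h1 : ‖v (wordMap S.H n w y)‖ ≤ 3 / 5 * u (wordMap S.H n w p) := by
    have h2 := h.holder (wordMap S.H n w y) (wordMap S.H n w p)
    have h3 := mul_le_mul_of_nonneg_left (hcontr y p (hq.trans hq5))
      (h.nonneg (wordMap S.H n w p))
    have h4 := norm_le_norm_add_norm_sub' (v (wordMap S.H n w y)) (v (wordMap S.H n w p))
    linarith
  have h2 : u (wordMap S.H n w p) ≤ 5 / 4 * u (wordMap S.H n w y) := by
    have h3 := hcontr p y (by rw [dist_comm]; exact hq.trans hq5)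
    have h4 := (Real.exp_le_exp.2 h3).trans exp_tenth_le
    have h5 := (h.harnack (wordMap S.H n w p) (wordMap S.H n w y)).trans
      (mul_le_mul_of_nonneg_left h4 (h.nonneg _))
    linarith
  rw [norm_mul, norm_E]
  have h3 := mul_le_mul_of_nonneg_left (h1.trans (by linarith :
    3 / 5 * u (wordMap S.H n w p) ≤ 3 / 4 * u (wordMap S.H n w y))) (S.G_pos s.re n w y).le
  linarith

/-- The majorants `G u ∘ h` are almost constant on the balls of cancellation. -/
theorem majorant_le {D δ : ℝ} (hδ : IsRadius α C₁ ρ₀ D δ) {s : ℂ} (hs1 : |s.re| ≤ 1)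
    (hb : 1 ≤ |s.im|)
    {n : ℕ} (hn : C₁ ^ α * coneConst α C₁ ρ₀ * (ρ₀ ^ α) ^ n ≤ 1 / 2) {u : Y → ℝ} {v : Y → ℂ}
    (h : Cone α (coneConst α C₁ ρ₀) s.im u v) (w : Word ι n) {x y : Y}
    (hy : dist x y ≤ δ / |s.im|) :
    S.G s.re n w x * u (wordMap S.H n w x)
      ≤ S.G s.re n w y * u (wordMap S.H n w y) * Real.exp (1 / 4) := by
  set C := coneConst α C₁ ρ₀ with hC
  set κ := weightConst α C₁ ρ₀
  have hκ : 0 < κ := S.weightConst_pos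
  have hK := S.one_le_roofConst
  have hC0 : 0 < C := by rw [hC, coneConst]; positivity
  have hw := hδ.weight
  have hq := S.rpow_mul_dist_le hb hy
  have hbα : 1 ≤ |s.im| ^ α := Real.one_le_rpow hb S.α_pos.le
  have hq' : dist x y ^ α ≤ δ ^ α :=
    (le_mul_of_one_le_left (Real.rpow_nonneg dist_nonneg _) hbα).trans hq
  have h1 := S.G_le hs1 n w x y
  have h2 := h.harnack (wordMap S.H n w x) (wordMap S.H n w y)
  refine (mul_le_mul h1 h2 (h.nonneg _)
    (mul_nonneg (S.G_pos _ _ _ _).le (Real.exp_pos _).le)).trans ?_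
  have h3 : Real.exp (κ * dist x y ^ α) *
      Real.exp (C * |s.im| ^ α * dist (wordMap S.H n w x) (wordMap S.H n w y) ^ α)
      ≤ Real.exp (1 / 4) := by
    rw [← Real.exp_add]
    refine Real.exp_le_exp.2 ?_
    have h4 := mul_le_mul_of_nonneg_left (S.wordMap_dist_rpow n w x y)
      (by positivity : 0 ≤ C * |s.im| ^ α)
    have h5 := mul_le_mul_of_nonneg_right hn
      (by positivity : 0 ≤ |s.im| ^ α * dist x y ^ α)
    have h6 := mul_le_mul_of_nonneg_left hq' hκ.le
    have h7 : 0 < δ ^ α := Real.rpow_pos_of_pos hδ.pos _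
    linarith
  have h4 := mul_le_mul_of_nonneg_left h3
    (mul_nonneg (S.G_pos s.re n w y).le (h.nonneg (wordMap S.H n w y)))
  linarith

/-- On a ball on which the two terms are nearly opposite, the same one of them can be damped at all
points of the ball. -/
theorem term_add_le_of_opposite {D δ : ℝ} (hδ : IsRadius α C₁ ρ₀ D δ) {s : ℂ} (hs1 : |s.re| ≤ 1)
    (hb : 1 ≤ |s.im|)
    {n : ℕ} (hn : C₁ ^ α * coneConst α C₁ ρ₀ * (ρ₀ ^ α) ^ n ≤ 1 / 2) {u : Y → ℝ} {v : Y → ℂ}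
    (h : Cone α (coneConst α C₁ ρ₀) s.im u v) (w₁ w₂ : Word ι n) {p y : Y}
    (hp : S.G s.re n w₁ p * u (wordMap S.H n w₁ p) ≤ S.G s.re n w₂ p * u (wordMap S.H n w₂ p))
    (hy : dist y p ≤ δ / |s.im|)
    (hmax : ‖S.E s n w₁ y * v (wordMap S.H n w₁ y) + S.E s n w₂ y * v (wordMap S.H n w₂ y)‖
      ≤ max ‖S.E s n w₁ y * v (wordMap S.H n w₁ y)‖ ‖S.E s n w₂ y * v (wordMap S.H n w₂ y)‖) :
    ‖S.E s n w₁ y * v (wordMap S.H n w₁ y) + S.E s n w₂ y * v (wordMap S.H n w₂ y)‖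
      ≤ 3 / 4 * (S.G s.re n w₁ y * u (wordMap S.H n w₁ y))
        + S.G s.re n w₂ y * u (wordMap S.H n w₂ y) := by
  have hz : ∀ w : Word ι n, ‖S.E s n w y * v (wordMap S.H n w y)‖
      ≤ S.G s.re n w y * u (wordMap S.H n w y) := fun w => by
    rw [norm_mul, norm_E]
    exact mul_le_mul_of_nonneg_left (h.norm_le _) (S.G_pos _ _ _ _).le
  have h0 : ∀ w : Word ι n, 0 ≤ S.G s.re n w y * u (wordMap S.H n w y) := fun w =>
    mul_nonneg (S.G_pos _ _ _ _).le (h.nonneg _)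
  have h1 := majorant_le (S := S) hδ hs1 hb hn h w₁ hy
  have h2 := majorant_le (S := S) hδ hs1 hb hn h w₂ (by rwa [dist_comm] : dist p y ≤ δ / |s.im|)
  have he : Real.exp (1 / 4) * Real.exp (1 / 4) ≤ 2 := by
    rw [← Real.exp_add]
    have := exp_sub_one_le_mul_exp (1 / 4 + 1 / 4)
    linarith
  have h3 : S.G s.re n w₁ y * u (wordMap S.H n w₁ y)
      ≤ 2 * (S.G s.re n w₂ y * u (wordMap S.H n w₂ y)) := by
    calc S.G s.re n w₁ y * u (wordMap S.H n w₁ y)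
        ≤ S.G s.re n w₁ p * u (wordMap S.H n w₁ p) * Real.exp (1 / 4) := h1
      _ ≤ S.G s.re n w₂ p * u (wordMap S.H n w₂ p) * Real.exp (1 / 4) :=
        mul_le_mul_of_nonneg_right hp (Real.exp_pos _).le
      _ ≤ S.G s.re n w₂ y * u (wordMap S.H n w₂ y) * Real.exp (1 / 4) * Real.exp (1 / 4) :=
        mul_le_mul_of_nonneg_right h2 (Real.exp_pos _).le
      _ = S.G s.re n w₂ y * u (wordMap S.H n w₂ y) * (Real.exp (1 / 4) * Real.exp (1 / 4)) := by
        ring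
      _ ≤ S.G s.re n w₂ y * u (wordMap S.H n w₂ y) * 2 := mul_le_mul_of_nonneg_left he (h0 w₂)
      _ = _ := mul_comm _ _
  refine hmax.trans (max_le ((hz w₁).trans ?_) ((hz w₂).trans ?_))
  · linarith [h0 w₁]
  · linarith [h0 w₁]

/-- A ball of radius `r` about a point of `cancelSet` is a region where the sum of the terms of `w₁`
and `w₂` is small because the term of `w₁` can be damped. -/
def cancelSet (S : WeightedSystem ι α C₁ ρ₀) (s : ℂ) (n : ℕ) (u : Y → ℝ) (v : Y → ℂ) (r : ℝ)
    (w₁ w₂ : Word ι n) : Set Y :=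
  {p | ∀ y, dist y p ≤ r →
    ‖S.E s n w₁ y * v (wordMap S.H n w₁ y) + S.E s n w₂ y * v (wordMap S.H n w₂ y)‖
      ≤ 3 / 4 * (S.G s.re n w₁ y * u (wordMap S.H n w₁ y))
        + S.G s.re n w₂ y * u (wordMap S.H n w₂ y)}

/-- Nonintegrability forces cancellation in every interval of length `2π / (D |b|)`. -/
theorem exists_mem_cancelSet {D δ : ℝ} (hD : 0 < D) (hδ : IsRadius α C₁ ρ₀ D δ) {s : ℂ}
    (hs1 : |s.re| ≤ 1) (hb : 1 ≤ |s.im|)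
    {n : ℕ} (hn : C₁ ^ α * coneConst α C₁ ρ₀ * (ρ₀ ^ α) ^ n ≤ 1 / 2)
    (hn' : C₁ ^ α * coneConst α C₁ ρ₀ * (ρ₀ ^ α) ^ n * (4 * Real.pi / D) ^ α ≤ 0.066)
    {u : Y → ℝ} {v : Y → ℂ} (h : Cone α (coneConst α C₁ ρ₀) s.im u v) {w₁ w₂ : Word ι n}
    (huni : ∀ x y : Y, D * dist x y ≤
      |(S.birk n w₁ x - S.birk n w₂ x) - (S.birk n w₁ y - S.birk n w₂ y)|)
    {p : ℝ} (hp0 : 0 ≤ p) (hp1 : p + 2 * Real.pi / (D * |s.im|) ≤ 1) :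
    ∃ y : Y, p ≤ y ∧ (y : ℝ) ≤ p + 2 * Real.pi / (D * |s.im|) ∧
      (y ∈ S.cancelSet s n u v (δ / |s.im|) w₁ w₂ ∨
        y ∈ S.cancelSet s n u v (δ / |s.im|) w₂ w₁) := by
  set C := coneConst α C₁ ρ₀ with hC
  have hκ := S.weightConst_pos
  have hK := S.one_le_roofConst
  have hC0 : 0 < C := by rw [hC, coneConst]; positivity
  have hpi := Real.pi_pos
  have hb0 : 0 < |s.im| := by linarith
  set ℓ := 2 * Real.pi / (D * |s.im|) with hℓ
  have hℓ0 : 0 < ℓ := by positivity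
  have hz : ∀ (w : Word ι n) y, ‖S.E s n w y * v (wordMap S.H n w y)‖
      ≤ S.G s.re n w y * u (wordMap S.H n w y) := fun w y => by
    rw [norm_mul, norm_E]
    exact mul_le_mul_of_nonneg_left (h.norm_le _) (S.G_pos _ _ _ _).le
  let P : Y := ⟨p, hp0, by linarith⟩
  let R : Y := ⟨p + ℓ, by linarith, hp1⟩
  by_cases hsmall₁ : ‖v (wordMap S.H n w₁ P)‖ ≤ 1 / 2 * u (wordMap S.H n w₁ P)
  · refine ⟨P, le_rfl, (by linarith : p ≤ p + ℓ), Or.inl fun y hy => ?_⟩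
    refine (norm_add_le _ _).trans (add_le_add ?_ (hz _ _))
    exact norm_term_le_of_small hδ hb hn h w₁ hsmall₁ hy
  by_cases hsmall₂ : ‖v (wordMap S.H n w₂ P)‖ ≤ 1 / 2 * u (wordMap S.H n w₂ P)
  · refine ⟨P, le_rfl, (by linarith : p ≤ p + ℓ), Or.inr fun y hy => ?_⟩
    refine (norm_add_le _ _).trans (add_le_add ?_ (hz _ _))
    exact norm_term_le_of_small hδ hb hn h w₂ hsmall₂ hy
  push Not at hsmall₁ hsmall₂
  set c₁ := v (wordMap S.H n w₁ P) with hc₁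
  set c₂ := v (wordMap S.H n w₂ P) with hc₂
  set c := c₁ * (starRingEnd ℂ) c₂ with hc
  set ψ : Y → ℝ := fun y => S.birk n w₁ y - S.birk n w₂ y with hψ
  have hψc : Continuous ψ := (S.continuous_birk n w₁).sub (S.continuous_birk n w₂)
  set e : Y → ℂ := fun y => Complex.exp ((-(s.im * ψ y) : ℝ) * Complex.I) with he
  -- a point at which the terms are opposite, if `v` is replaced by its values at `P`
  obtain ⟨y₁, hpy₁, hy₁ℓ, hey₁⟩ : ∃ y : Y, p ≤ y ∧ (y : ℝ) ≤ p + ℓ ∧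
      e y * c = -((‖c₁‖ * ‖c₂‖ : ℝ) : ℂ) := by
    set f : ℝ → ℝ := fun x => s.im * ψ (projIcc 0 1 zero_le_one x) with hf
    have hfc : Continuous f := (hψc.comp continuous_projIcc).const_mul _
    have hf2 : 2 * Real.pi ≤ |f (p + ℓ) - f p| := by
      have e1 : projIcc 0 1 zero_le_one (p + ℓ) = R := projIcc_of_mem _ R.2
      have e2 : projIcc 0 1 zero_le_one p = P := projIcc_of_mem _ P.2
      rw [hf]
      simp only
      rw [e1, e2, ← mul_sub, abs_mul]
      have h1 := mul_le_mul_of_nonneg_left (huni R P) hb0.le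
      refine le_trans (le_of_eq ?_) h1
      have e3 : dist R P = ℓ := by
        rw [Subtype.dist_eq, Real.dist_eq]
        change |p + ℓ - p| = ℓ
        rw [add_sub_cancel_left, abs_of_pos hℓ0]
      rw [e3, hℓ]
      field_simp
    obtain ⟨y, hy, k, hyk⟩ := exists_eq_add_two_pi_mul (by linarith : p ≤ p + ℓ)
      hfc.continuousOn hf2 (c.arg + Real.pi)
    have hyY : y ∈ Y := ⟨hp0.trans hy.1, hy.2.trans hp1⟩
    refine ⟨⟨y, hyY⟩, hy.1, hy.2, ?_⟩
    have e4 : s.im * ψ ⟨y, hyY⟩ = c.arg + Real.pi + k * (2 * Real.pi) := by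
      rw [← hyk, hf]
      simp only
      rw [projIcc_of_mem _ hyY]
    have e6 : ‖c‖ = ‖c₁‖ * ‖c₂‖ := by rw [hc, norm_mul, RCLike.norm_conj]
    rw [he]
    simp only
    rw [e4]
    have e7 : Complex.exp (((-(c.arg + Real.pi + k * (2 * Real.pi)) : ℝ) : ℂ) * Complex.I)
        * Complex.exp (c.arg * Complex.I) = -1 := by
      rw [← Complex.exp_add]
      have e8 : ((-(c.arg + Real.pi + k * (2 * Real.pi)) : ℝ) : ℂ) * Complex.I
          + c.arg * Complex.I = -(Real.pi * Complex.I) - k * (2 * Real.pi * Complex.I) := by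
        push_cast
        ring
      rw [e8, Complex.exp_sub, Complex.exp_neg, Complex.exp_pi_mul_I,
        Complex.exp_int_mul_two_pi_mul_I]
      norm_num
    set A := Complex.exp (((-(c.arg + Real.pi + k * (2 * Real.pi)) : ℝ) : ℂ) * Complex.I)
    calc A * c = A * ((‖c‖ : ℂ) * Complex.exp (c.arg * Complex.I)) := by
          rw [Complex.norm_mul_exp_arg_mul_I]
      _ = (‖c‖ : ℂ) * (A * Complex.exp (c.arg * Complex.I)) := by ring
      _ = _ := by rw [e7, e6]; push_cast; ring
  -- near that point the terms make an obtuse angle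
  have hmax : ∀ y, dist y y₁ ≤ δ / |s.im| →
      ‖S.E s n w₁ y * v (wordMap S.H n w₁ y) + S.E s n w₂ y * v (wordMap S.H n w₂ y)‖
      ≤ max ‖S.E s n w₁ y * v (wordMap S.H n w₁ y)‖
        ‖S.E s n w₂ y * v (wordMap S.H n w₂ y)‖ := by
    intro y hy
    have hyP : dist y P ≤ (4 * Real.pi / D) / |s.im| := by
      have h1 : dist y₁ P ≤ ℓ := by
        rw [Subtype.dist_eq, Real.dist_eq]
        change |(y₁ : ℝ) - p| ≤ ℓ
        rw [abs_of_nonneg (by linarith)]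
        linarith
      have h2 : δ / |s.im| ≤ ℓ := by
        rw [hℓ, ← div_div]
        exact div_le_div_of_nonneg_right hδ.le_div hb0.le
      have h3 : (4 * Real.pi / D) / |s.im| = ℓ + ℓ := by
        rw [hℓ, ← div_div]
        ring
      rw [h3]
      exact (dist_triangle _ _ _).trans (add_le_add (hy.trans h2) h1)
    have hq := S.rpow_mul_dist_le hb hyP
    have hclose : ∀ w : Word ι n, 1 / 2 * u (wordMap S.H n w P) < ‖v (wordMap S.H n w P)‖ →
        ‖v (wordMap S.H n w y) - v (wordMap S.H n w P)‖
          ≤ 0.132 * ‖v (wordMap S.H n w P)‖ := by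
      intro w hw
      refine (h.holder _ _).trans ?_
      have h1 := mul_le_mul_of_nonneg_left (S.wordMap_dist_rpow n w y P)
        (by positivity : 0 ≤ C * |s.im| ^ α)
      have hρ := S.rho_rpow_pos
      have hCα := S.C_rpow_pos
      have h2 := mul_le_mul_of_nonneg_left hq
        (by positivity : 0 ≤ C₁ ^ α * C * (ρ₀ ^ α) ^ n)
      have h3 : C * |s.im| ^ α * dist (wordMap S.H n w y) (wordMap S.H n w P) ^ α ≤ 0.066 := by
        linarith
      have h4 := mul_le_mul_of_nonneg_left h3 (h.nonneg (wordMap S.H n w P))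
      linarith
    have hv₁ := hclose w₁ hsmall₁
    have hv₂ := hclose w₂ hsmall₂
    have hee : ‖e y - e y₁‖ ≤ 1 / 20 := by
      refine (norm_exp_mul_I_sub_le _ _).trans ?_
      rw [← neg_sub', abs_neg, ← mul_sub, abs_mul]
      have h1 : |ψ y - ψ y₁| ≤ 2 * roofConst C₁ ρ₀ * (δ / |s.im|) := by
        have h2 := S.birk_sub_le n w₁ y y₁
        have h3 := S.birk_sub_le n w₂ y y₁
        have h4 := mul_le_mul_of_nonneg_left hy (by linarith : 0 ≤ roofConst C₁ ρ₀)
        have e1 : ψ y - ψ y₁ = (S.birk n w₁ y - S.birk n w₁ y₁)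
            - (S.birk n w₂ y - S.birk n w₂ y₁) := by rw [hψ]; ring
        rw [e1]
        have h5 := abs_sub (S.birk n w₁ y - S.birk n w₁ y₁) (S.birk n w₂ y - S.birk n w₂ y₁)
        linarith
      refine (mul_le_mul_of_nonneg_left h1 hb0.le).trans (le_trans (le_of_eq ?_) hδ.roof)
      field_simp
    have hre := re_rotate_mul_conj_le (Complex.norm_exp_ofReal_mul_I _) hey₁ hee hv₁ hv₂
    apply norm_add_le_max
    set V := v (wordMap S.H n w₁ y) * (starRingEnd ℂ) (v (wordMap S.H n w₂ y)) with hV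
    have hprod : S.E s n w₁ y * v (wordMap S.H n w₁ y)
        * (starRingEnd ℂ) (S.E s n w₂ y * v (wordMap S.H n w₂ y))
        = ((S.G s.re n w₁ y * S.G s.re n w₂ y : ℝ) : ℂ) * (e y * V) := by
      have e1 : e y = Complex.exp ((-(s.im * S.birk n w₁ y) : ℝ) * Complex.I)
          * (starRingEnd ℂ) (Complex.exp ((-(s.im * S.birk n w₂ y) : ℝ) * Complex.I)) := by
        rw [← Complex.exp_conj, map_mul, Complex.conj_I, Complex.conj_ofReal, ← Complex.exp_add]
        change Complex.exp ((-(s.im * (S.birk n w₁ y - S.birk n w₂ y)) : ℝ) * Complex.I) = _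
        congr 1
        push_cast
        ring
      rw [E_eq_G, E_eq_G, e1, hV]
      simp only [map_mul, Complex.conj_ofReal]
      push_cast
      ring
    rw [hprod, Complex.re_ofReal_mul, norm_mul, norm_mul, norm_E, norm_E]
    have h1 := mul_le_mul_of_nonneg_left hre
      (mul_pos (S.G_pos s.re n w₁ y) (S.G_pos s.re n w₂ y)).le
    linarith
  refine ⟨y₁, hpy₁, hy₁ℓ, ?_⟩
  rcases le_total (S.G s.re n w₁ y₁ * u (wordMap S.H n w₁ y₁))
    (S.G s.re n w₂ y₁ * u (wordMap S.H n w₂ y₁)) with hle | hle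
  · exact Or.inl fun y hy => term_add_le_of_opposite hδ hs1 hb hn h w₁ w₂ hle hy (hmax y hy)
  · refine Or.inr fun y hy => term_add_le_of_opposite hδ hs1 hb hn h w₂ w₁ hle hy ?_
    rw [add_comm, max_comm]
    exact hmax y hy

end WeightedSystem

/-! ### The contraction in mean square -/

/-- If every interval of a partition into `N` equal parts contains the centre of a ball of radius
`r` on which `Φ ≥ 1/2`, and if `W` satisfies a Harnack inequality at scale `1/N`, then a definite
proportion of the integral of `W` is carried by `Φ`. -/
theorem integ_le_of_tiles {W Φ : Y → ℝ} (hW : Continuous W) (hΦ : Continuous Φ)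
    (hW0 : ∀ y, 0 ≤ W y) (hΦ0 : ∀ y, 0 ≤ Φ y) {N : ℕ} (hN : 0 < N) {K r : ℝ} (hK : 0 < K)
    (hr : 0 < r) (hrN : r ≤ 1 / N) (hH : ∀ x y, dist x y ≤ 1 / (N : ℝ) → W x ≤ K * W y)
    (hc : ∀ k < N, ∃ y : Y, (k : ℝ) / N ≤ y ∧ (y : ℝ) ≤ k / N + 1 / N ∧
      ∀ z, dist z y ≤ r → 1 / 2 ≤ Φ z) :
    integ W ≤ 2 * K ^ 2 / (N * r) * integ (fun y => Φ y * W y) := by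
  have hN0 : (0 : ℝ) < N := by exact_mod_cast hN
  set p : ℝ → Y := projIcc 0 1 zero_le_one with hp
  have hpc : Continuous p := continuous_projIcc
  have hWc : Continuous fun x => W (p x) := hW.comp hpc
  have hFc : Continuous fun x => Φ (p x) * W (p x) := (hΦ.comp hpc).mul hWc
  set a : ℕ → ℝ := fun k => k / N with ha
  have hsucc : ∀ k, a (k + 1) = a k + 1 / N := fun k => by
    simp only [ha]; push_cast; ring
  have htile : ∀ k < N, ∫ x in a k..a (k + 1), W (p x) ≤
      2 * K ^ 2 / (N * r) * ∫ x in a k..a (k + 1), Φ (p x) * W (p x) := by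
    intro k hk
    obtain ⟨y, hy0, hy1, hy⟩ := hc k hk
    have hk0 : 0 ≤ a k := by positivity
    have hk1 : a k + 1 / N ≤ 1 := by
      rw [← hsucc]
      simp only [ha]
      rw [div_le_one hN0]
      exact_mod_cast hk
    have hdist : ∀ x ∈ Icc (a k) (a k + 1 / N), dist (p x) y ≤ 1 / (N : ℝ) ∧
        dist (p x) y = |x - y| := by
      intro x hx
      have hxY : x ∈ Y := ⟨hk0.trans hx.1, hx.2.trans hk1⟩
      have e1 : dist (p x) y = |x - y| := by
        rw [hp, projIcc_of_mem _ hxY, Subtype.dist_eq, Real.dist_eq]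
      refine ⟨?_, e1⟩
      rw [e1, abs_le]
      have hy0' : a k ≤ y := hy0
      have hy1' : (y : ℝ) ≤ a k + 1 / N := hy1
      constructor <;> linarith [hx.1, hx.2]
    rw [hsucc]
    have hNinv : 0 < 1 / (N : ℝ) := by positivity
    have hupper : ∫ x in a k..(a k + 1 / N), W (p x) ≤ 1 / N * (K * W y) := by
      have h1 : ∫ x in a k..(a k + 1 / N), W (p x) ≤ ∫ _ in a k..(a k + 1 / N), K * W y :=
        intervalIntegral.integral_mono_on (by linarith) (hWc.intervalIntegrable _ _)
          (continuous_const.intervalIntegrable _ _) fun x hx => hH _ _ (hdist x hx).1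
      rwa [intervalIntegral.integral_const, add_sub_cancel_left, smul_eq_mul] at h1
    -- an interval of length `r` inside both the tile and the ball
    set z := min (y : ℝ) (a k + 1 / N - r) with hz
    have hz1 : a k ≤ z := le_min hy0 (by linarith)
    have hz2 : z + r ≤ a k + 1 / N := by linarith [min_le_right (y : ℝ) (a k + 1 / N - r)]
    have hlower : r * (1 / 2 * (W y / K)) ≤ ∫ x in a k..(a k + 1 / N), Φ (p x) * W (p x) := by
      have h1 : ∫ _ in z..(z + r), 1 / 2 * (W y / K) ≤ ∫ x in z..(z + r), Φ (p x) * W (p x) := by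
        refine intervalIntegral.integral_mono_on (by linarith)
          (continuous_const.intervalIntegrable _ _) (hFc.intervalIntegrable _ _) fun x hx => ?_
        have hx' : x ∈ Icc (a k) (a k + 1 / N) := ⟨hz1.trans hx.1, hx.2.trans hz2⟩
        obtain ⟨h2, h3⟩ := hdist x hx'
        have h4 : dist (p x) y ≤ r := by
          rw [h3, abs_le]
          have h5 : z ≤ y := min_le_left _ _
          refine ⟨?_, by linarith [hx.2]⟩
          rcases min_choice (y : ℝ) (a k + 1 / N - r) with h6 | h6
          · rw [← hz] at h6
            linarith [hx.1]
          · rw [← hz] at h6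
            have hy1' : (y : ℝ) ≤ a k + 1 / N := hy1
            linarith [hx.1]
        refine mul_le_mul (hy _ h4) ?_ (div_nonneg (hW0 _) hK.le) (hΦ0 _)
        rw [div_le_iff₀ hK, mul_comm]
        exact hH _ _ (by rwa [dist_comm])
      rw [intervalIntegral.integral_const, add_sub_cancel_left, smul_eq_mul] at h1
      refine h1.trans (intervalIntegral.integral_mono_interval hz1 (by linarith) hz2
        (Filter.Eventually.of_forall fun x => mul_nonneg (hΦ0 _) (hW0 _))
        (hFc.intervalIntegrable _ _))
    refine hupper.trans (le_trans (le_of_eq ?_)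
      (mul_le_mul_of_nonneg_left hlower (by positivity)))
    field_simp
  have h1 : ∀ f : Y → ℝ, Continuous (fun x => f (p x)) →
      ∑ k ∈ Finset.range N, ∫ x in a k..a (k + 1), f (p x) = integ f := fun f hf => by
    rw [intervalIntegral.sum_integral_adjacent_intervals
      fun k _ => hf.intervalIntegrable _ _, integ]
    congr 1
    · simp [ha]
    · simp [ha, hN0.ne']
  rw [← h1 W hWc, ← h1 (fun y => Φ y * W y) hFc, Finset.mul_sum]
  exact Finset.sum_le_sum fun k hk => htile k (Finset.mem_range.1 hk)

/-- A Lipschitz function which is at least `1/2` within distance `r/2` of `E`, and vanishes at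
distance `r` from `E`. -/
noncomputable def bump {r : ℝ} (hr : 0 < r) (E : Set Y) (y : Y) : ℝ := thickenedIndicator hr E y

section Bump

variable {r : ℝ} (hr : 0 < r) (E : Set Y)

theorem bump_nonneg (y : Y) : 0 ≤ bump hr E y := NNReal.coe_nonneg _

theorem bump_le_one (y : Y) : bump hr E y ≤ 1 := by
  exact_mod_cast thickenedIndicator_le_one hr E y

theorem continuous_bump : Continuous (bump hr E) :=
  NNReal.continuous_coe.comp (thickenedIndicator hr E).continuous

theorem abs_bump_sub_le (x y : Y) : |bump hr E x - bump hr E y| ≤ dist x y / r := by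
  have h := (lipschitzWith_thickenedIndicator hr E).dist_le_mul x y
  rw [NNReal.coe_inv, Real.coe_toNNReal _ hr.le] at h
  rw [div_eq_inv_mul]
  exact h

theorem abs_bump_sub_le_rpow {α : ℝ} (hα0 : 0 < α) (hα1 : α ≤ 1) (x y : Y) :
    |bump hr E x - bump hr E y| ≤ (dist x y / r) ^ α := by
  have hz : 0 ≤ dist x y / r := div_nonneg dist_nonneg hr.le
  rcases le_total (dist x y / r) 1 with hz1 | hz1
  · have h1 := Real.rpow_le_rpow_of_exponent_ge' hz hz1 hα0.le hα1
    rw [Real.rpow_one] at h1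
    exact (abs_bump_sub_le hr E x y).trans h1
  · refine le_trans ?_ (Real.one_le_rpow hz1 hα0.le)
    rw [abs_le]
    constructor <;> linarith [bump_nonneg hr E x, bump_le_one hr E x, bump_nonneg hr E y,
      bump_le_one hr E y]

variable {E}

theorem bump_eq_one {y : Y} (h : y ∈ E) : bump hr E y = 1 := by
  rw [bump, thickenedIndicator_one hr E h, NNReal.coe_one]

theorem half_le_bump {p y : Y} (hp : p ∈ E) (h : dist y p ≤ r / 2) : 1 / 2 ≤ bump hr E y := by
  have h1 := abs_bump_sub_le hr E p y
  rw [bump_eq_one hr hp, dist_comm] at h1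
  have h2 : dist y p / r ≤ 1 / 2 := by rw [div_le_iff₀ hr]; linarith
  linarith [le_abs_self (1 - bump hr E y)]

theorem exists_of_bump_pos {y : Y} (h : bump hr E y ≠ 0) : ∃ p ∈ E, dist y p ≤ r := by
  by_contra hne
  refine h ?_
  rw [bump, thickenedIndicator_zero hr E, NNReal.coe_zero]
  intro hy
  obtain ⟨p, hp, hd⟩ := Metric.mem_thickening_iff.1 hy
  exact hne ⟨p, hp, hd.le⟩

end Bump

namespace WeightedSystem

variable {ι : Type*} {α C₁ ρ₀ : ℝ} {S : WeightedSystem ι α C₁ ρ₀}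

open Classical in
/-- The damping factors: the terms of the words `w₁` and `w₂` are damped by `φ₁` and `φ₂`, and the
other terms are left alone. -/
noncomputable def damping {n : ℕ} (η : ℝ) (w₁ w₂ : Word ι n) (φ₁ φ₂ : Y → ℝ) (w : Word ι n)
    (y : Y) : ℝ :=
  if w = w₁ then 1 - η * φ₁ y else if w = w₂ then 1 - η * φ₂ y else 1

section Damping

variable {n : ℕ} {η : ℝ} {w₁ w₂ : Word ι n} {φ₁ φ₂ : Y → ℝ}

theorem damping_fst (y : Y) : damping η w₁ w₂ φ₁ φ₂ w₁ y = 1 - η * φ₁ y := if_pos rfl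

theorem damping_snd (h : w₁ ≠ w₂) (y : Y) : damping η w₁ w₂ φ₁ φ₂ w₂ y = 1 - η * φ₂ y :=
  (if_neg h.symm).trans (if_pos rfl)

theorem damping_of_ne {w : Word ι n} (h₁ : w ≠ w₁) (h₂ : w ≠ w₂) (y : Y) :
    damping η w₁ w₂ φ₁ φ₂ w y = 1 := (if_neg h₁).trans (if_neg h₂)

theorem damping_cases (P : (Y → ℝ) → Prop) (h₁ : P fun y => 1 - η * φ₁ y)
    (h₂ : P fun y => 1 - η * φ₂ y) (h₃ : P fun _ => 1) (w : Word ι n) :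
    P (damping η w₁ w₂ φ₁ φ₂ w) := by
  unfold damping
  by_cases e₁ : w = w₁
  · simpa [e₁] using h₁
  · by_cases e₂ : w = w₂
    · simp only [if_neg e₁, if_pos e₂]
      exact h₂
    · simp only [if_neg e₁, if_neg e₂]
      exact h₃

end Damping

/-- The weight of a fixed word is bounded below, uniformly for `|σ| ≤ 1`. -/
theorem exists_le_G (S : WeightedSystem ι α C₁ ρ₀) (n : ℕ) (w : Word ι n) :
    ∃ g : ℝ, 0 < g ∧ ∀ σ : ℝ, |σ| ≤ 1 → ∀ y, g ≤ S.G σ n w y := by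
  set f : Y → ℝ := fun y => Real.exp (-|S.birk n w y|) * S.jac n w y with hf
  have hj : Continuous (S.jac n w) := continuous_of_le_mul_exp S.α_pos (S.jac_le n w)
  have hfc : Continuous f := (Real.continuous_exp.comp (S.continuous_birk n w).abs.neg).mul hj
  obtain ⟨y₀, -, hy₀⟩ := isCompact_univ.exists_isMinOn (univ_nonempty (α := Y)) hfc.continuousOn
  refine ⟨f y₀, mul_pos (Real.exp_pos _) (S.jac_pos _ _ _), fun σ hσ y => ?_⟩
  refine (hy₀ (mem_univ y)).trans ?_
  rw [G_eq]
  refine mul_le_mul_of_nonneg_right (Real.exp_le_exp.2 ?_) (S.jac_pos _ _ _).le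
  have h1 : |σ * S.birk n w y| ≤ 1 * |S.birk n w y| := by
    rw [abs_mul]
    exact mul_le_mul_of_nonneg_right hσ (abs_nonneg _)
  linarith [le_abs_self (σ * S.birk n w y)]

/-- The Cauchy–Schwarz inequality for the damped operator, relative to a density `ψ`. -/
theorem damped_sq_le {σ B b₀ : ℝ} (hσ2 : |2 * σ| ≤ S.ε₀) {u ψ : Y → ℝ} (hu : ∀ y, |u y| ≤ B)
    (hb₀ : 0 < b₀) {B₁ : ℝ} (hψ0 : ∀ y, b₀ ≤ ψ y) (hψ1 : ∀ y, ψ y ≤ B₁) {n : ℕ}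
    {χ : Word ι n → Y → ℝ} (hχ0 : ∀ w y, 0 ≤ χ w y) (hχ1 : ∀ w y, χ w y ≤ 1) (y : Y) :
    S.damped σ n χ u y ^ 2 ≤
      (∑' w : Word ι n, S.G (2 * σ) n w y * (χ w y * ψ (wordMap S.H n w y))) *
        S.Q 0 n (fun x => u x ^ 2 / ψ x) y := by
  have hσ : |σ| ≤ S.ε₀ := by
    rw [abs_mul, abs_two] at hσ2
    linarith [abs_nonneg σ]
  have hψpos : ∀ y, 0 < ψ y := fun y => hb₀.trans_le (hψ0 y)
  have hψB : ∀ y, |ψ y| ≤ B₁ := fun y => by rw [abs_of_pos (hψpos y)]; exact hψ1 y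
  have huψ : ∀ y, |u y ^ 2 / ψ y| ≤ B ^ 2 / b₀ := fun y => by
    rw [abs_of_nonneg (div_nonneg (sq_nonneg _) (hψpos y).le)]
    exact div_le_div₀ (sq_nonneg _) (sq_le_sq' (abs_le.1 (hu y)).1 (abs_le.1 (hu y)).2) hb₀ (hψ0 y)
  refine tsum_sq_le_tsum_mul_tsum
    (fun w => mul_nonneg (S.G_pos _ _ _ _).le (mul_nonneg (hχ0 w y) (hψpos _).le))
    (fun w => mul_nonneg (S.G_pos _ _ _ _).le (div_nonneg (sq_nonneg _) (hψpos _).le))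
    (summable_damped hσ2 hψB hχ0 hχ1 y) (summable_Q S.abs_zero_le huψ n y)
    (summable_damped hσ hu hχ0 hχ1 y) fun w => ?_
  set x := wordMap S.H n w y
  have hG : S.G σ n w y ^ 2 = S.G (2 * σ) n w y * S.G 0 n w y := by
    rw [G_zero, G_eq, G_eq, mul_pow, ← Real.exp_nat_mul, sq (S.jac n w y), ← mul_assoc]
    congr 3
    push_cast
    ring
  have hχ2 : χ w y ^ 2 ≤ χ w y := by nlinarith [hχ0 w y, hχ1 w y]
  calc (S.G σ n w y * (χ w y * u x)) ^ 2
      = S.G (2 * σ) n w y * S.G 0 n w y * u x ^ 2 * χ w y ^ 2 := by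
        rw [mul_pow, mul_pow, hG]; ring
    _ ≤ S.G (2 * σ) n w y * S.G 0 n w y * u x ^ 2 * χ w y :=
        mul_le_mul_of_nonneg_left hχ2 (mul_nonneg (mul_pos (S.G_pos _ _ _ _)
          (S.G_pos _ _ _ _)).le (sq_nonneg _))
    _ = _ := by
        have := (hψpos x).ne'
        change _ = S.G (2 * σ) n w y * (χ w y * ψ x) * (S.G 0 n w y * (u x ^ 2 / ψ x))
        field_simp

/-- The damping of the terms of `w₁` and `w₂` makes the transfer operator with real weights
smaller by a definite amount. -/
theorem tsum_damping_le {σ Θ g η : ℝ} (hσ : |σ| ≤ S.ε₀) {ψ : Y → ℝ} {n : ℕ} {κ : ℝ}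
    (hψ0 : ∀ y, Real.exp (-κ) ≤ ψ y) (hψ1 : ∀ y, ψ y ≤ Real.exp κ) {w₁ w₂ : Word ι n}
    (hne : w₁ ≠ w₂) {φ₁ φ₂ : Y → ℝ} (hφ₁ : ∀ y, 0 ≤ φ₁ y ∧ φ₁ y ≤ 1)
    (hφ₂ : ∀ y, 0 ≤ φ₂ y ∧ φ₂ y ≤ 1) (hη0 : 0 ≤ η) (hη1 : η ≤ 1)
    (hg₁ : ∀ y, g ≤ S.G σ n w₁ y) (hg₂ : ∀ y, g ≤ S.G σ n w₂ y)
    (hΘ : ∀ y, S.Q σ n ψ y ≤ Θ * ψ y) (y : Y) :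
    ∑' w : Word ι n, S.G σ n w y * (damping η w₁ w₂ φ₁ φ₂ w y * ψ (wordMap S.H n w y))
      ≤ (Θ - η * g * Real.exp (-(2 * κ)) * (φ₁ y + φ₂ y)) * ψ y := by
  have hψpos : ∀ y, 0 < ψ y := fun y => (Real.exp_pos _).trans_le (hψ0 y)
  have hψB : ∀ y, |ψ y| ≤ Real.exp κ := fun y => by rw [abs_of_pos (hψpos y)]; exact hψ1 y
  have hηφ : ∀ {φ : Y → ℝ}, (∀ y, 0 ≤ φ y ∧ φ y ≤ 1) → ∀ y, 0 ≤ 1 - η * φ y ∧ 1 - η * φ y ≤ 1 :=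
    fun {φ} hφ y => by
      have h1 := mul_nonneg hη0 (hφ y).1
      have h2 := mul_le_mul hη1 (hφ y).2 (hφ y).1 zero_le_one
      constructor <;> linarith
  have hχ : ∀ w y, 0 ≤ damping η w₁ w₂ φ₁ φ₂ w y ∧ damping η w₁ w₂ φ₁ φ₂ w y ≤ 1 := fun w =>
    damping_cases (fun f => ∀ y, 0 ≤ f y ∧ f y ≤ 1) (hηφ hφ₁) (hηφ hφ₂) (by simp) w
  have hs1 := summable_damped hσ hψB (fun w y => (hχ w y).1) (fun w y => (hχ w y).2) y
  have hs2 := summable_Q hσ hψB n y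
  have hΘ' := hΘ y
  rw [Q_apply] at hΘ'
  classical
  rw [← hs1.sum_add_tsum_compl (s := {w₁, w₂}), Finset.sum_pair hne, damping_fst,
    damping_snd hne]
  rw [← hs2.sum_add_tsum_compl (s := {w₁, w₂}), Finset.sum_pair hne] at hΘ'
  have hrest : ∑' w : ((({w₁, w₂} : Finset (Word ι n)) : Set (Word ι n))ᶜ : Set (Word ι n)),
      S.G σ n w y * (damping η w₁ w₂ φ₁ φ₂ w y * ψ (wordMap S.H n w y))
      = ∑' w : ((({w₁, w₂} : Finset (Word ι n)) : Set (Word ι n))ᶜ : Set (Word ι n)),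
      S.G σ n w y * ψ (wordMap S.H n w y) := by
    refine tsum_congr fun w => ?_
    have hw := w.2
    simp only [Finset.coe_insert, Finset.coe_singleton, mem_compl_iff, mem_insert_iff,
      mem_singleton_iff, not_or] at hw
    rw [damping_of_ne hw.1 hw.2, one_mul]
  rw [hrest]
  have hgain : ∀ w : Word ι n, (∀ y, g ≤ S.G σ n w y) →
      g * Real.exp (-(2 * κ)) * ψ y ≤ S.G σ n w y * ψ (wordMap S.H n w y) := by
    intro w hw
    have h1 : Real.exp (-(2 * κ)) * ψ y ≤ ψ (wordMap S.H n w y) := by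
      refine (mul_le_mul_of_nonneg_left (hψ1 y) (Real.exp_pos _).le).trans ?_
      rw [← Real.exp_add]
      refine (le_of_eq ?_).trans (hψ0 _)
      congr 1
      ring
    rw [mul_assoc]
    exact mul_le_mul (hw y) h1 (mul_nonneg (Real.exp_pos _).le (hψpos _).le) (S.G_pos _ _ _ _).le
  have h1 := mul_le_mul_of_nonneg_left (hgain w₁ hg₁) (mul_nonneg hη0 (hφ₁ y).1)
  have h2 := mul_le_mul_of_nonneg_left (hgain w₂ hg₂) (mul_nonneg hη0 (hφ₂ y).1)
  linarith

/-- On the supports of the bumps the damped operator dominates the complex one. -/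
theorem norm_P_le_damped {s : ℂ} (hs : |s.re| ≤ S.ε₀) {C r η : ℝ} (hr : 0 < r) (hη0 : 0 ≤ η)
    (hη1 : η ≤ 1 / 8) {n : ℕ} {u : Y → ℝ} {v : Y → ℂ} {B : ℝ} (hB : ∀ y, |u y| ≤ B)
    (h : Cone α C s.im u v) {w₁ w₂ : Word ι n} (hne : w₁ ≠ w₂) (y : Y) :
    ‖S.P s n v y‖ ≤ S.damped s.re n (damping η w₁ w₂ (bump hr (S.cancelSet s n u v r w₁ w₂))
      (bump hr (S.cancelSet s n u v r w₂ w₁))) u y := by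
  set φ₁ := bump hr (S.cancelSet s n u v r w₁ w₂) with hφ₁
  set φ₂ := bump hr (S.cancelSet s n u v r w₂ w₁) with hφ₂
  have b1 : ∀ y, 0 ≤ φ₁ y ∧ φ₁ y ≤ 1 := fun y => ⟨bump_nonneg _ _ _, bump_le_one _ _ _⟩
  have b2 : ∀ y, 0 ≤ φ₂ y ∧ φ₂ y ≤ 1 := fun y => ⟨bump_nonneg _ _ _, bump_le_one _ _ _⟩
  have hηφ : ∀ {φ : Y → ℝ}, (∀ y, 0 ≤ φ y ∧ φ y ≤ 1) → ∀ y, 0 ≤ 1 - η * φ y ∧ 1 - η * φ y ≤ 1 :=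
    fun {φ} hφ y => by
      have h1 := mul_nonneg hη0 (hφ y).1
      have h2 := mul_le_mul hη1 (hφ y).2 (hφ y).1 (by norm_num)
      constructor <;> linarith
  have hχ : ∀ w y, 0 ≤ damping η w₁ w₂ φ₁ φ₂ w y ∧ damping η w₁ w₂ φ₁ φ₂ w y ≤ 1 := fun w =>
    damping_cases (fun f => ∀ y, 0 ≤ f y ∧ f y ≤ 1) (hηφ b1) (hηφ b2) (by simp) w
  have hvB : ∀ y, ‖v y‖ ≤ B := fun y => (h.norm_le y).trans ((le_abs_self _).trans (hB y))
  have hs1 := summable_norm_P hs hvB n y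
  have hs2 := summable_damped (u := u) hs hB (fun w y => (hχ w y).1) (fun w y => (hχ w y).2) y
  have hz : ∀ w : Word ι n, ‖S.E s n w y * v (wordMap S.H n w y)‖
      ≤ S.G s.re n w y * u (wordMap S.H n w y) := fun w => by
    rw [norm_mul, norm_E]
    exact mul_le_mul_of_nonneg_left (h.norm_le _) (S.G_pos _ _ _ _).le
  have h0 : ∀ w : Word ι n, 0 ≤ S.G s.re n w y * u (wordMap S.H n w y) := fun w =>
    mul_nonneg (S.G_pos _ _ _ _).le (h.nonneg _)
  classical
  rw [P_apply, damped, ← hs1.of_norm.sum_add_tsum_compl (s := {w₁, w₂}), Finset.sum_pair hne,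
    ← hs2.sum_add_tsum_compl (s := {w₁, w₂}), Finset.sum_pair hne, damping_fst, damping_snd hne]
  refine (norm_add_le _ _).trans (add_le_add ?_ ?_)
  · set a₁ := S.G s.re n w₁ y * u (wordMap S.H n w₁ y) with ha₁
    set a₂ := S.G s.re n w₂ y * u (wordMap S.H n w₂ y) with ha₂
    set z := S.E s n w₁ y * v (wordMap S.H n w₁ y) + S.E s n w₂ y * v (wordMap S.H n w₂ y) with hz'
    have t0 : ‖z‖ ≤ a₁ + a₂ := (norm_add_le _ _).trans (add_le_add (hz w₁) (hz w₂))
    have t1 : φ₁ y ≠ 0 → ‖z‖ ≤ 3 / 4 * a₁ + a₂ := fun hy => by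
      obtain ⟨p, hp, hd⟩ := exists_of_bump_pos hr hy
      exact hp y hd
    have t2 : φ₂ y ≠ 0 → ‖z‖ ≤ 3 / 4 * a₂ + a₁ := fun hy => by
      obtain ⟨p, hp, hd⟩ := exists_of_bump_pos hr hy
      rw [hz', add_comm]
      exact hp y hd
    have e : S.G s.re n w₁ y * ((1 - η * φ₁ y) * u (wordMap S.H n w₁ y))
        + S.G s.re n w₂ y * ((1 - η * φ₂ y) * u (wordMap S.H n w₂ y))
        = a₁ + a₂ - η * φ₁ y * a₁ - η * φ₂ y * a₂ := by rw [ha₁, ha₂]; ring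
    rw [e]
    have c : ∀ φ : Y → ℝ, (∀ y, 0 ≤ φ y ∧ φ y ≤ 1) → ∀ a, 0 ≤ a → η * φ y * a ≤ 1 / 8 * a :=
      fun φ hφ a ha => mul_le_mul_of_nonneg_right (by
        have := mul_le_mul hη1 (hφ y).2 (hφ y).1 (by norm_num)
        linarith) ha
    have c1 := c φ₁ b1 a₁ (h0 w₁)
    have c2 := c φ₂ b2 a₂ (h0 w₂)
    have p1 := h0 w₁
    have p2 := h0 w₂
    by_cases hy1 : φ₁ y = 0
    · rw [hy1, mul_zero, zero_mul, sub_zero]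
      by_cases hy2 : φ₂ y = 0
      · rw [hy2, mul_zero, zero_mul, sub_zero]
        exact t0
      · linarith [t2 hy2]
    · by_cases hy2 : φ₂ y = 0
      · rw [hy2, mul_zero, zero_mul, sub_zero]
        linarith [t1 hy1]
      · linarith [t1 hy1, t2 hy2]
  · refine tsum_of_norm_bounded (hs2.subtype _).hasSum fun w => ?_
    have hw := w.2
    simp only [Finset.coe_insert, Finset.coe_singleton, mem_compl_iff, mem_insert_iff,
      mem_singleton_iff, not_or] at hw
    simp only [Function.comp_apply]
    rw [damping_of_ne hw.1 hw.2, one_mul]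
    exact hz w

end WeightedSystem

namespace WeightedSystem

variable {ι : Type*} {α C₁ ρ₀ : ℝ} {S : WeightedSystem ι α C₁ ρ₀}

/-- The damping factors vary slowly at scale `1 / |b|` if `η = δ / 8`. -/
theorem one_sub_bump_le (S : WeightedSystem ι α C₁ ρ₀) {b δ : ℝ} (hb : 0 < |b|) (hδ0 : 0 < δ)
    (hδ1 : δ ≤ 1) (hr : 0 < δ / |b|) (E : Set Y) (x y : Y) :
    1 - δ / 8 * bump hr E x ≤
      (1 - δ / 8 * bump hr E y) * Real.exp (|b| ^ α * dist x y ^ α) := by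
  set t := |b| ^ α * dist x y ^ α with ht
  have ht0 : 0 ≤ t := mul_nonneg (Real.rpow_nonneg hb.le _) (Real.rpow_nonneg dist_nonneg _)
  have h1 := abs_bump_sub_le_rpow hr E S.α_pos S.α_le y x
  have h2 : δ * (dist y x / (δ / |b|)) ^ α ≤ t := by
    have e1 : dist y x / (δ / |b|) = |b| * dist x y / δ := by rw [dist_comm]; field_simp
    rw [e1, Real.div_rpow (by positivity) hδ0.le, Real.mul_rpow hb.le dist_nonneg,
      mul_div_assoc', div_le_iff₀ (Real.rpow_pos_of_pos hδ0 _), mul_comm]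
    have h3 := Real.rpow_le_rpow_of_exponent_ge' hδ0.le hδ1 S.α_pos.le S.α_le
    rw [Real.rpow_one] at h3
    exact mul_le_mul_of_nonneg_left h3 ht0
  have h3 : 7 / 8 ≤ 1 - δ / 8 * bump hr E y := by
    have := mul_le_mul hδ1 (bump_le_one hr E y) (bump_nonneg hr E y) zero_le_one
    linarith
  have h4 := mul_le_mul_of_nonneg_left ((le_abs_self _).trans h1) hδ0.le
  have h5 := mul_le_mul_of_nonneg_left (Real.add_one_le_exp t)
    (by linarith : 0 ≤ 1 - δ / 8 * bump hr E y)
  have h6 := mul_le_mul_of_nonneg_right h3 ht0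
  linarith

/-- The function `u² / ψ` satisfies a Harnack inequality at those scales at which `u` does. -/
theorem harnack_sq_div (S : WeightedSystem ι α C₁ ρ₀) {b C κ : ℝ} {u ψ : Y → ℝ} {v : Y → ℂ}
    (h : Cone α C b u v) (hψ0 : ∀ y, 0 < ψ y) (hκ : 0 ≤ κ)
    (hψ : ∀ x y, ψ x ≤ ψ y * Real.exp (κ * dist x y ^ α)) {X Z : Y} {t : ℝ}
    (ht : C * |b| ^ α * dist X Z ^ α ≤ t / 2) :
    u X ^ 2 / ψ X ≤ u Z ^ 2 / ψ Z * Real.exp (t + κ) := by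
  have h1 : u X ≤ u Z * Real.exp (t / 2) :=
    (h.harnack X Z).trans (mul_le_mul_of_nonneg_left (Real.exp_le_exp.2 ht) (h.nonneg _))
  have h2 : ψ Z ≤ ψ X * Real.exp κ := by
    refine (hψ Z X).trans (mul_le_mul_of_nonneg_left (Real.exp_le_exp.2 ?_) (hψ0 _).le)
    exact mul_le_of_le_one_right hκ (S.dist_rpow_le_one _ _)
  have h3 : u X ^ 2 ≤ u Z ^ 2 * Real.exp t := by
    have h4 := pow_le_pow_left₀ (h.nonneg _) h1 2
    rw [mul_pow, ← Real.exp_nat_mul] at h4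
    refine h4.trans (le_of_eq ?_)
    congr 2
    push_cast
    ring
  rw [div_le_iff₀ (hψ0 _), div_mul_eq_mul_div, div_mul_eq_mul_div, le_div_iff₀ (hψ0 _),
    Real.exp_add]
  calc u X ^ 2 * ψ Z ≤ (u Z ^ 2 * Real.exp t) * (ψ X * Real.exp κ) :=
        mul_le_mul h3 h2 (hψ0 _).le (mul_nonneg (sq_nonneg _) (Real.exp_pos _).le)
    _ = _ := by ring

/-- One step of the Dolgopyat argument: a pair in the cone is mapped to a pair in the cone with a
smaller mean square. The gain `c` depends neither on `s` nor on the density `ψ`. -/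
theorem exists_cone_contraction (S : WeightedSystem ι α C₁ ρ₀) {D : ℝ} (hD : 0 < D) {n : ℕ}
    (hn : C₁ ^ α * coneConst α C₁ ρ₀ * (ρ₀ ^ α) ^ n ≤ 1 / 2)
    (hn' : C₁ ^ α * coneConst α C₁ ρ₀ * (ρ₀ ^ α) ^ n * (4 * Real.pi / D) ^ α ≤ 0.066)
    {w₁ w₂ : Word ι n}
    (huni : ∀ x y : Y, D * dist x y ≤
      |(S.birk n w₁ x - S.birk n w₂ x) - (S.birk n w₁ y - S.birk n w₂ y)|) :
    ∃ c : ℝ, 0 < c ∧ ∀ (s : ℂ) (Θ : ℝ) (u ψ : Y → ℝ) (v : Y → ℂ), |2 * s.re| ≤ S.ε₀ →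
      |2 * s.re| ≤ 1 → 1 ≤ |s.im| → 4 * Real.pi / D ≤ |s.im| →
      Cone α (coneConst α C₁ ρ₀) s.im u v →
      (∀ y, Real.exp (-weightConst α C₁ ρ₀) ≤ ψ y) →
      (∀ y, ψ y ≤ Real.exp (weightConst α C₁ ρ₀)) →
      (∀ x y, ψ x ≤ ψ y * Real.exp (weightConst α C₁ ρ₀ * dist x y ^ α)) →
      (∀ y, S.Q (2 * s.re) n ψ y ≤ Θ * ψ y) →
      ∃ u' : Y → ℝ, Cone α (coneConst α C₁ ρ₀) s.im u' (S.P s n v) ∧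
        integ (fun y => u' y ^ 2 / ψ y) ≤ (Θ - c) * integ (fun y => u y ^ 2 / ψ y) := by
  obtain ⟨δ, hδ⟩ := S.exists_isRadius hD
  obtain ⟨g₁, hg₁0, hg₁⟩ := S.exists_le_G n w₁
  obtain ⟨g₂, hg₂0, hg₂⟩ := S.exists_le_G n w₂
  have hne : w₁ ≠ w₂ := by
    rintro rfl
    have h1 := huni ⟨0, by simp⟩ ⟨1, by simp⟩
    rw [Subtype.dist_eq, Real.dist_eq] at h1
    norm_num at h1
    linarith
  set C := coneConst α C₁ ρ₀ with hC
  set κ := weightConst α C₁ ρ₀ with hκ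
  have hκ0 : 0 < κ := S.weightConst_pos
  have hK := S.one_le_roofConst
  have hC0 : 0 < C := by rw [hC, coneConst]; positivity
  have hpi := Real.pi_pos
  have hδ0 := hδ.pos
  set g := min g₁ g₂ with hg
  have hg0 : 0 < g := lt_min hg₁0 hg₂0
  set Λ := 2 * κ + (4 * Real.pi / D) ^ α with hΛ
  set K₃ := 16 * Real.pi / (D * δ) * Real.exp Λ ^ 2 with hK₃
  have hK₃0 : 0 < K₃ := by positivity
  set c₀ := δ / 8 * g * Real.exp (-(2 * κ)) with hc₀
  have hc₀0 : 0 < c₀ := by positivity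
  refine ⟨c₀ / K₃, by positivity, ?_⟩
  intro s Θ u ψ v hs2 hs12 hb hbD h hψ0 hψ1 hψH hΘ
  have hb0 : 0 < |s.im| := by linarith
  have hs : |s.re| ≤ S.ε₀ := by
    rw [abs_mul, abs_two] at hs2
    linarith [abs_nonneg s.re]
  have hs1 : |s.re| ≤ 1 := by
    rw [abs_mul, abs_two] at hs12
    linarith [abs_nonneg s.re]
  obtain ⟨B, hB⟩ := exists_bound_of_continuous (h.continuous S.α_pos)
  have hr : 0 < δ / |s.im| := by positivity
  set φ₁ := bump hr (S.cancelSet s n u v (δ / |s.im|) w₁ w₂) with hφ₁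
  set φ₂ := bump hr (S.cancelSet s n u v (δ / |s.im|) w₂ w₁) with hφ₂
  have b1 : ∀ y, 0 ≤ φ₁ y ∧ φ₁ y ≤ 1 := fun y => ⟨bump_nonneg _ _ _, bump_le_one _ _ _⟩
  have b2 : ∀ y, 0 ≤ φ₂ y ∧ φ₂ y ≤ 1 := fun y => ⟨bump_nonneg _ _ _, bump_le_one _ _ _⟩
  set χ := damping (δ / 8) w₁ w₂ φ₁ φ₂ with hχ
  have hη1 : δ / 8 ≤ 1 / 8 := by linarith [hδ.le_one]
  have hηφ : ∀ {φ : Y → ℝ}, (∀ y, 0 ≤ φ y ∧ φ y ≤ 1) →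
      ∀ y, 7 / 8 ≤ 1 - δ / 8 * φ y ∧ 1 - δ / 8 * φ y ≤ 1 := fun {φ} hφ y => by
    have h1 := mul_nonneg hδ0.le (hφ y).1
    have h2 := mul_le_mul hδ.le_one (hφ y).2 (hφ y).1 zero_le_one
    constructor <;> linarith
  have hχb : ∀ w y, 7 / 8 ≤ χ w y ∧ χ w y ≤ 1 := fun w =>
    damping_cases (fun f => ∀ y, 7 / 8 ≤ f y ∧ f y ≤ 1) (hηφ b1) (hηφ b2)
      (fun _ => by norm_num) w
  have hχ00 : ∀ w y, 0 ≤ χ w y := fun w y => by linarith [(hχb w y).1]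
  have hχH : ∀ w x y, χ w x ≤ χ w y * Real.exp (|s.im| ^ α * dist x y ^ α) := fun w =>
    damping_cases (fun f => ∀ x y, f x ≤ f y * Real.exp (|s.im| ^ α * dist x y ^ α))
      (S.one_sub_bump_le hb0 hδ0 hδ.le_one hr _) (S.one_sub_bump_le hb0 hδ0 hδ.le_one hr _)
      (fun x y => by
        rw [one_mul]
        exact Real.one_le_exp (by positivity)) w
  have hcone : Cone α C s.im (S.damped s.re n χ u) (S.P s n v) :=
    cone_step hs hs1 hb hn h (fun w y => (hχb w y).1) (fun w y => (hχb w y).2) hχH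
      (norm_P_le_damped hs hr (by positivity) hη1 hB h hne)
  refine ⟨S.damped s.re n χ u, hcone, ?_⟩
  have hψpos : ∀ y, 0 < ψ y := fun y => (Real.exp_pos _).trans_le (hψ0 y)
  have hψc : Continuous ψ := continuous_of_le_mul_exp S.α_pos hψH
  have huc : Continuous u := h.continuous S.α_pos
  have hfc : Continuous fun y => u y ^ 2 / ψ y := (huc.pow 2).div hψc fun y => (hψpos y).ne'
  have hf0 : ∀ y, 0 ≤ u y ^ 2 / ψ y := fun y => div_nonneg (sq_nonneg _) (hψpos y).le
  set W := S.Q 0 n fun y => u y ^ 2 / ψ y with hW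
  have hWc : Continuous W := continuous_Q S.abs_zero_le (by simp) hfc n
  have hW0 : ∀ y, 0 ≤ W y := Q_nonneg hf0 n
  set Φ : Y → ℝ := fun y => φ₁ y + φ₂ y with hΦ
  have hΦc : Continuous Φ := (continuous_bump hr _).add (continuous_bump hr _)
  have hΦ0 : ∀ y, 0 ≤ Φ y := fun y => add_nonneg (b1 y).1 (b2 y).1
  -- the tiles have length between `2π / (D |b|)` and `4π / (D |b|)`
  set x₀ := D * |s.im| / (4 * Real.pi) with hx₀
  have hx1 : 1 ≤ x₀ := by
    rw [hx₀, le_div_iff₀ (by positivity), one_mul]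
    rw [div_le_iff₀ hD] at hbD
    linarith
  set N := ⌈x₀⌉₊ with hN
  have hNx : x₀ ≤ N := Nat.le_ceil _
  have hN0 : (0 : ℝ) < N := by linarith
  have hNx2 : (N : ℝ) ≤ 2 * x₀ := by
    have := Nat.ceil_lt_add_one (by linarith : 0 ≤ x₀)
    linarith
  have hN1 : 1 / (N : ℝ) ≤ (4 * Real.pi / D) / |s.im| := by
    rw [div_le_iff₀ hN0]
    calc (1 : ℝ) = (4 * Real.pi / D) / |s.im| * x₀ := by rw [hx₀]; field_simp
      _ ≤ _ := mul_le_mul_of_nonneg_left hNx (by positivity)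
  have hN2 : 2 * Real.pi / (D * |s.im|) ≤ 1 / (N : ℝ) := by
    rw [le_div_iff₀ hN0]
    calc 2 * Real.pi / (D * |s.im|) * N ≤ 2 * Real.pi / (D * |s.im|) * (2 * x₀) :=
          mul_le_mul_of_nonneg_left hNx2 (by positivity)
      _ = 1 := by rw [hx₀]; field_simp; norm_num
  -- `Φ` carries a definite proportion of the integral of `W`
  have hproportion : integ W ≤ K₃ * integ (fun y => Φ y * W y) := by
    have h1 : δ / |s.im| / 2 ≤ 1 / N := by
      refine le_trans ?_ hN2
      have h2 := div_le_div_of_nonneg_right hδ.le_div hb0.le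
      rw [div_div] at h2
      linarith
    have h2 := integ_le_of_tiles hWc hΦc hW0 hΦ0 (Nat.ceil_pos.2 (by linarith : 0 < x₀))
      (Real.exp_pos Λ) (half_pos hr) h1 (fun x y hxy => ?_) (fun k hk => ?_)
    · refine h2.trans (mul_le_mul_of_nonneg_right ?_
        (integ_nonneg fun y => mul_nonneg (hΦ0 y) (hW0 y)))
      rw [div_le_iff₀ (by positivity), hK₃]
      have h3 : 1 ≤ 8 * Real.pi / (D * δ) * (N * (δ / |s.im| / 2)) := by
        calc (1 : ℝ) = 8 * Real.pi / (D * δ) * (x₀ * (δ / |s.im| / 2)) := by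
              rw [hx₀]; field_simp; norm_num
          _ ≤ _ := by gcongr
      calc 2 * Real.exp Λ ^ 2 = 2 * Real.exp Λ ^ 2 * 1 := by ring
        _ ≤ 2 * Real.exp Λ ^ 2 * (8 * Real.pi / (D * δ) * (N * (δ / |s.im| / 2))) :=
          mul_le_mul_of_nonneg_left h3 (by positivity)
        _ = _ := by ring
    · have h3 : |s.im| ^ α * dist x y ^ α ≤ (4 * Real.pi / D) ^ α :=
        S.rpow_mul_dist_le hb (hxy.trans hN1)
      obtain ⟨B', hB'⟩ := exists_bound_of_continuous hfc
      have h4 := Q_le_Q_mul_exp S.abs_zero_le (by simp) hB' hf0 n x y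
        (c := (4 * Real.pi / D) ^ α + κ)
        fun w => harnack_sq_div S h hψpos hκ0.le hψH <| by
          have h5 := mul_le_mul_of_nonneg_left (S.wordMap_dist_rpow n w x y)
            (mul_nonneg hC0.le (Real.rpow_nonneg (abs_nonneg s.im) α))
          have h6 := mul_le_mul_of_nonneg_right hn
            (mul_nonneg (Real.rpow_nonneg (abs_nonneg s.im) α)
              (Real.rpow_nonneg (dist_nonneg (x := x) (y := y)) α))
          linarith
      refine h4.trans ?_
      rw [mul_comm]
      refine mul_le_mul_of_nonneg_right (Real.exp_le_exp.2 ?_) (hW0 y)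
      have h5 := mul_le_of_le_one_right hκ0.le (S.dist_rpow_le_one x y)
      linarith
    · have hk1 : (k : ℝ) / N + 1 / N ≤ 1 := by
        rw [← add_div, div_le_one hN0]
        exact_mod_cast hk
      obtain ⟨y, hy0, hy1, hy⟩ := exists_mem_cancelSet hD hδ hs1 hb hn hn' h huni
        (p := k / N) (by positivity) (by linarith)
      refine ⟨y, hy0, hy1.trans (by linarith), fun z hz => ?_⟩
      rcases hy with hy | hy
      · have h3 := half_le_bump hr hy hz
        exact h3.trans (le_add_of_nonneg_right (b2 z).1)
      · have h3 := half_le_bump hr hy hz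
        exact h3.trans (le_add_of_nonneg_left (b1 z).1)
  have hpoint : ∀ y, S.damped s.re n χ u y ^ 2 / ψ y ≤ Θ * W y - c₀ * (Φ y * W y) := fun y => by
    rw [div_le_iff₀ (hψpos y)]
    have h1 := damped_sq_le hs2 hB (Real.exp_pos _) hψ0 hψ1 hχ00 (fun w y => (hχb w y).2) y
    have h2 := tsum_damping_le hs2 hψ0 hψ1 hne b1 b2 (by positivity : 0 ≤ δ / 8) (by linarith)
      (fun y => (min_le_left _ _).trans (hg₁ _ hs12 y))
      (fun y => (min_le_right _ _).trans (hg₂ _ hs12 y)) hΘ y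
    refine h1.trans ((mul_le_mul_of_nonneg_right h2 (hW0 y)).trans (le_of_eq ?_))
    ring
  have hdc : Continuous fun y => S.damped s.re n χ u y ^ 2 / ψ y :=
    ((hcone.continuous S.α_pos).pow 2).div hψc fun y => (hψpos y).ne'
  have hΦW : Continuous fun y => Φ y * W y := hΦc.mul hWc
  have h1 := integ_mono hdc ((hWc.const_mul Θ).sub (hΦW.const_mul c₀)) hpoint
  have e1 : integ (fun y => Θ * W y - c₀ * (Φ y * W y))
      = Θ * integ W - c₀ * integ (fun y => Φ y * W y) := by
    rw [integ_sub (hWc.const_mul Θ) (hΦW.const_mul c₀), integ_const_mul,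
      integ_const_mul]
  have e2 : integ W = integ fun y => u y ^ 2 / ψ y := integ_Q_zero hfc hf0 n
  have h2 : c₀ / K₃ * integ W ≤ c₀ * integ (fun y => Φ y * W y) := by
    rw [div_mul_eq_mul_div, div_le_iff₀ hK₃0]
    exact (mul_le_mul_of_nonneg_left hproportion hc₀0.le).trans_eq (by ring)
  rw [← e2]
  refine h1.trans (e1.trans_le ?_)
  linarith

end WeightedSystem

/-! ### From mean square to Hölder norm -/

/-- Times of order `log b` are long enough to beat a power of `b`. -/
theorem exists_mul_rpow_mul_pow_le_one {q a B : ℝ} (hq0 : 0 < q) (hq1 : q < 1) (ha : 0 ≤ a)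
    (hB : 0 < B) : ∃ A : ℝ, 0 < A ∧ ∀ b : ℝ, 2 ≤ b → ∀ n : ℕ, A * Real.log b ≤ n →
      B * b ^ a * q ^ n ≤ 1 := by
  have hlq : 0 < -Real.log q := neg_pos.2 (Real.log_neg hq0 hq1)
  have hl2 : 0 < Real.log 2 := Real.log_pos one_lt_two
  refine ⟨(|Real.log B| / Real.log 2 + a + 1) / -Real.log q, by positivity, ?_⟩
  intro b hb n hn
  have hb0 : 0 < b := by linarith
  have hlb : Real.log 2 ≤ Real.log b := Real.log_le_log two_pos hb
  rw [div_mul_eq_mul_div, div_le_iff₀ hlq] at hn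
  have h1 : |Real.log B| ≤ |Real.log B| / Real.log 2 * Real.log b := by
    rw [div_mul_eq_mul_div, le_div_iff₀ hl2]
    exact mul_le_mul_of_nonneg_left hlb (abs_nonneg _)
  have h2 : B * b ^ a * q ^ n = Real.exp (Real.log B + a * Real.log b + n * Real.log q) := by
    rw [Real.exp_add, Real.exp_add, Real.exp_log hB, mul_comm a, ← Real.rpow_def_of_pos hb0,
      mul_comm (n : ℝ), ← Real.rpow_def_of_pos hq0, Real.rpow_natCast]
  rw [h2]
  refine Real.exp_le_one_iff.2 ?_
  linarith [le_abs_self (Real.log B)]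

namespace WeightedSystem

variable {ι : Type*} {α C₁ ρ₀ : ℝ} {S : WeightedSystem ι α C₁ ρ₀}

/-- Once the branches of length `k` contract more than the scale `1 / |b|`, the operator `P_s^k`
turns a mean square bound in the cone into a bound in sup norm. -/
theorem norm_P_sq_le_integ {s : ℂ} (hs2 : |2 * s.re| ≤ S.ε₀) {u ψ : Y → ℝ} {v : Y → ℂ} {C Θ : ℝ}
    (hC : 0 ≤ C) {k : ℕ}
    (hk : C₁ ^ α * |s.im| ^ α * (ρ₀ ^ α) ^ k ≤ 1) (h : Cone α C s.im u v)
    (hψ0 : ∀ y, Real.exp (-weightConst α C₁ ρ₀) ≤ ψ y)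
    (hψ1 : ∀ y, ψ y ≤ Real.exp (weightConst α C₁ ρ₀))
    (hψH : ∀ x y, ψ x ≤ ψ y * Real.exp (weightConst α C₁ ρ₀ * dist x y ^ α))
    (hΘ0 : 0 ≤ Θ) (hΘ : ∀ y, S.Q (2 * s.re) k ψ y ≤ Θ * ψ y) (x : Y) :
    ‖S.P s k v x‖ ^ 2 ≤ Θ * Real.exp (3 * weightConst α C₁ ρ₀ + 2 * C)
      * integ fun y => u y ^ 2 / ψ y := by
  set κ := weightConst α C₁ ρ₀ with hκ
  have hκ0 : 0 < κ := S.weightConst_pos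
  have hs : |s.re| ≤ S.ε₀ := by
    rw [abs_mul, abs_two] at hs2
    linarith [abs_nonneg s.re]
  obtain ⟨B, hB⟩ := exists_bound_of_continuous (h.continuous S.α_pos)
  have hψpos : ∀ y, 0 < ψ y := fun y => (Real.exp_pos _).trans_le (hψ0 y)
  have hψc : Continuous ψ := continuous_of_le_mul_exp S.α_pos hψH
  have hfc : Continuous fun y => u y ^ 2 / ψ y :=
    ((h.continuous S.α_pos).pow 2).div hψc fun y => (hψpos y).ne'
  have hf0 : ∀ y, 0 ≤ u y ^ 2 / ψ y := fun y => div_nonneg (sq_nonneg _) (hψpos y).le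
  obtain ⟨B', hB'⟩ := exists_bound_of_continuous hfc
  set W := S.Q 0 k fun y => u y ^ 2 / ψ y with hW
  have hWc : Continuous W := continuous_Q S.abs_zero_le (by simp) hfc k
  have h1 : ‖S.P s k v x‖ ≤ S.damped s.re k (fun _ _ => 1) u x := by
    refine (norm_P_le hs hB h.norm_le k x).trans_eq ?_
    simp only [damped, Q_apply, one_mul]
  have h2 := damped_sq_le hs2 hB (Real.exp_pos _) hψ0 hψ1 (n := k) (χ := fun _ _ => 1)
    (fun _ _ => zero_le_one) (fun _ _ => le_rfl) x
  have h3 : ∑' w : Word ι k, S.G (2 * s.re) k w x * (1 * ψ (wordMap S.H k w x))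
      ≤ Θ * Real.exp κ := by
    simp only [one_mul]
    exact (hΘ x).trans (mul_le_mul_of_nonneg_left (hψ1 x) hΘ0)
  have hWH : ∀ y, W x ≤ Real.exp (2 * κ + 2 * C) * W y := fun y => by
    have h4 := Q_le_Q_mul_exp S.abs_zero_le (by simp) hB' hf0 k x y (c := 2 * C + κ)
      fun w => harnack_sq_div S h hψpos hκ0.le hψH <| by
        have h5 := mul_le_mul_of_nonneg_left (S.wordMap_dist_rpow k w x y)
          (mul_nonneg hC (Real.rpow_nonneg (abs_nonneg s.im) α))
        have h6 := mul_le_mul_of_nonneg_left hk hC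
        have h7 := mul_le_mul h6 (S.dist_rpow_le_one x y) (Real.rpow_nonneg dist_nonneg _)
          (by linarith)
        linarith
    refine h4.trans ?_
    rw [mul_comm]
    refine mul_le_mul_of_nonneg_right (Real.exp_le_exp.2 ?_) (Q_nonneg hf0 k y)
    have h5 := mul_le_of_le_one_right hκ0.le (S.dist_rpow_le_one x y)
    linarith
  have h4 : W x ≤ Real.exp (2 * κ + 2 * C) * integ fun y => u y ^ 2 / ψ y := by
    have h5 := integ_mono continuous_const (hWc.const_mul (Real.exp (2 * κ + 2 * C))) hWH
    rwa [integ_const, integ_const_mul, hW, integ_Q_zero hfc hf0] at h5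
  have h5 := pow_le_pow_left₀ (norm_nonneg _) h1 2
  refine h5.trans (h2.trans ((mul_le_mul h3 h4 (Q_nonneg hf0 k x) (by positivity)).trans_eq ?_))
  have e : Real.exp (3 * κ + 2 * C) = Real.exp κ * Real.exp (2 * κ + 2 * C) := by
    rw [← Real.exp_add]
    congr 1
    ring
  rw [e]
  ring

/-- A pair in the cone above `P_s^{m n} v` whose mean square decays exponentially in `m`. -/
theorem exists_cone_iterate {c Θ b₀ β : ℝ} {n : ℕ} {s : ℂ} {ψ : Y → ℝ} (hs : |s.re| ≤ S.ε₀)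
    (hb : 1 ≤ |s.im|) (hψ0 : ∀ y, Real.exp (-b₀) ≤ ψ y) (hψc : Continuous ψ) (hβ0 : 0 ≤ β)
    (hβ : Θ - c ≤ β)
    (hstep : ∀ (u : Y → ℝ) (v : Y → ℂ), Cone α (coneConst α C₁ ρ₀) s.im u v →
      ∃ u' : Y → ℝ, Cone α (coneConst α C₁ ρ₀) s.im u' (S.P s n v) ∧
        integ (fun y => u' y ^ 2 / ψ y) ≤ (Θ - c) * integ (fun y => u y ^ 2 / ψ y))
    {v : Y → ℂ} (hv1 : ∀ y, ‖v y‖ ≤ 1)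
    (hv2 : ∀ x y, ‖v x - v y‖ ≤ (1 + |s.im| ^ α) * dist x y ^ α) (m : ℕ) :
    ∃ u : Y → ℝ, Cone α (coneConst α C₁ ρ₀) s.im u (S.P s (m * n) v) ∧
      integ (fun y => u y ^ 2 / ψ y) ≤ β ^ m * Real.exp b₀ := by
  have hψpos : ∀ y, 0 < ψ y := fun y => (Real.exp_pos _).trans_le (hψ0 y)
  have hbα : 1 ≤ |s.im| ^ α := Real.one_le_rpow hb S.α_pos.le
  have hκ := S.weightConst_pos
  have hK := S.one_le_roofConst
  have hC : 2 ≤ coneConst α C₁ ρ₀ := by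
    unfold coneConst
    have h1 : 0 ≤ weightConst α C₁ ρ₀ * Real.exp (weightConst α C₁ ρ₀) := by positivity
    linarith [Real.exp_pos (weightConst α C₁ ρ₀)]
  induction m with
  | zero =>
    refine ⟨fun _ => 1, ⟨?_, fun x y => ?_, fun x y => ?_⟩, ?_⟩
    · rw [Nat.zero_mul, P_zero]
      exact hv1
    · rw [one_mul]
      exact Real.one_le_exp (by positivity)
    · rw [Nat.zero_mul, P_zero, mul_one]
      refine (hv2 x y).trans (mul_le_mul_of_nonneg_right ?_ (Real.rpow_nonneg dist_nonneg _))
      nlinarith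
    · rw [pow_zero, one_mul]
      have h1 := integ_mono (f := fun y => 1 ^ 2 / ψ y) (g := fun _ => Real.exp b₀)
        (continuous_const.div hψc fun y => (hψpos y).ne') continuous_const fun y => by
          rw [one_pow, one_div, inv_le_comm₀ (hψpos y) (Real.exp_pos _), ← Real.exp_neg]
          exact hψ0 y
      rwa [integ_const] at h1
  | succ m ih =>
    obtain ⟨u, hu, hu2⟩ := ih
    obtain ⟨u', hu', hu2'⟩ := hstep u _ hu
    refine ⟨u', ?_, hu2'.trans ?_⟩
    · rwa [Nat.succ_mul, add_comm, P_add hs hv1]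
    · have h0 : 0 ≤ integ (fun y => u y ^ 2 / ψ y) :=
        integ_nonneg fun y => div_nonneg (sq_nonneg _) (hψpos y).le
      refine (mul_le_mul hβ hu2 h0 hβ0).trans_eq ?_
      rw [pow_succ']
      ring

/-- A bound for the Hölder constants of functions of norm at most one under the operators, relative
to the growth of the real operators and to `1 + |b| ^ α`. -/
noncomputable def lasotaYorkeConst (α C₁ ρ₀ : ℝ) : ℝ :=
  weightConst α C₁ ρ₀ * Real.exp (weightConst α C₁ ρ₀) + 2 * roofConst C₁ ρ₀
    + Real.exp (weightConst α C₁ ρ₀) * C₁ ^ α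

theorem one_le_lasotaYorkeConst (S : WeightedSystem ι α C₁ ρ₀) : 1 ≤ lasotaYorkeConst α C₁ ρ₀ := by
  have hκ := S.weightConst_pos
  have hK := S.one_le_roofConst
  have hC := S.C_rpow_pos
  have h1 : 0 ≤ weightConst α C₁ ρ₀ * Real.exp (weightConst α C₁ ρ₀) := by positivity
  have h2 : 0 ≤ Real.exp (weightConst α C₁ ρ₀) * C₁ ^ α := by positivity
  unfold lasotaYorkeConst
  linarith

/-- The Lasota–Yorke inequality in terms of the norm `‖·‖_b`. -/
theorem norm_P_sub_le' {s : ℂ} (hs : |s.re| ≤ S.ε₀) (hs1 : |s.re| ≤ 1) {v : Y → ℂ} {B L g : ℝ}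
    (hB : ∀ y, ‖v y‖ ≤ B) (hL0 : 0 ≤ L)
    (hL : ∀ x y, ‖v x - v y‖ ≤ L * (1 + |s.im| ^ α) * dist x y ^ α) {n : ℕ}
    (hg : ∀ y, S.Q s.re n (fun _ => 1) y ≤ g) (x y : Y) :
    ‖S.P s n v x - S.P s n v y‖ ≤ g * (lasotaYorkeConst α C₁ ρ₀ * (B + L * (ρ₀ ^ α) ^ n))
      * (1 + |s.im| ^ α) * dist x y ^ α := by
  have hκ := S.weightConst_pos
  have hK := S.one_le_roofConst
  have hCα := S.C_rpow_pos
  have hρ := S.rho_rpow_pos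
  set κ := weightConst α C₁ ρ₀ with hκe
  have hbα : 0 ≤ |s.im| ^ α := by positivity
  have hB0 : 0 ≤ B := (norm_nonneg _).trans (hB x)
  have hg0 : 0 ≤ g := (Q_nonneg (fun _ => zero_le_one) n x).trans (hg x)
  have hLb : 0 ≤ L * (1 + |s.im| ^ α) := by positivity
  refine (norm_P_sub_le hs hs1 hB hLb hL n x y).trans ?_
  have hph : phaseConst α C₁ ρ₀ s.im
      ≤ (κ * Real.exp κ + 2 * roofConst C₁ ρ₀) * (1 + |s.im| ^ α) := by
    rw [phaseConst, ← hκe]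
    have h4 : 0 ≤ κ * Real.exp κ := by positivity
    nlinarith
  set E := Real.exp κ with hE
  have hE0 : 0 < E := Real.exp_pos _
  set Z := L * (ρ₀ ^ α) ^ n with hZ
  have hZ0 : 0 ≤ Z := by positivity
  have h1 : phaseConst α C₁ ρ₀ s.im * B
      + E * (L * (1 + |s.im| ^ α) * (C₁ ^ α * (ρ₀ ^ α) ^ n))
      ≤ lasotaYorkeConst α C₁ ρ₀ * (B + Z) * (1 + |s.im| ^ α) := by
    have h2 := mul_le_mul_of_nonneg_right hph hB0
    have h3 : 0 ≤ (κ * E + 2 * roofConst C₁ ρ₀) * (1 + |s.im| ^ α) * Z := by positivity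
    have h4 : 0 ≤ E * C₁ ^ α * (1 + |s.im| ^ α) * B := by positivity
    have e1 : E * (L * (1 + |s.im| ^ α) * (C₁ ^ α * (ρ₀ ^ α) ^ n))
        = E * C₁ ^ α * (1 + |s.im| ^ α) * Z := by rw [hZ]; ring
    have e2 : lasotaYorkeConst α C₁ ρ₀ * (B + Z) * (1 + |s.im| ^ α)
        = (κ * E + 2 * roofConst C₁ ρ₀) * (1 + |s.im| ^ α) * B
          + (κ * E + 2 * roofConst C₁ ρ₀) * (1 + |s.im| ^ α) * Z
          + E * C₁ ^ α * (1 + |s.im| ^ α) * B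
          + E * C₁ ^ α * (1 + |s.im| ^ α) * Z := by
      unfold lasotaYorkeConst
      rw [← hκe, ← hE]
      ring
    rw [e1, e2]
    linarith
  have h2 : 0 ≤ phaseConst α C₁ ρ₀ s.im * B
      + E * (L * (1 + |s.im| ^ α) * (C₁ ^ α * (ρ₀ ^ α) ^ n)) :=
    add_nonneg (mul_nonneg (S.phaseConst_nonneg _) hB0) (by positivity)
  have hd : 0 ≤ dist x y ^ α := Real.rpow_nonneg dist_nonneg _
  refine (mul_le_mul (hg y) (mul_le_mul_of_nonneg_right h1 hd) (mul_nonneg h2 hd) hg0).trans_eq ?_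
  ring

end WeightedSystem

/-! ### Exponential decay for times of order log b -/

namespace WeightedSystem

variable {ι : Type*} {α C₁ ρ₀ : ℝ} {S : WeightedSystem ι α C₁ ρ₀}

/-- The growth of the real operators, read off from an almost invariant density. -/
theorem Q_one_le {σ κ θ : ℝ} (hσ : |σ| ≤ S.ε₀) {ψ : Y → ℝ} (hψ0 : ∀ y, Real.exp (-κ) ≤ ψ y)
    (hψ1 : ∀ y, ψ y ≤ Real.exp κ) {n : ℕ} (hθ0 : 0 ≤ θ)
    (hθ : ∀ y, S.Q σ n ψ y ≤ θ * ψ y) (y : Y) :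
    S.Q σ n (fun _ => 1) y ≤ Real.exp (2 * κ) * θ := by
  have hψpos : ∀ y, 0 < ψ y := fun y => (Real.exp_pos _).trans_le (hψ0 y)
  have h1 : ∀ y, (1 : ℝ) ≤ Real.exp κ * ψ y := fun y => by
    have h2 := mul_le_mul_of_nonneg_left (hψ0 y) (Real.exp_pos κ).le
    rwa [← Real.exp_add, add_neg_cancel, Real.exp_zero] at h2
  have h2 : ∀ y, |Real.exp κ * ψ y| ≤ Real.exp κ * Real.exp κ := fun y => by
    rw [abs_of_pos (mul_pos (Real.exp_pos _) (hψpos y))]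
    exact mul_le_mul_of_nonneg_left (hψ1 y) (Real.exp_pos _).le
  refine (Q_mono (A := 1) hσ (by simp) h2 h1 n y).trans ?_
  rw [Q_const_mul]
  refine (mul_le_mul_of_nonneg_left ((hθ y).trans (mul_le_mul_of_nonneg_left (hψ1 y) hθ0))
    (Real.exp_pos _).le).trans_eq ?_
  rw [two_mul, Real.exp_add]
  ring

/-- Decay of `P_s^n` in the norm `‖·‖_b`, in the form of a bound by `(1 + τ)^n q^m` with `τ` small,
where `m` is a fixed proportion of `n`. -/
theorem norm_P_le_and_norm_P_sub_le {s : ℂ} (hs2 : |2 * s.re| ≤ S.ε₀) (hs12 : |2 * s.re| ≤ 1)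
    (hb : 1 ≤ |s.im|) {ψ : Y → ℝ} {n₀ : ℕ} {τ β q c : ℝ} (hτ : 0 ≤ τ)
    (hψ0 : ∀ y, Real.exp (-weightConst α C₁ ρ₀) ≤ ψ y)
    (hψ1 : ∀ y, ψ y ≤ Real.exp (weightConst α C₁ ρ₀))
    (hψH : ∀ x y, ψ x ≤ ψ y * Real.exp (weightConst α C₁ ρ₀ * dist x y ^ α))
    (hΘ : ∀ n y, S.Q (2 * s.re) n ψ y ≤ (1 + τ) ^ n * ψ y)
    (hΘ' : ∀ n y, S.Q s.re n ψ y ≤ (1 + τ) ^ n * ψ y)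
    (hβ0 : 0 ≤ β) (hβ : (1 + τ) ^ n₀ - c ≤ β) (hβq : β ≤ q ^ 2) (hρq : ρ₀ ^ α ≤ q) (hq1 : q ≤ 1)
    (hstep : ∀ (u : Y → ℝ) (v : Y → ℂ), Cone α (coneConst α C₁ ρ₀) s.im u v →
      ∃ u' : Y → ℝ, Cone α (coneConst α C₁ ρ₀) s.im u' (S.P s n₀ v) ∧
        integ (fun y => u' y ^ 2 / ψ y) ≤ ((1 + τ) ^ n₀ - c) * integ (fun y => u y ^ 2 / ψ y))
    {v : Y → ℂ} (hv1 : ∀ y, ‖v y‖ ≤ 1)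
    (hv2 : ∀ x y, ‖v x - v y‖ ≤ (1 + |s.im| ^ α) * dist x y ^ α) {j k m : ℕ} (hmj : m ≤ j)
    (hk : C₁ ^ α * |s.im| ^ α * (ρ₀ ^ α) ^ k ≤ 1) {K : ℝ}
    (hK : K = Real.exp (2 * weightConst α C₁ ρ₀) * lasotaYorkeConst α C₁ ρ₀ *
      (Real.exp (2 * weightConst α C₁ ρ₀ + coneConst α C₁ ρ₀)
        + 2 * lasotaYorkeConst α C₁ ρ₀ * Real.exp (2 * weightConst α C₁ ρ₀))) :
    (∀ y, ‖S.P s (j + (k + m * n₀)) v y‖ ≤ K * ((1 + τ) ^ (j + (k + m * n₀)) * q ^ m)) ∧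
    ∀ x y, ‖S.P s (j + (k + m * n₀)) v x - S.P s (j + (k + m * n₀)) v y‖
      ≤ K * ((1 + τ) ^ (j + (k + m * n₀)) * q ^ m) * (1 + |s.im| ^ α) * dist x y ^ α := by
  have hs : |s.re| ≤ S.ε₀ := by
    rw [abs_mul, abs_two] at hs2
    linarith [abs_nonneg s.re]
  have hs1 : |s.re| ≤ 1 := by
    rw [abs_mul, abs_two] at hs12
    linarith [abs_nonneg s.re]
  have hψc : Continuous ψ := continuous_of_le_mul_exp S.α_pos hψH
  have hκ0 := S.weightConst_pos
  have hK0 := S.one_le_roofConst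
  have hC0 : 0 ≤ coneConst α C₁ ρ₀ := by unfold coneConst; positivity
  have hΛ := S.one_le_lasotaYorkeConst
  have hρ0 := S.rho_rpow_pos
  set κ := weightConst α C₁ ρ₀ with hκ
  set C := coneConst α C₁ ρ₀ with hC
  set Λ := lasotaYorkeConst α C₁ ρ₀ with hΛ'
  have hq0 : 0 ≤ q := hρ0.le.trans hρq
  have hT1 : ∀ n : ℕ, 1 ≤ (1 + τ) ^ n := fun n => one_le_pow₀ (by linarith)
  have hT0 : ∀ n : ℕ, 0 ≤ (1 + τ) ^ n := fun n => zero_le_one.trans (hT1 n)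
  have hg : ∀ n y, S.Q s.re n (fun _ => 1) y ≤ Real.exp (2 * κ) * (1 + τ) ^ n := fun n =>
    Q_one_le hs hψ0 hψ1 (hT0 n) (hΘ' n)
  set l := k + m * n₀ with hl
  set w := S.P s l v with hw
  obtain ⟨u, hu, hu2⟩ := exists_cone_iterate hs hb hψ0 hψc hβ0 hβ hstep hv1 hv2 m
  set T := (1 + τ) ^ l with hT
  set B := T * Real.exp (2 * κ + C) * q ^ m with hB
  have hB0 : 0 ≤ B := mul_nonneg (mul_nonneg (hT0 l) (Real.exp_pos _).le) (pow_nonneg hq0 _)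
  -- sup norm after `m n₀` steps in the cone and `k` smoothing steps
  have hwB : ∀ y, ‖w y‖ ≤ B := fun y => by
    refine le_of_sq_le_sq ?_ hB0
    rw [hw, hl, P_add hs hv1]
    refine (norm_P_sq_le_integ hs2 hC0 hk hu hψ0 hψ1 hψH (hT0 k) (hΘ k) y).trans ?_
    have h1 : β ^ m ≤ (q ^ m) ^ 2 := by
      rw [← pow_mul, mul_comm, pow_mul]
      exact pow_le_pow_left₀ hβ0 hβq m
    have h2 : (1 + τ) ^ k ≤ T ^ 2 := by
      rw [hT, ← pow_mul]
      refine pow_le_pow_right₀ (by linarith) ?_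
      rw [hl]
      nlinarith [Nat.zero_le (m * n₀)]
    have h3 := hu2.trans (mul_le_mul_of_nonneg_right h1 (Real.exp_pos κ).le)
    refine (mul_le_mul (mul_le_mul_of_nonneg_right h2 (Real.exp_pos _).le) h3
      (integ_nonneg fun y => div_nonneg (sq_nonneg _)
        ((Real.exp_pos _).trans_le (hψ0 y)).le) (by positivity)).trans_eq ?_
    have e1 : Real.exp (2 * κ + C) ^ 2 = Real.exp (3 * κ + 2 * C) * Real.exp κ := by
      rw [← Real.exp_nat_mul, ← Real.exp_add]
      congr 1
      push_cast
      ring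
    rw [hB, mul_pow, mul_pow, e1]
    ring
  have hT0' : 0 ≤ T := hT0 l
  have hρ1 := S.rho_rpow_lt
  set L := Real.exp (2 * κ) * T * (2 * Λ) with hL
  have hL0 : 0 ≤ L := by positivity
  have hwL : ∀ x y, ‖w x - w y‖ ≤ L * (1 + |s.im| ^ α) * dist x y ^ α := fun x y => by
    have h1 := norm_P_sub_le' hs hs1 hv1 zero_le_one (by simpa using hv2) (hg l) x y
    refine h1.trans ?_
    have h2 : (ρ₀ ^ α) ^ l ≤ 1 := pow_le_one₀ hρ0.le hρ1.le
    have h3 : Λ * (1 + 1 * (ρ₀ ^ α) ^ l) ≤ 2 * Λ := by nlinarith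
    have hbα : 0 ≤ 1 + |s.im| ^ α :=
      add_nonneg zero_le_one (Real.rpow_nonneg (abs_nonneg _) _)
    exact mul_le_mul_of_nonneg_right (mul_le_mul_of_nonneg_right (mul_le_mul_of_nonneg_left h3
      (mul_nonneg (Real.exp_pos _).le hT0')) hbα) (Real.rpow_nonneg dist_nonneg _)
  -- the last `j` steps bring the Hölder seminorm down to the size of the sup norm
  have hPl : S.P s (j + l) v = S.P s j w := P_add hs hv1 j l
  have hsplit : (1 + τ) ^ (j + l) = (1 + τ) ^ j * T := by rw [pow_add]
  have hρj : (ρ₀ ^ α) ^ j ≤ q ^ m :=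
    (pow_le_pow_left₀ hρ0.le hρq j).trans (pow_le_pow_of_le_one hq0 hq1 hmj)
  have hBL : B + L * (ρ₀ ^ α) ^ j
      ≤ (Real.exp (2 * κ + C) + 2 * Λ * Real.exp (2 * κ)) * (T * q ^ m) := by
    have h1 := mul_le_mul_of_nonneg_left hρj hL0
    have e1 : (Real.exp (2 * κ + C) + 2 * Λ * Real.exp (2 * κ)) * (T * q ^ m)
        = B + L * q ^ m := by rw [hB, hL]; ring
    rw [e1]
    linarith
  have hmain : Real.exp (2 * κ) * (1 + τ) ^ j * (Λ * (B + L * (ρ₀ ^ α) ^ j))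
      ≤ K * ((1 + τ) ^ (j + l) * q ^ m) := by
    have h1 := hT0 j
    refine (mul_le_mul_of_nonneg_left (mul_le_mul_of_nonneg_left hBL (by linarith))
      (by positivity : 0 ≤ Real.exp (2 * κ) * (1 + τ) ^ j)).trans_eq ?_
    rw [hK, hsplit]
    ring
  rw [hPl]
  refine ⟨fun y => ?_, fun x y => ?_⟩
  · have h1 := norm_P_le (u := fun _ => B * 1) (B := B) hs (fun y => by
      rw [mul_one, abs_of_nonneg hB0]) (fun y => by rw [mul_one]; exact hwB y) j y
    rw [Q_const_mul] at h1
    refine h1.trans (le_trans ?_ hmain)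
    have h2 := mul_le_mul_of_nonneg_left (hg j y) hB0
    have h3 : B ≤ Λ * (B + L * (ρ₀ ^ α) ^ j) := by
      have h4 : 0 ≤ L * (ρ₀ ^ α) ^ j := by positivity
      nlinarith
    have h5 := mul_le_mul_of_nonneg_left h3
      (mul_nonneg (Real.exp_pos (2 * κ)).le (hT0 j))
    linarith
  · refine (norm_P_sub_le' hs hs1 hwB hL0 hwL (hg j) x y).trans ?_
    have hbα : 0 ≤ |s.im| ^ α := Real.rpow_nonneg (abs_nonneg _) _
    exact mul_le_mul_of_nonneg_right (mul_le_mul_of_nonneg_right hmain (by linarith))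
      (Real.rpow_nonneg dist_nonneg _)

/-- Exponential decay of `P_s^n` for times of order `log |b|`. -/
theorem exists_rate (S : WeightedSystem ι α C₁ ρ₀) {D : ℝ} (hD : 0 < D) {n₀ : ℕ} (hn₀ : 1 ≤ n₀)
    (hn : C₁ ^ α * coneConst α C₁ ρ₀ * (ρ₀ ^ α) ^ n₀ ≤ 1 / 2)
    (hn' : C₁ ^ α * coneConst α C₁ ρ₀ * (ρ₀ ^ α) ^ n₀ * (4 * Real.pi / D) ^ α ≤ 0.066)
    {w₁ w₂ : Word ι n₀}
    (huni : ∀ x y : Y, D * dist x y ≤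
      |(S.birk n₀ w₁ x - S.birk n₀ w₂ x) - (S.birk n₀ w₁ y - S.birk n₀ w₂ y)|) :
    ∃ ε ∈ Ioo (0 : ℝ) 1, ε ≤ S.ε₀ ∧ ∃ γ ∈ Ioo (0 : ℝ) 1, ∃ A : ℝ, 0 < A ∧
      ∀ s : ℂ, |s.re| < ε → 4 * Real.pi / D ≤ |s.im| → 2 ≤ |s.im| →
      ∀ n : ℕ, A * Real.log |s.im| ≤ n → ∀ v : Y → ℂ, (∀ y, ‖v y‖ ≤ 1) →
        (∀ x y, ‖v x - v y‖ ≤ (1 + |s.im| ^ α) * dist x y ^ α) →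
        (∀ y, ‖S.P s n v y‖ ≤ γ ^ n) ∧
        ∀ x y, ‖S.P s n v x - S.P s n v y‖ ≤ γ ^ n * (1 + |s.im| ^ α) * dist x y ^ α := by
  obtain ⟨c₀, hc₀, hstep⟩ := S.exists_cone_contraction hD hn hn' huni
  set c := min c₀ 1 with hc
  have hc0 : 0 < c := lt_min hc₀ one_pos
  have hc1 : c ≤ 1 := min_le_right _ _
  have hcc : c ≤ c₀ := min_le_left _ _
  -- with `(1 + τ) ^ n₀ ≤ 1 + c / 2` one step in the cone multiplies the mean square by at most `β`,
  -- and norms by at most `q`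
  set β := 1 - c / 2 with hβ
  have hβ0 : 0 < β := by rw [hβ]; linarith
  have hρ0 := S.rho_rpow_pos
  have hρ1 := S.rho_rpow_lt
  set q := max (Real.sqrt β) (ρ₀ ^ α) with hq
  have hρq : ρ₀ ^ α ≤ q := le_max_right _ _
  have hq0 : 0 < q := hρ0.trans_le hρq
  have hq1 : q < 1 := max_lt (by
    rw [Real.sqrt_lt' one_pos, hβ]
    linarith) hρ1
  have hβq : β ≤ q ^ 2 := by
    rw [← Real.sq_sqrt hβ0.le]
    exact pow_le_pow_left₀ (Real.sqrt_nonneg _) (le_max_left _ _) 2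
  have hn₀' : (0 : ℝ) < n₀ := by exact_mod_cast hn₀
  -- `m` is about `n / (3 n₀)`, so `q ^ m` is about `γ ^ (4 n)`; of these four factors `γ ^ n` one
  -- absorbs `(1 + τ) ^ n`, one the constant `K / q`, and one is the claimed rate
  set γ := q ^ ((1 : ℝ) / (12 * n₀)) with hγ
  have hγ0 : 0 < γ := Real.rpow_pos_of_pos hq0 _
  have hγ1 : γ < 1 := Real.rpow_lt_one hq0.le hq1 (by positivity)
  have hγq : γ ^ (12 * n₀) = q := by
    rw [hγ, ← Real.rpow_natCast, ← Real.rpow_mul hq0.le]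
    push_cast
    rw [one_div, inv_mul_cancel₀ (by positivity), Real.rpow_one]
  obtain ⟨τ, hτ0, hτ1, hτ2⟩ : ∃ τ : ℝ, 0 < τ ∧ (1 + τ) ^ n₀ ≤ 1 + c / 2 ∧ (1 + τ) * γ ≤ 1 := by
    have h1 : Filter.Tendsto (fun τ : ℝ => (1 + τ) ^ n₀) (nhdsWithin 0 (Ioi 0)) (nhds 1) := by
      have h2 : Continuous fun τ : ℝ => (1 + τ) ^ n₀ := by fun_prop
      have h3 := (h2.tendsto 0).mono_left (nhdsWithin_le_nhds (s := Ioi 0))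
      simpa using h3
    have h2 : Filter.Tendsto (fun τ : ℝ => (1 + τ) * γ) (nhdsWithin 0 (Ioi 0)) (nhds γ) := by
      have h2 : Continuous fun τ : ℝ => (1 + τ) * γ := by fun_prop
      have h3 := (h2.tendsto 0).mono_left (nhdsWithin_le_nhds (s := Ioi 0))
      simpa using h3
    obtain ⟨τ, h3, h4, h5⟩ := ((h1.eventually_le_const (by linarith : 1 < 1 + c / 2)).and
      ((h2.eventually_le_const hγ1).and self_mem_nhdsWithin)).exists
    exact ⟨τ, h5, h3, h4⟩
  obtain ⟨ψ, ε₁, hε₁, hε₁S, hψ0, hψ1, hψH, hψQ⟩ := S.exists_almost_invariant_density hτ0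
  obtain ⟨A₁, hA₁, hA₁'⟩ := exists_mul_rpow_mul_pow_le_one hρ0 hρ1
    (mul_nonneg zero_le_three S.α_pos.le) (pow_pos S.C_rpow_pos 3)
  have hΛ := S.one_le_lasotaYorkeConst
  obtain ⟨K, hK⟩ : ∃ K, K = Real.exp (2 * weightConst α C₁ ρ₀) * lasotaYorkeConst α C₁ ρ₀ *
      (Real.exp (2 * weightConst α C₁ ρ₀ + coneConst α C₁ ρ₀)
        + 2 * lasotaYorkeConst α C₁ ρ₀ * Real.exp (2 * weightConst α C₁ ρ₀)) := ⟨_, rfl⟩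
  have hK0 : 0 < K := by rw [hK]; positivity
  obtain ⟨A₂, hA₂, hA₂'⟩ := exists_mul_rpow_mul_pow_le_one hγ0 hγ1 le_rfl
    (div_pos hK0 hq0)
  refine ⟨min ε₁ (1 / 2), ⟨lt_min hε₁ (by norm_num), (min_le_right _ _).trans_lt (by norm_num)⟩,
    (min_le_left _ _).trans (by linarith), γ, ⟨hγ0, hγ1⟩, max A₁ A₂, lt_max_of_lt_left hA₁, ?_⟩
  intro s hsε hbD hb2 n hAn v hv1 hv2
  have hb1 : 1 ≤ |s.im| := by linarith
  have hlog : 0 ≤ Real.log |s.im| := Real.log_nonneg hb1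
  have hsε1 : |s.re| ≤ ε₁ := hsε.le.trans (min_le_left _ _)
  have hs2 : |2 * s.re| ≤ S.ε₀ := by rw [abs_mul, abs_two]; linarith
  have hs12 : |2 * s.re| ≤ 1 := by
    rw [abs_mul, abs_two]
    linarith [hsε.le.trans (min_le_right _ _)]
  -- the time is divided into `m n₀` steps in the cone, `k` and `j` further steps
  set j := n / 3 with hj
  set m := n / (3 * n₀) with hm
  have hmj : m ≤ j := Nat.div_le_div_left (by omega) (by norm_num)
  have hmn : 3 * (m * n₀) ≤ n := by
    have := Nat.div_mul_le_self n (3 * n₀)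
    calc 3 * (m * n₀) = m * (3 * n₀) := by ring
      _ ≤ n := this
  obtain ⟨k, hk⟩ : ∃ k, n = j + (k + m * n₀) := ⟨n - j - m * n₀, by omega⟩
  have hkn : n ≤ 3 * k := by omega
  have hmn' : n ≤ 3 * n₀ * (m + 1) := by
    have := Nat.lt_mul_div_succ n (by omega : 0 < 3 * n₀)
    exact this.le
  have hkb : C₁ ^ α * |s.im| ^ α * (ρ₀ ^ α) ^ k ≤ 1 := by
    have h1 := hA₁' |s.im| hb2 n ((mul_le_mul_of_nonneg_right (le_max_left _ _) hlog).trans hAn)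
    have h2 : (C₁ ^ α * |s.im| ^ α * (ρ₀ ^ α) ^ k) ^ 3 ≤ 1 := by
      refine le_trans ?_ h1
      rw [mul_pow, mul_pow, ← pow_mul, mul_comm k 3, ← Real.rpow_natCast (|s.im| ^ α),
        ← Real.rpow_mul (abs_nonneg _), mul_comm α]
      push_cast
      refine mul_le_mul_of_nonneg_left (pow_le_pow_of_le_one hρ0.le hρ1.le hkn) ?_
      have := S.C_rpow_pos
      positivity
    have := S.C_rpow_pos
    exact (pow_le_one_iff_of_nonneg (by positivity) (by norm_num)).1 h2
  have hrate : K * ((1 + τ) ^ n * q ^ m) ≤ γ ^ n := by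
    have h1 : (1 + τ) ^ n * γ ^ n ≤ 1 := by
      rw [← mul_pow]
      exact pow_le_one₀ (by positivity) hτ2
    have h2 : q ^ m * q ≤ (γ ^ n) ^ 4 := by
      rw [← pow_succ, ← hγq, ← pow_mul, ← pow_mul]
      refine pow_le_pow_of_le_one hγ0.le hγ1.le ?_
      calc n * 4 ≤ 3 * n₀ * (m + 1) * 4 := Nat.mul_le_mul_right 4 hmn'
        _ = _ := by ring
    have h3 : K / q * γ ^ n ≤ 1 := by
      have h4 := hA₂' |s.im| hb2 n ((mul_le_mul_of_nonneg_right (le_max_right _ _) hlog).trans hAn)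
      rwa [Real.rpow_zero, mul_one] at h4
    have hγn0 : 0 < γ ^ n := pow_pos hγ0 n
    have hγn1 : γ ^ n ≤ 1 := pow_le_one₀ hγ0.le hγ1.le
    have h5 : q ^ m ≤ (γ ^ n) ^ 4 / q := (le_div_iff₀ hq0).2 h2
    calc K * ((1 + τ) ^ n * q ^ m) ≤ K * ((1 + τ) ^ n * ((γ ^ n) ^ 4 / q)) := by gcongr
      _ = (K / q * γ ^ n) * ((1 + τ) ^ n * γ ^ n) * (γ ^ n * γ ^ n) := by ring
      _ ≤ 1 * 1 * (1 * γ ^ n) := by gcongr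
      _ = γ ^ n := by ring
  have h0 : |s.re| ≤ S.ε₀ := by
    rw [abs_mul, abs_two] at hs2
    linarith [abs_nonneg s.re]
  have hψQ' : ∀ n y, S.Q s.re n ψ y ≤ (1 + τ) ^ n * ψ y := fun n y => by
    have h1 := hψQ (s.re / 2) (by rw [abs_div, abs_two]; linarith [abs_nonneg s.re]) n y
    rwa [mul_div_cancel₀ _ two_ne_zero] at h1
  have hmain := norm_P_le_and_norm_P_sub_le hs2 hs12 hb1 hτ0.le hψ0 hψ1 hψH (hψQ s.re hsε1) hψQ'
    hβ0.le (by linarith : (1 + τ) ^ n₀ - c₀ ≤ β) hβq hρq hq1.le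
    (fun u v h => hstep s _ u ψ v hs2 hs12 hb1 hbD h hψ0 hψ1 hψH (hψQ s.re hsε1 n₀))
    hv1 hv2 hmj hkb hK
  rw [← hk] at hmain
  refine ⟨fun y => (hmain.1 y).trans hrate, fun x y => (hmain.2 x y).trans ?_⟩
  gcongr

end WeightedSystem

/-! ### The weighted system of a full-branch map -/

namespace FullBranchMap

variable {α : ℝ} {ι : Type*} {T : FullBranchMap α ι} {C₁ ρ₀ : ℝ} {R : ℝ → ℝ}

/-- The inverse branch `h m` as a map of `Y` into itself. -/
def branchMap (T : FullBranchMap α ι) (m : ι) (y : Y) : Y := ⟨T.h m y, T.h_mem m y.2⟩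

/-- The list of the letters of a word. -/
def wordList {ι : Type*} : (n : ℕ) → Word ι n → List ι
  | 0, _ => []
  | n + 1, (m, w) => m :: wordList n w

theorem length_wordList (n : ℕ) (w : Word ι n) : (wordList n w).length = n := by
  induction n with
  | zero => rfl
  | succ n ih => exact congrArg (· + 1) (ih w.2)

theorem exists_wordList_eq {n : ℕ} {l : List ι} (hl : l.length = n) :
    ∃ w : Word ι n, wordList n w = l := by
  subst hl
  induction l with
  | nil => exact ⟨PUnit.unit, rfl⟩
  | cons m l ih =>
    obtain ⟨w, hw⟩ := ih
    exact ⟨(m, w), congrArg (m :: ·) hw⟩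

theorem branch_wordList (n : ℕ) (w : Word ι n) (y : Y) :
    T.branch (wordList n w) (y : ℝ) = (wordMap T.branchMap n w y : Y) := by
  induction n with
  | zero => rfl
  | succ n ih =>
    obtain ⟨m, w⟩ := w
    change T.h m (T.branch (wordList n w) y) = T.h m (wordMap T.branchMap n w y : Y)
    rw [ih w]

theorem branch_mem (l : List ι) {y : ℝ} (hy : y ∈ Y) : T.branch l y ∈ Y := by
  induction l with
  | nil => exact hy
  | cons m l ih => exact T.h_mem m ih

theorem differentiableOn_branch (hT : T.IsUniformlyExpanding C₁ ρ₀) (l : List ι) :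
    DifferentiableOn ℝ (T.branch l) Y := by
  induction l with
  | nil => exact differentiableOn_id
  | cons m l ih => exact (hT.differentiableOn_h m).comp ih fun y hy => T.branch_mem l hy

theorem dist_wordMap_le (hT : T.IsUniformlyExpanding C₁ ρ₀) (n : ℕ) (w : Word ι n) (x y : Y) :
    dist (wordMap T.branchMap n w x) (wordMap T.branchMap n w y) ≤ C₁ * ρ₀ ^ n * dist x y := by
  have h := (convex_Icc (0 : ℝ) 1).norm_image_sub_le_of_norm_derivWithin_le
    (differentiableOn_branch hT (wordList n w))
    (fun z hz => hT.contracting n _ ⟨_, length_wordList n w, rfl⟩ z hz) y.2 x.2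
  rw [branch_wordList, branch_wordList] at h
  exact h

theorem jacobian_pos (hT : T.IsUniformlyExpanding C₁ ρ₀) (m : ι) (y : Y) :
    0 < |derivWithin (T.h m) Y y| := abs_pos.2 (hT.deriv_h_ne_zero m y y.2)

theorem jacobian_le_mul_exp (hT : T.IsUniformlyExpanding C₁ ρ₀) (m : ι) (x y : Y) :
    |derivWithin (T.h m) Y x| ≤ |derivWithin (T.h m) Y y| * Real.exp (C₁ * dist x y ^ α) := by
  have h := (le_abs_self _).trans (hT.distortion m x x.2 y y.2)
  rw [← Real.exp_log (jacobian_pos hT m x), ← Real.exp_log (jacobian_pos hT m y),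
    ← Real.exp_add]
  refine Real.exp_le_exp.2 ?_
  rw [Subtype.dist_eq, Real.dist_eq]
  linarith

/-- Inverse branches map the interior into the interior. -/
theorem h_mem_Ioo (hT : T.IsUniformlyExpanding C₁ ρ₀) (m : ι) {y : ℝ} (hy : y ∈ Ioo (0 : ℝ) 1) :
    T.h m y ∈ Ioo (T.c m) (T.d m) := by
  have hnhds : Y ∈ nhds y := Icc_mem_nhds hy.1 hy.2
  have hmaps : ∀ᶠ x in nhds y, T.h m x ∈ Icc (T.c m) (T.d m) := by
    filter_upwards [hnhds] with x hx using (T.bijOn_h m).mapsTo hx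
  have hmem := (T.bijOn_h m).mapsTo (Ioo_subset_Icc_self hy)
  -- an interior point mapped to an end point would be a critical point
  have hd : deriv (T.h m) y ≠ 0 := by
    rw [← derivWithin_of_mem_nhds hnhds]
    exact hT.deriv_h_ne_zero m y (Ioo_subset_Icc_self hy)
  refine ⟨hmem.1.lt_of_ne fun h => hd ?_, hmem.2.lt_of_ne fun h => hd ?_⟩
  · refine IsLocalMin.deriv_eq_zero ?_
    filter_upwards [hmaps] with x hx
    rw [← h]
    exact hx.1
  · refine IsLocalMax.deriv_eq_zero ?_
    filter_upwards [hmaps] with x hx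
    rw [h]
    exact hx.2

theorem differentiableAt_roof (hT : T.IsUniformlyExpanding C₁ ρ₀) (hR : T.IsExpandingRoof C₁ R)
    (m : ι) {y : ℝ} (hy : y ∈ Ioo (0 : ℝ) 1) : DifferentiableAt ℝ (R ∘ T.h m) y := by
  have h1 := h_mem_Ioo hT m hy
  have h2 : DifferentiableAt ℝ R (T.h m y) :=
    ((hR.contDiffOn m).differentiableOn one_ne_zero).differentiableAt (Ioo_mem_nhds h1.1 h1.2)
  have h3 : DifferentiableAt ℝ (T.h m) y :=
    (hT.differentiableOn_h m).differentiableAt (Icc_mem_nhds hy.1 hy.2)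
  exact h2.comp y h3

/-- The roof function seen through a branch is the restriction of a Lipschitz function. -/
theorem exists_lipschitz_roof (hT : T.IsUniformlyExpanding C₁ ρ₀) (hR : T.IsExpandingRoof C₁ R)
    (m : ι) : ∃ g : ℝ → ℝ, LipschitzWith C₁.toNNReal g ∧
      (∀ y ∈ Ioo (0 : ℝ) 1, R (T.h m y) = g y) ∧ ∀ y ∈ Y, T.roofBranch R m y = g y := by
  have h0 : 0 ≤ C₁ := zero_le_one.trans hT.one_le_C
  have h1 : LipschitzOnWith C₁.toNNReal (R ∘ T.h m) (Ioo 0 1) := by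
    refine (convex_Ioo (0 : ℝ) 1).lipschitzOnWith_of_nnnorm_deriv_le
      (fun y hy => differentiableAt_roof hT hR m hy) fun y hy => ?_
    rw [← NNReal.coe_le_coe, coe_nnnorm, Real.coe_toNNReal _ h0]
    exact hR.deriv_le m y hy
  obtain ⟨g, hg, hgeq⟩ := h1.extend_real
  refine ⟨g, hg, fun y hy => hgeq hy, fun y hy => ?_⟩
  refine extendFrom_eq ?_ ?_
  · rw [closure_Ioo zero_ne_one]
    exact hy
  · have h2 : Filter.Tendsto g (nhdsWithin y (Ioo 0 1)) (nhds (g y)) :=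
      (hg.continuous.tendsto y).mono_left nhdsWithin_le_nhds
    refine h2.congr' ?_
    filter_upwards [self_mem_nhdsWithin] with x hx using (hgeq hx).symm

theorem roofBranch_sub_le (hT : T.IsUniformlyExpanding C₁ ρ₀) (hR : T.IsExpandingRoof C₁ R)
    (m : ι) (x y : Y) : |T.roofBranch R m x - T.roofBranch R m y| ≤ C₁ * dist x y := by
  obtain ⟨g, hg, -, hgr⟩ := exists_lipschitz_roof hT hR m
  rw [hgr x x.2, hgr y y.2]
  have h := hg.dist_le_mul x y
  rwa [Real.coe_toNNReal _ (zero_le_one.trans hT.one_le_C)] at h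

theorem roofBranch_eq (hT : T.IsUniformlyExpanding C₁ ρ₀) (hR : T.IsExpandingRoof C₁ R)
    (m : ι) {y : ℝ} (hy : y ∈ Ioo (0 : ℝ) 1) : T.roofBranch R m y = R (T.h m y) := by
  obtain ⟨g, -, hgi, hgr⟩ := exists_lipschitz_roof hT hR m
  rw [hgr y (Ioo_subset_Icc_self hy), hgi y hy]

/-- The boundedness of `f` excludes the junk value of the supremum. -/
theorem le_supNormOn {s : Set ℝ} {f : ℝ → ℝ} {B : ℝ} (hB : ∀ y ∈ s, |f y| ≤ B) {y : ℝ}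
    (hy : y ∈ s) : |f y| ≤ supNormOn s f :=
  le_ciSup (f := fun y : s => |f y|) ⟨B, by rintro _ ⟨z, rfl⟩; exact hB z z.2⟩ ⟨y, hy⟩

/-- The bound extends from `(0,1)` to `Y` by continuity. -/
theorem abs_roofBranch_le (hT : T.IsUniformlyExpanding C₁ ρ₀) (hR : T.IsExpandingRoof C₁ R)
    (m : ι) (y : Y) : |T.roofBranch R m y| ≤ supNormOn (Ioo 0 1) (R ∘ T.h m) := by
  obtain ⟨g, hg, hgi, hgr⟩ := exists_lipschitz_roof hT hR m
  rw [hgr y y.2]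
  obtain ⟨B, hB⟩ := isCompact_Icc.exists_bound_of_continuousOn
    (hg.continuous.continuousOn (s := Icc (0 : ℝ) 1))
  have h1 : Ioo (0 : ℝ) 1 ⊆ {x | |g x| ≤ supNormOn (Ioo 0 1) (R ∘ T.h m)} := fun x hx => by
    have h2 := le_supNormOn (s := Ioo (0 : ℝ) 1) (f := R ∘ T.h m) (B := B) (fun z hz => by
      rw [Function.comp_apply, hgi z hz]
      exact hB z (Ioo_subset_Icc_self hz)) hx
    rwa [Function.comp_apply, hgi x hx] at h2
  have h2 := closure_minimal h1 (isClosed_le hg.continuous.abs continuous_const)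
  rw [closure_Ioo zero_ne_one] at h2
  exact h2 y.2

theorem jacobian_le_supNormOn (hT : T.IsUniformlyExpanding C₁ ρ₀) (m : ι) (y : Y) :
    |derivWithin (T.h m) Y y| ≤ supNormOn Y (derivWithin (T.h m) Y) :=
  le_supNormOn (fun z hz => hT.contracting 1 (T.h m) ⟨[m], rfl, rfl⟩ z hz) y.2

theorem exp_mul_jacobian_le (hT : T.IsUniformlyExpanding C₁ ρ₀) (hR : T.IsExpandingRoof C₁ R)
    {ε : ℝ} (hε : 0 < ε) (m : ι) (y : Y) :
    Real.exp (ε * |T.roofBranch R m y|) * |derivWithin (T.h m) Y y| ≤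
      Real.exp (ε * supNormOn (Ioo 0 1) (R ∘ T.h m)) * supNormOn Y (derivWithin (T.h m) Y) :=
  mul_le_mul
    (Real.exp_le_exp.2 (mul_le_mul_of_nonneg_left (abs_roofBranch_le hT hR m y) hε.le))
    (jacobian_le_supNormOn hT m y) (abs_nonneg _) (Real.exp_pos _).le

theorem integ_eq_toReal_lintegral {f : Y → ℝ} (hf : Continuous f) (hf0 : ∀ y, 0 ≤ f y) :
    integ f = (∫⁻ x in Y, ENNReal.ofReal (f (projIcc 0 1 zero_le_one x))).toReal := by
  rw [integ, intervalIntegral.integral_of_le zero_le_one, ← integral_Icc_eq_integral_Ioc,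
    integral_eq_lintegral_of_nonneg_ae (Filter.Eventually.of_forall fun x => hf0 _)
      (hf.comp continuous_projIcc).aestronglyMeasurable]

/-- The transfer operator preserves Lebesgue measure, by a change of variables in each branch. -/
theorem integ_transfer [Countable ι] (hα : 0 < α) (hT : T.IsUniformlyExpanding C₁ ρ₀) {M : ι → ℝ}
    (hM : Summable M) (hJ : ∀ m (y : Y), |derivWithin (T.h m) Y y| ≤ M m) {f : Y → ℝ}
    (hf : Continuous f) (hf0 : ∀ y, 0 ≤ f y) :
    integ (fun y : Y => ∑' m, |derivWithin (T.h m) Y y| * f (T.branchMap m y)) = integ f := by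
  obtain ⟨B, hB⟩ := exists_bound_of_continuous hf
  have hJc : ∀ m, Continuous fun y : Y => |derivWithin (T.h m) Y y| := fun m =>
    continuous_of_le_mul_exp hα (jacobian_le_mul_exp hT m)
  have hHc : ∀ m, Continuous (T.branchMap m) := fun m =>
    ((T.continuousOn_h m).domRestrict).subtype_mk _
  have hterm : ∀ m (y : Y), ‖|derivWithin (T.h m) Y y| * f (T.branchMap m y)‖ ≤ M m * B :=
    fun m y => by
      rw [norm_mul, Real.norm_of_nonneg (abs_nonneg _)]
      exact mul_le_mul (hJ m y) (hB _) (norm_nonneg _) ((abs_nonneg _).trans (hJ m y))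
  have hgc : Continuous fun y : Y => ∑' m, |derivWithin (T.h m) Y y| * f (T.branchMap m y) :=
    continuous_tsum (fun m => (hJc m).mul (hf.comp (hHc m))) (hM.mul_right B) hterm
  rw [integ_eq_toReal_lintegral hgc fun y =>
      tsum_nonneg fun m => mul_nonneg (abs_nonneg _) (hf0 _), integ_eq_toReal_lintegral hf hf0]
  congr 1
  set p : ℝ → Y := projIcc 0 1 zero_le_one with hp
  have hpc : Continuous p := continuous_projIcc
  set F : ℝ → ℝ≥0∞ := fun x => ENNReal.ofReal (f (p x)) with hF
  have hpY : ∀ {x} (hx : x ∈ Y), p x = ⟨x, hx⟩ := fun {x} hx => projIcc_of_mem _ hx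
  have hUY : (⋃ m, Ioo (T.c m) (T.d m)) ⊆ Y :=
    iUnion_subset fun m => Ioo_subset_Icc_self.trans (T.Icc_subset m)
  have hae : (⋃ m, Ioo (T.c m) (T.d m)) =ᵐ[volume] Y := by
    rw [ae_eq_set]
    exact ⟨by rw [sdiff_eq_empty.2 hUY, measure_empty], T.null_compl⟩
  calc ∫⁻ x in Y, ENNReal.ofReal
        (∑' m, |derivWithin (T.h m) Y (p x)| * f (T.branchMap m (p x)))
      = ∫⁻ x in Y, ∑' m,
        ENNReal.ofReal (|derivWithin (T.h m) Y (p x)| * f (T.branchMap m (p x))) := by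
        refine lintegral_congr fun x => ?_
        exact ENNReal.ofReal_tsum_of_nonneg (fun m => mul_nonneg (abs_nonneg _) (hf0 _))
          (Summable.of_norm_bounded (hM.mul_right B) fun m => hterm m (p x))
    _ = ∑' m, ∫⁻ x in Y,
        ENNReal.ofReal (|derivWithin (T.h m) Y (p x)| * f (T.branchMap m (p x))) := by
        refine lintegral_tsum fun m => ?_
        exact (((hJc m).mul (hf.comp (hHc m))).comp hpc).measurable.ennreal_ofReal.aemeasurable
    _ = ∑' m, ∫⁻ x in Y, ENNReal.ofReal |derivWithin (T.h m) Y x| * F (T.h m x) := by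
        refine tsum_congr fun m => setLIntegral_congr_fun measurableSet_Icc fun x hx => ?_
        simp only [hF]
        rw [hpY hx, ENNReal.ofReal_mul (abs_nonneg _), hpY (T.h_mem m hx)]
        rfl
    _ = ∑' m, ∫⁻ x in Ioo (T.c m) (T.d m), F x := by
        refine tsum_congr fun m => ?_
        rw [← lintegral_image_eq_lintegral_abs_deriv_mul measurableSet_Icc
          (fun x hx => ((hT.differentiableOn_h m) x hx).hasDerivWithinAt)
          (T.bijOn_h m).injOn F, (T.bijOn_h m).image_eq, setLIntegral_congr Ioo_ae_eq_Icc]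
    _ = ∫⁻ x in ⋃ m, Ioo (T.c m) (T.d m), F x :=
        (lintegral_iUnion (fun m => measurableSet_Ioo) T.disjoint F).symm
    _ = ∫⁻ x in Y, F x := setLIntegral_congr hae

/-- The weighted system of a uniformly expanding map and a roof function. -/
noncomputable def toWeightedSystem [Countable ι] (hα : 0 < α) (hα' : α ≤ 1)
    (hT : T.IsUniformlyExpanding C₁ ρ₀) (hR : T.IsExpandingRoof C₁ R) (ε : ℝ) (hε : 0 < ε)
    (hs : Summable fun m : ι => Real.exp (ε * supNormOn (Ioo 0 1) (R ∘ T.h m)) *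
      supNormOn Y (derivWithin (T.h m) Y)) : WeightedSystem ι α C₁ ρ₀ where
  H := T.branchMap
  J m y := |derivWithin (T.h m) Y y|
  r m y := T.roofBranch R m y
  M m := Real.exp (ε * supNormOn (Ioo 0 1) (R ∘ T.h m)) * supNormOn Y (derivWithin (T.h m) Y)
  ε₀ := ε
  α_pos := hα
  α_le := hα'
  one_le_C := hT.one_le_C
  rho_pos := hT.rho_mem.1
  rho_lt := hT.rho_mem.2
  J_pos := jacobian_pos hT
  contracting := dist_wordMap_le hT
  distortion := jacobian_le_mul_exp hT
  roof_lipschitz := roofBranch_sub_le hT hR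
  ε₀_pos := hε
  summable_M := hs
  tail := exp_mul_jacobian_le hT hR hε
  integ_transfer _ hf hf0 := integ_transfer hα hT hs (fun m y =>
    (le_mul_of_one_le_left (abs_nonneg _) (Real.one_le_exp (by positivity))).trans
      (exp_mul_jacobian_le hT hR hε m y)) hf hf0

/-! ### Nonintegrability -/

theorem branch_mem_Ioo (hT : T.IsUniformlyExpanding C₁ ρ₀) (l : List ι) {y : ℝ}
    (hy : y ∈ Ioo (0 : ℝ) 1) : T.branch l y ∈ Ioo (0 : ℝ) 1 := by
  induction l with
  | nil => exact hy
  | cons m l ih =>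
    have h1 := h_mem_Ioo hT m ih
    have h2 := T.Icc_subset m (left_mem_Icc.2 (T.c_lt_d m).le)
    have h3 := T.Icc_subset m (right_mem_Icc.2 (T.c_lt_d m).le)
    exact ⟨h2.1.trans_lt h1.1, h1.2.trans_le h3.2⟩

/-- Birkhoff sums along the map are sums along words. -/
theorem birkhoffSum_branch (hT : T.IsUniformlyExpanding C₁ ρ₀) (hR : T.IsExpandingRoof C₁ R)
    (n : ℕ) (w : Word ι n) (y : Y) (hy : (y : ℝ) ∈ Ioo (0 : ℝ) 1) :
    birkhoffSum T.F R n (T.branch (wordList n w) y)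
      = wordSum T.branchMap (fun m (y : Y) => T.roofBranch R m y) n w y := by
  induction n with
  | zero => exact birkhoffSum_zero _ _ _
  | succ n ih =>
    obtain ⟨m, w⟩ := w
    have h1 := branch_mem_Ioo hT (wordList n w) hy
    change birkhoffSum T.F R (n + 1) (T.h m (T.branch (wordList n w) y))
      = T.roofBranch R m (wordMap T.branchMap n w y : Y) + wordSum T.branchMap _ n w y
    rw [birkhoffSum_succ', T.F_h m _ h1, ih w, ← branch_wordList, roofBranch_eq hT hR m h1]

/-- Nonintegrability makes the difference of two Birkhoff sums expand distances, by the mean value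
theorem. -/
theorem exists_words_of_UNI [Countable ι] (hα : 0 < α) (hα' : α ≤ 1)
    (hT : T.IsUniformlyExpanding C₁ ρ₀) (hR : T.IsExpandingRoof C₁ R) (ε : ℝ) (hε : 0 < ε)
    (hs : Summable fun m : ι => Real.exp (ε * supNormOn (Ioo 0 1) (R ∘ T.h m)) *
      supNormOn Y (derivWithin (T.h m) Y)) {D : ℝ} (hD : 0 < D) {n : ℕ} (h : T.UNI R D n) :
    ∃ w₁ w₂ : Word ι n, ∀ x y : Y, D * dist x y ≤
      |((toWeightedSystem hα hα' hT hR ε hε hs).birk n w₁ x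
          - (toWeightedSystem hα hα' hT hR ε hε hs).birk n w₂ x)
        - ((toWeightedSystem hα hα' hT hR ε hε hs).birk n w₁ y
          - (toWeightedSystem hα hα' hT hR ε hε hs).birk n w₂ y)| := by
  set S := toWeightedSystem hα hα' hT hR ε hε hs with hS
  obtain ⟨g₁, ⟨l₁, hl₁, rfl⟩, g₂, ⟨l₂, hl₂, rfl⟩, hg⟩ := h
  obtain ⟨w₁, hw₁⟩ := exists_wordList_eq hl₁
  obtain ⟨w₂, hw₂⟩ := exists_wordList_eq hl₂
  refine ⟨w₁, w₂, ?_⟩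
  set ψ : Y → ℝ := fun y => S.birk n w₁ y - S.birk n w₂ y with hψ
  have hψc : Continuous ψ := (S.continuous_birk n w₁).sub (S.continuous_birk n w₂)
  set p : ℝ → Y := projIcc 0 1 zero_le_one with hp
  set f : ℝ → ℝ := fun x => ψ (p x) with hf
  have hfc : Continuous f := hψc.comp continuous_projIcc
  have hpY : ∀ {x} (hx : x ∈ Y), p x = ⟨x, hx⟩ := fun {x} hx => projIcc_of_mem _ hx
  have hfd : ∀ x ∈ Ioo (0 : ℝ) 1, DifferentiableAt ℝ f x ∧ D ≤ |deriv f x| := by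
    intro x hx
    have h1 : (fun t => birkhoffSum T.F R n (T.branch l₁ t) - birkhoffSum T.F R n (T.branch l₂ t))
        =ᶠ[nhds x] f := by
      filter_upwards [Ioo_mem_nhds hx.1 hx.2] with t ht
      have htY := Ioo_subset_Icc_self ht
      have e1 := birkhoffSum_branch hT hR n w₁ ⟨t, htY⟩ ht
      have e2 := birkhoffSum_branch hT hR n w₂ ⟨t, htY⟩ ht
      rw [hw₁] at e1
      rw [hw₂] at e2
      simp only at e1 e2
      rw [e1, e2, hf]
      simp only
      rw [hpY htY]
      rfl
    have h2 := hg x hx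
    rw [h1.deriv_eq] at h2
    exact ⟨differentiableAt_of_deriv_ne_zero (abs_pos.1 (hD.trans_le h2)), h2⟩
  have hlt : ∀ x y : Y, (x : ℝ) < y → D * dist x y ≤ |ψ x - ψ y| := by
    intro x y hxy
    have hsub : Ioo (x : ℝ) y ⊆ Ioo 0 1 := Ioo_subset_Ioo x.2.1 y.2.2
    obtain ⟨z, hz, hz2⟩ := exists_deriv_eq_slope f hxy hfc.continuousOn
      fun t ht => (hfd t (hsub ht)).1.differentiableWithinAt
    have h1 := (hfd z (hsub hz)).2
    have e1 : f x = ψ x := by rw [hf]; simp only; rw [hpY x.2]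
    have e2 : f y = ψ y := by rw [hf]; simp only; rw [hpY y.2]
    rw [hz2, e1, e2, abs_div, le_div_iff₀ (abs_pos.2 (by linarith))] at h1
    rwa [Subtype.dist_eq, Real.dist_eq, abs_sub_comm, abs_sub_comm (ψ x)]
  intro x y
  change D * dist x y ≤ |ψ x - ψ y|
  rcases lt_trichotomy (x : ℝ) y with hxy | hxy | hxy
  · exact hlt x y hxy
  · rw [Subtype.ext hxy]
    simp
  · rw [dist_comm, abs_sub_comm]
    exact hlt y x hxy

end FullBranchMap

/-! ### Norms -/

theorem supNorm_le_iff {v : Y → ℂ} {B : ℝ} (hB : 0 ≤ B) :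
    supNorm v ≤ ENNReal.ofReal B ↔ ∀ y, ‖v y‖ ≤ B := by
  rw [supNorm, iSup_le_iff]
  refine forall_congr' fun y => ?_
  rw [← ofReal_norm, ENNReal.ofReal_le_ofReal_iff hB]

theorem holderSeminorm_le_iff {α : ℝ} (hα : 0 < α) {v : Y → ℂ} {L : ℝ} (hL : 0 ≤ L) :
    holderSeminorm α v ≤ ENNReal.ofReal L ↔ ∀ x y, ‖v x - v y‖ ≤ L * dist x y ^ α := by
  simp only [holderSeminorm, iSup_le_iff]
  refine forall_congr' fun x => forall_congr' fun y => ?_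
  rcases eq_or_ne x y with rfl | hxy
  · simp [Real.zero_rpow hα.ne']
  · have hd : 0 < |(x : ℝ) - y| ^ α :=
      Real.rpow_pos_of_pos (abs_pos.2 (sub_ne_zero.2 fun h => hxy (Subtype.ext h))) _
    simp only [hxy, ne_eq, not_false_eq_true, forall_true_left]
    rw [ENNReal.div_le_iff (ENNReal.ofReal_pos.2 hd).ne' ENNReal.ofReal_ne_top,
      ← ENNReal.ofReal_mul hL, ← ofReal_norm, ENNReal.ofReal_le_ofReal_iff (by positivity)]
    rfl

theorem mem_holderSpace_iff {α : ℝ} (hα : 0 < α) {v : Y → ℂ} :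
    v ∈ holderSpace α ↔ ∃ B L : ℝ, 0 ≤ L ∧ (∀ y, ‖v y‖ ≤ B) ∧
      ∀ x y, ‖v x - v y‖ ≤ L * dist x y ^ α := by
  constructor
  · intro h
    obtain ⟨h1, h2⟩ := max_lt_iff.1 (show max (supNorm v) (holderSeminorm α v) < ∞ from h)
    refine ⟨(supNorm v).toReal, (holderSeminorm α v).toReal, ENNReal.toReal_nonneg,
      (supNorm_le_iff ENNReal.toReal_nonneg).1 ?_,
      (holderSeminorm_le_iff hα ENNReal.toReal_nonneg).1 ?_⟩
    · rw [ENNReal.ofReal_toReal h1.ne]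
    · rw [ENNReal.ofReal_toReal h2.ne]
  · rintro ⟨B, L, hL, h1, h2⟩
    have hB : 0 ≤ B := (norm_nonneg _).trans (h1 ⟨0, by simp⟩)
    exact max_lt (((supNorm_le_iff hB).2 h1).trans_lt ENNReal.ofReal_lt_top)
      (((holderSeminorm_le_iff hα hL).2 h2).trans_lt ENNReal.ofReal_lt_top)

theorem normB_le_iff {α b : ℝ} (hα : 0 < α) {v : Y → ℂ} {g : ℝ} (hg : 0 ≤ g) :
    normB α b v ≤ ENNReal.ofReal g ↔ (∀ y, ‖v y‖ ≤ g) ∧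
      ∀ x y, ‖v x - v y‖ ≤ g * (1 + |b| ^ α) * dist x y ^ α := by
  have hb : 0 < 1 + |b| ^ α := by positivity
  rw [normB, max_le_iff, supNorm_le_iff hg,
    ENNReal.div_le_iff (ENNReal.ofReal_pos.2 hb).ne' ENNReal.ofReal_ne_top,
    ← ENNReal.ofReal_mul hg, holderSeminorm_le_iff hα (by positivity)]

/-! ### Decay of the twisted transfer operators -/

/-- The numerical value of the bound on the contraction of the branches; `0.066` is what
`exists_mem_cancelSet` requires for opposite terms to stay nearly opposite. -/
theorem quarter_sqrt_le :
    1 / 4 * Real.sqrt (2 - 2 * Real.cos (Real.pi / 12)) ≤ 0.066 := by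
  have h1 := Real.one_sub_sq_div_two_le_cos (x := Real.pi / 12)
  have h2 := Real.pi_lt_d2
  have h3 := Real.pi_pos
  have h4 : Real.sqrt (2 - 2 * Real.cos (Real.pi / 12)) ≤ 0.264 := by
    rw [Real.sqrt_le_left (by norm_num)]
    nlinarith
  linarith

theorem twelve_le_coneConst {α C₁ ρ₀ : ℝ} (hα : 0 < α) (hC : 1 ≤ C₁) (hρ0 : 0 < ρ₀)
    (hρ1 : ρ₀ < 1) : 12 ≤ coneConst α C₁ ρ₀ := by
  have h1 : 0 ≤ roofConst C₁ ρ₀ := div_nonneg (by positivity) (by linarith)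
  have h2 : 0 ≤ distortionConst α C₁ ρ₀ :=
    div_nonneg (by positivity) (by linarith [Real.rpow_lt_one hρ0.le hρ1 hα])
  have h3 : 0 ≤ weightConst α C₁ ρ₀ := add_nonneg h1 h2
  have h4 : 0 ≤ weightConst α C₁ ρ₀ * Real.exp (weightConst α C₁ ρ₀) := by positivity
  unfold coneConst
  linarith [Real.exp_pos (weightConst α C₁ ρ₀)]

end ExpandingSemiflow

theorem mainTheorem4 {ι : Type*} [Countable ι] (α : ℝ) (hα : 0 < α) (hα' : α ≤ 1) (C₁ ρ₀ : ℝ)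
    (T : ExpandingSemiflow.FullBranchMap α ι) (hT : T.IsUniformlyExpanding C₁ ρ₀) :
    ∃ C₃ C₄ : ℝ, 1 < C₃ ∧ 6 * C₃ ≤ C₄ ∧
      ∀ R : ℝ → ℝ, T.IsExpandingRoof C₁ R →
      ∀ D : ℝ, 0 < D → ∀ n₀ : ℕ, 1 ≤ n₀ →
        ExpandingSemiflow.SufficientlyLarge α C₁ ρ₀ C₃ C₄ D n₀ → T.UNI R D n₀ →
      ∃ ε ∈ Set.Ioo (0 : ℝ) 1, ∃ γ ∈ Set.Ioo (0 : ℝ) 1, ∃ A : ℝ, 0 < A ∧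
        (∀ s : ℂ, |s.re| < ε → ∀ v ∈ ExpandingSemiflow.holderSpace α,
          (∀ y, Summable fun m => T.branchOperator R s m v y) ∧
            T.transferOperator R s v ∈ ExpandingSemiflow.holderSpace α) ∧
        ∀ s : ℂ, |s.re| < ε → max (4 * Real.pi / D) 2 ≤ |s.im| →
          ∀ n : ℕ, A * Real.log |s.im| ≤ n →
            ExpandingSemiflow.opNormB α s.im ((T.transferOperator R s)^[n])
              ≤ ENNReal.ofReal (γ ^ n) := by
  -- `C₄` is the aperture of the cone, which depends on `R` through the constant `C₁` only
  open ExpandingSemiflow ExpandingSemiflow.FullBranchMap ExpandingSemiflow.WeightedSystem in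
  refine ⟨2, coneConst α C₁ ρ₀, one_lt_two, by
    linarith [twelve_le_coneConst hα hT.one_le_C hT.rho_mem.1 hT.rho_mem.2], ?_⟩
  intro R hR D hD n₀ hn₀ hlarge hUNI
  obtain ⟨ε₀, hε₀, hsum⟩ := hR.exp_tail
  obtain ⟨w₁, w₂, huni⟩ := exists_words_of_UNI hα hα' hT hR ε₀ hε₀ hsum hD hUNI
  set S := toWeightedSystem hα hα' hT hR ε₀ hε₀ hsum with hS
  have hn : C₁ ^ α * coneConst α C₁ ρ₀ * (ρ₀ ^ α) ^ n₀ ≤ 1 / 2 := by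
    have h1 := hlarge.large₂
    have h2 : 0 < (ρ₀ ^ α) ^ n₀ := pow_pos S.rho_rpow_pos _
    linarith
  have hn' := hlarge.large₁.trans quarter_sqrt_le
  obtain ⟨ε, hε, hεS, γ, hγ, A, hA, hmain⟩ := S.exists_rate hD hn₀ hn hn' huni
  have hop : ∀ s v, T.transferOperator R s v = S.P s 1 v := fun s v => (wordOp_one _ _ _).symm
  refine ⟨ε, hε, γ, hγ, A, hA, fun s hs v hv => ?_, fun s hs hb n hn => ?_⟩
  · obtain ⟨B, L, hL0, hB, hL⟩ := (mem_holderSpace_iff hα).1 hv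
    have hs0 : |s.re| ≤ S.ε₀ := hs.le.trans hεS
    have hs1 : |s.re| ≤ 1 := (hs.trans hε.2).le
    refine ⟨fun y => ?_, ?_⟩
    · refine Summable.of_norm_bounded (S.summable_M.mul_right B) fun m => ?_
      change ‖S.cweight s m y * v (S.H m y)‖ ≤ _
      rw [norm_mul]
      exact mul_le_mul (S.norm_cweight_le hs0 m y) (hB _) (norm_nonneg _) (S.M_nonneg m)
    · rw [hop]
      obtain ⟨B', hB'⟩ := P_bounded hs0 hB 1
      obtain ⟨g, hg⟩ := Q_bounded (S := S) (u := fun _ => 1) (B := 1) hs0 (by simp) 1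
      have hB0 : 0 ≤ B := (norm_nonneg _).trans (hB ⟨0, by simp⟩)
      have hX : 0 ≤ phaseConst α C₁ ρ₀ s.im * B + Real.exp (weightConst α C₁ ρ₀) *
          (L * (C₁ ^ α * (ρ₀ ^ α) ^ 1)) := by
        have h1 := S.phaseConst_nonneg s.im
        have h2 := S.C_rpow_pos
        have h3 := S.rho_rpow_pos
        positivity
      have hg0 : 0 ≤ g := (abs_nonneg _).trans (hg ⟨0, by simp⟩)
      refine (mem_holderSpace_iff hα).2 ⟨B', _, mul_nonneg hg0 hX, hB', fun x y => ?_⟩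
      refine (norm_P_sub_le hs0 hs1 hB hL0 hL 1 x y).trans ?_
      rw [← mul_assoc]
      exact mul_le_mul_of_nonneg_right (mul_le_mul_of_nonneg_right
        ((le_abs_self _).trans (hg y)) hX) (Real.rpow_nonneg dist_nonneg _)
  · refine iSup₂_le fun v hv => ?_
    have hv' : normB α s.im v ≤ ENNReal.ofReal 1 := by rwa [ENNReal.ofReal_one]
    obtain ⟨hv1, hv2⟩ := (normB_le_iff hα zero_le_one).1 hv'
    have hit : (T.transferOperator R s)^[n] v = S.P s n v := by
      have e : T.transferOperator R s = wordOp S.H (S.cweight s) 1 := funext fun v => hop s v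
      rw [e]
      exact iterate_wordOp (S.norm_cweight_le (hs.le.trans hεS)) S.summable_M hv1 n
    rw [hit, normB_le_iff hα (pow_nonneg hγ.1.le n)]
    exact hmain s hs ((le_max_left _ _).trans hb) ((le_max_right _ _).trans hb) n hn v hv1
      (by simpa using hv2)
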